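/- Let $\mathbb H,\mathbb U$ be real Hilbert spaces, let $(S(t))_{t\in\mathbb R}$ be a strongly continuous group on $\mathbb H$ with infinitesimal generator $A$, and let $D(A^*)$ carry its graph scalar product. Let $B\in\mathcal L(\mathbb U,D(A^*)')$, where the dual is taken with pivot space $\mathbb H$, with adjoint $B^*\in\mathcal L(D(A^*),\mathbb U)$. Assume that $B$ is admissible: for all $T>0$ and $u\in L^2((0,T);\mathbb U)$, the function $t\mapsto\int_0^tS(t-s)Bu(s)\,ds$ (an integral in $D(A^*)'$) belongs to $C([0,T];\mathbb H)$. Let $Q\in\mathcal L(\mathbb H)$ be symmetric, invertible and coercive, and let $R\in\mathcal L(\mathbb H)$ and $W\in\mathcal L(\mathbb U)$ be symmetric and non-negative. Let $\lambda>0$ and assume $AQ+QA^*-BWB^*+QRQ+2\lambda Q=0$ in the sense that, for all $x,x'\in D(A^*)$, $$\langle Qx,A^*x'\rangle+\langle A^*x,Qx'\rangle-\langle WB^*x,B^*x'\rangle_{\mathbb U}+\langle RQx,Qx'\rangle+2\lambda\langle Qx,x'\rangle=0 .$$ Let $f:\mathbb H\to\mathbb H$ be continuous, Lipschitz in a neighbourhood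 of $0$, and such that for every $\eta>0$ there is $\delta>0$ with $\|f(x)\|\le\eta\|x\|$ whenever $\|x\|<\delta$. Consider $$\begin{cases}y'=Ay+f(y)-BWB^*\tilde y,\\ \tilde y'=-A^*\tilde y-2\lambda\tilde y-RQ\tilde y+Q^{-1}f(Q\tilde y),\\ y(0)=y_0,\quad \tilde y(0)=Q^{-1}y_0.\end{cases}\qquad(\ast)$$ A weak solution of $(\ast)$ on $[0,T]$ is a pair $(y,\tilde y)\in C([0,T];\mathbb H)^2$ that satisfies the initial conditions and, in the sense of distributions in $(0,T)$, for all $\varphi\in D(A^*)$ and $\psi\in D(A)$, $$\tfrac{d}{dt}\langle y,\varphi\rangle=\langle y,A^*\varphi\rangle+\langle f(y),\varphi\rangle-\langle WB^*\tilde y,B^*\varphi\rangle_{\mathbb U},$$ $$\tfrac{d}{dt}\langle\tilde y,\psi\rangle=-\langle\tilde y,A\psi\rangle+\langle-2\lambda\tilde y-RQ\tilde y+Q^{-1}f(Q\tilde y),\psi\rangle .$$ Here $B^*\tilde y\in L^2((0,T);\mathbb U)$ is the observation of $\tilde y$, i.e. the function $v$ with $\int_a^bv\,ds=B^*\int_a^b\tilde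 y\,ds$ for all $0\le a\le b\le T$, where $\int_a^b\tilde y\,ds\in D(A^*)$. A global weak solution is a pair that is a weak solution on $[0,T]$ for every $T>0$. Then there exists $\varepsilon>0$ such that for every $y_0\in\mathbb H$ with $\|y_0\|\le\varepsilon$ there is a global weak solution $(y,\tilde y)$ of $(\ast)$, it is unique (every weak solution on any $[0,T]$ is its restriction), it satisfies $\tilde y(t)=Q^{-1}y(t)$ for $t\ge0$, and for all $t\ge\tau\ge0$ $$\|Q^{-1/2}y(t)\|^2-\|Q^{-1/2}y(\tau)\|^2=-2\lambda\int_\tau^t\|Q^{-1/2}y(s)\|^2ds-\int_\tau^t\Big(\|W^{1/2}B^*\tilde y(s)\|_{\mathbb U}^2+\|R^{1/2}y(s)\|^2\Big)ds+2\int_\tau^t\langle f(y(s)),Q^{-1}y(s)\rangle\,ds .$$ Moreover, for every $\gamma<\lambda$ there exists $\varepsilon_\gamma\in(0,\varepsilon]$ such that, if $\|y_0\|\le\varepsilon_\gamma$, then $$\|Q^{-1/2}y(t)\|\le e^{-\gamma t}\|Q^{-1/2}y_0\|\qquad\text{for all }t\ge0 .$$ -/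

import Mathlib

open MeasureTheory Set Filter Topology
open scoped ContDiff InnerProductSpace LinearPMap

noncomputable section

namespace StaticFeedback

/-! ### Strongly continuous groups and their generators -/

/-- A strongly continuous group of bounded operators on `H`. -/
structure C0Group (H : Type*) [NormedAddCommGroup H] [InnerProductSpace ℝ H] where
  op : ℝ → H →L[ℝ] H
  op_zero : op 0 = ContinuousLinearMap.id ℝ H
  op_add : ∀ s t : ℝ, op (s + t) = (op s).comp (op t)
  tendsto_zero : ∀ x : H, Tendsto (fun t => op t x) (𝓝 0) (𝓝 x)

variable {H : Type*} [NormedAddCommGroup H] [InnerProductSpace ℝ H]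

namespace C0Group

/-- The domain of the infinitesimal generator: all `x` for which `(S(t)x - x)/t` converges as
`t → 0`. -/
def generatorDomain (S : C0Group H) : Submodule ℝ H where
  carrier := {x | ∃ z, Tendsto (fun t : ℝ => t⁻¹ • (S.op t x - x)) (𝓝[≠] 0) (𝓝 z)}
  zero_mem' := ⟨0, by simp⟩
  add_mem' := by
    rintro x y ⟨z, hz⟩ ⟨w, hw⟩
    refine ⟨z + w, (hz.add hw).congr fun t => ?_⟩
    rw [map_add, ← smul_add]
    congr 1
    abel
  smul_mem' := by
    rintro c x ⟨z, hz⟩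
    refine ⟨c • z, (hz.const_smul c).congr fun t => ?_⟩
    rw [map_smul, ← smul_sub, smul_comm]

/-- The infinitesimal generator `A` of `S`: `A x = lim (S(t)x - x)/t` as `t → 0`. -/
def generator (S : C0Group H) : H →ₗ.[ℝ] H where
  domain := S.generatorDomain
  toFun :=
    { toFun := fun x => x.2.choose
      map_add' := fun x y => by
        refine tendsto_nhds_unique (x + y).2.choose_spec
          ((x.2.choose_spec.add y.2.choose_spec).congr fun t => ?_)
        rw [Submodule.coe_add, map_add, ← smul_add]
        congr 1
        abel
      map_smul' := fun c x => by
        refine tendsto_nhds_unique (c • x).2.choose_spec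
          ((x.2.choose_spec.const_smul c).congr fun t => ?_)
        rw [Submodule.coe_smul, map_smul, ← smul_sub, smul_comm] }

theorem tendsto_generator (S : C0Group H) (x : S.generator.domain) :
    Tendsto (fun t : ℝ => t⁻¹ • (S.op t x - x)) (𝓝[≠] 0) (𝓝 (S.generator x)) :=
  Exists.choose_spec x.2

theorem generator_eq (S : C0Group H) (x : S.generator.domain) {z : H}
    (hz : Tendsto (fun t : ℝ => t⁻¹ • (S.op t x - x)) (𝓝[≠] 0) (𝓝 z)) :
    S.generator x = z :=
  tendsto_nhds_unique (S.tendsto_generator x) hz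

theorem tendsto_op (S : C0Group H) (s : ℝ) (x : S.generator.domain) :
    Tendsto (fun t : ℝ => t⁻¹ • (S.op t (S.op s x) - S.op s x)) (𝓝[≠] 0)
      (𝓝 (S.op s (S.generator x))) := by
  refine (((S.op s).continuous.tendsto _).comp (S.tendsto_generator x)).congr fun t => ?_
  have h : S.op t (S.op s (x : H)) = S.op s (S.op t (x : H)) := by
    rw [← ContinuousLinearMap.comp_apply, ← ContinuousLinearMap.comp_apply, ← S.op_add,
      ← S.op_add, add_comm]
  simp only [Function.comp_apply, map_smul, map_sub, h]

/-- The group leaves the domain of its generator invariant and commutes with it. -/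
theorem op_mem_domain (S : C0Group H) (s : ℝ) (x : S.generator.domain) :
    S.op s x ∈ S.generator.domain :=
  ⟨_, S.tendsto_op s x⟩

theorem generator_op (S : C0Group H) (s : ℝ) (x : S.generator.domain) :
    S.generator ⟨S.op s x, S.op_mem_domain s x⟩ = S.op s (S.generator x) :=
  S.generator_eq _ (S.tendsto_op s x)

theorem continuous_orbit (S : C0Group H) (x : H) : Continuous fun t => S.op t x := by
  rw [continuous_iff_continuousAt]
  intro s
  have h1 : Tendsto (fun t : ℝ => t - s) (𝓝 s) (𝓝 0) := by
    have : Continuous fun t : ℝ => t - s := by fun_prop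
    simpa using this.tendsto s
  have h2 := ((S.op s).continuous.tendsto x).comp ((S.tendsto_zero x).comp h1)
  refine h2.congr fun t => ?_
  simp only [Function.comp_apply]
  rw [← ContinuousLinearMap.comp_apply, ← S.op_add]
  congr 2
  ring

/-- The generator is densely defined. -/
theorem dense_domain [CompleteSpace H] (S : C0Group H) :
    Dense (S.generator.domain : Set H) := by
  intro x
  have hc := S.continuous_orbit x
  have hint : ∀ a b : ℝ, IntervalIntegrable (fun s => S.op s x) volume a b :=
    fun a b => hc.intervalIntegrable a b
  have hder : ∀ h : ℝ, HasDerivAt (fun t : ℝ => ∫ s in (0 : ℝ)..t, S.op s x) (S.op h x) h :=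
    fun h => intervalIntegral.integral_hasDerivAt_right (hint 0 h)
      (hc.stronglyMeasurableAtFilter _ _) hc.continuousAt
  have hmem : ∀ h : ℝ, (∫ s in (0 : ℝ)..h, S.op s x) ∈ S.generator.domain := by
    intro h
    refine ⟨S.op h x - S.op 0 x, ?_⟩
    have h1 := (hasDerivAt_iff_tendsto_slope_zero.1 (hder h)).sub
      (hasDerivAt_iff_tendsto_slope_zero.1 (hder 0))
    refine h1.congr fun t => ?_
    have h2 : S.op t (∫ s in (0 : ℝ)..h, S.op s x) = ∫ s in t..(h + t), S.op s x := by
      rw [← ContinuousLinearMap.intervalIntegral_comp_comm _ (hint 0 h)]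
      have h3 : ∀ s : ℝ, S.op t (S.op s x) = S.op (s + t) x := fun s => by
        rw [← ContinuousLinearMap.comp_apply, ← S.op_add, add_comm]
      simp only [h3]
      rw [intervalIntegral.integral_comp_add_right (fun s => S.op s x) t, zero_add]
    have h4 : (∫ s in t..(h + t), S.op s x)
        = (∫ s in (0 : ℝ)..(h + t), S.op s x) - ∫ s in (0 : ℝ)..t, S.op s x := by
      rw [intervalIntegral.integral_interval_sub_left (hint _ _) (hint _ _)]
    rw [h2, h4, zero_add, intervalIntegral.integral_same, ← smul_sub]
    congr 1
    abel
  have hlim : Tendsto (fun t : ℝ => t⁻¹ • ∫ s in (0 : ℝ)..t, S.op s x) (𝓝[≠] 0) (𝓝 x) := by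
    have h1 := hasDerivAt_iff_tendsto_slope_zero.1 (hder 0)
    rw [S.op_zero] at h1
    refine h1.congr fun t => ?_
    rw [zero_add, intervalIntegral.integral_same, sub_zero]
  exact mem_closure_of_tendsto hlim
    (Eventually.of_forall fun t => S.generator.domain.smul_mem _ (hmem t))

variable [CompleteSpace H]

/-! ### The Hilbert space `D(A*)`, its dual, and control operators -/

/-- The Hilbert space `D(A*)` with the scalar product `⟪φ, ψ⟫ + ⟪A* φ, A* ψ⟫`, realised as the
graph of the adjoint `A*` of the generator inside the Hilbert space `H × H`: its elements are the
pairs `(φ, A* φ)`. -/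
abbrev adjDomain (S : C0Group H) : Submodule ℝ (WithLp 2 (H × H)) :=
  (S.generator†).graph.map (WithLp.linearEquiv 2 ℝ (H × H)).symm.toLinearMap

/-- The inclusion `D(A*) → H`. -/
def incl (S : C0Group H) (φ : S.adjDomain) : H := (φ : WithLp 2 (H × H)).fst

/-- The operator `A* : D(A*) → H`. -/
def adjGen (S : C0Group H) (φ : S.adjDomain) : H := (φ : WithLp 2 (H × H)).snd

theorem mem_graph (S : C0Group H) (φ : S.adjDomain) :
    (S.incl φ, S.adjGen φ) ∈ (S.generator†).graph := by
  obtain ⟨p, hp, hpφ⟩ := φ.2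
  have h : WithLp.ofLp (φ : WithLp 2 (H × H)) = p := by
    rw [← hpφ]
    rfl
  have h' : (S.incl φ, S.adjGen φ) = p := by
    rw [← h]
    rfl
  rw [h']
  exact hp

theorem incl_mem (S : C0Group H) (φ : S.adjDomain) : S.incl φ ∈ (S.generator†).domain :=
  LinearPMap.mem_domain_of_mem_graph (S.mem_graph φ)

/-- `adjGen` is Mathlib's adjoint of the generator. -/
theorem adjGen_eq (S : C0Group H) (φ : S.adjDomain) :
    S.adjGen φ = S.generator† ⟨S.incl φ, S.incl_mem φ⟩ :=
  ((S.generator†).image_iff (S.incl_mem φ)).2 (S.mem_graph φ)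

/-- The scalar product of `D(A*)`. -/
theorem inner_adjDomain (S : C0Group H) (φ ψ : S.adjDomain) :
    ⟪φ, ψ⟫_ℝ = ⟪S.incl φ, S.incl ψ⟫_ℝ + ⟪S.adjGen φ, S.adjGen ψ⟫_ℝ := by
  rw [Submodule.coe_inner, WithLp.prod_inner_apply]
  rfl

/-- The operator `S(t)*` maps `D(A*)` to itself and commutes with `A*`. -/
theorem adjoint_mem (S : C0Group H) (t : ℝ) (φ : S.adjDomain) :
    WithLp.toLp 2 ((S.op t).adjoint (S.incl φ), (S.op t).adjoint (S.adjGen φ)) ∈ S.adjDomain := by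
  refine ⟨((S.op t).adjoint (S.incl φ), (S.op t).adjoint (S.adjGen φ)), ?_, rfl⟩
  have hd := S.dense_domain
  have hg := S.mem_graph φ
  rw [SetLike.mem_coe]
  rw [LinearPMap.adjoint_graph_eq_graph_adjoint hd, Submodule.mem_adjoint_iff] at hg ⊢
  intro a b hab
  obtain ⟨y, rfl, rfl⟩ := (LinearPMap.mem_graph_iff _).1 hab
  rw [ContinuousLinearMap.adjoint_inner_right, ContinuousLinearMap.adjoint_inner_right,
    ← S.generator_op t y]
  exact hg _ _ (LinearPMap.mem_graph _ (⟨S.op t y, S.op_mem_domain t y⟩ : S.generator.domain))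

/-- The restriction of `S(t)*` to `D(A*)`. -/
def adjOp (S : C0Group H) (t : ℝ) (φ : S.adjDomain) : S.adjDomain :=
  ⟨WithLp.toLp 2 ((S.op t).adjoint (S.incl φ), (S.op t).adjoint (S.adjGen φ)), S.adjoint_mem t φ⟩

end C0Group

variable [CompleteSpace H]
variable {U : Type*} [NormedAddCommGroup U] [InnerProductSpace ℝ U] [CompleteSpace U]

/-- The adjoint `B* : D(A*) → U` of `B ∈ L(U, D(A*)')`, given by `⟪u, B* φ⟫ = (B u)(φ)`. -/
def ctrlAdj (S : C0Group H) (B : U →L[ℝ] StrongDual ℝ S.adjDomain) (φ : S.adjDomain) : U :=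
  (InnerProductSpace.toDual ℝ U).symm (B.flip φ)

theorem inner_ctrlAdj (S : C0Group H) (B : U →L[ℝ] StrongDual ℝ S.adjDomain) (u : U)
    (φ : S.adjDomain) : ⟪u, ctrlAdj S B φ⟫_ℝ = B u φ := by
  rw [real_inner_comm, ctrlAdj, InnerProductSpace.toDual_symm_apply]
  rfl

/-- `B` is an admissible control operator: for every `u ∈ L²((0,T); U)` the function
`Φ(t) = ∫₀ᵗ S(t - s) B u(s) ds`, where the group and the integral are taken in `D(A*)'`, belongs
to `C([0,T]; H)`. -/
def IsAdmissible (S : C0Group H) (B : U →L[ℝ] StrongDual ℝ S.adjDomain) : Prop :=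
  ∀ T : ℝ, 0 < T → ∀ u : ℝ → U, MemLp u 2 (volume.restrict (Ioo 0 T)) →
    ∃ Φ : ℝ → H, ContinuousOn Φ (Icc 0 T) ∧ ∀ t ∈ Icc 0 T, ∀ ψ : S.adjDomain,
      ⟪Φ t, S.incl ψ⟫_ℝ = ∫ s in (0 : ℝ)..t, B (u s) (S.adjOp (t - s) ψ)

/-! ### Bounded operators -/

/-- `T` is symmetric and non-negative. -/
def IsNonnegSymm {X : Type*} [NormedAddCommGroup X] [InnerProductSpace ℝ X]
    (T : X →L[ℝ] X) : Prop :=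
  (∀ x y : X, ⟪T x, y⟫_ℝ = ⟪x, T y⟫_ℝ) ∧ ∀ x : X, 0 ≤ ⟪T x, x⟫_ℝ

/-- `T` is symmetric and positive, i.e. coercive. -/
def IsPosSymm {X : Type*} [NormedAddCommGroup X] [InnerProductSpace ℝ X]
    (T : X →L[ℝ] X) : Prop :=
  (∀ x y : X, ⟪T x, y⟫_ℝ = ⟪x, T y⟫_ℝ) ∧ ∃ c : ℝ, 0 < c ∧ ∀ x : X, c * ‖x‖ ^ 2 ≤ ⟪T x, x⟫_ℝ

open scoped Classical in
/-- The square root `T^{1/2}` of a symmetric non-negative operator on a Hilbert space: the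
(unique) symmetric non-negative operator `P` with `P ∘ P = T`. -/
def opSqrt {X : Type*} [NormedAddCommGroup X] [InnerProductSpace ℝ X]
    (T : X →L[ℝ] X) : X →L[ℝ] X :=
  if h : ∃ P : X →L[ℝ] X, IsNonnegSymm P ∧ P.comp P = T then h.choose else 0

/-- The operator identity `A Q + Q A* - B W B* + Q R Q + 2 λ Q = 0`, tested on `D(A*)`. -/
def OperatorIdentity (S : C0Group H) (B : U →L[ℝ] StrongDual ℝ S.adjDomain)
    (Q R : H →L[ℝ] H) (W : U →L[ℝ] U) (lam : ℝ) : Prop :=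
  ∀ φ ψ : S.adjDomain,
    ⟪Q (S.incl φ), S.adjGen ψ⟫_ℝ + ⟪S.adjGen φ, Q (S.incl ψ)⟫_ℝ
      - ⟪W (ctrlAdj S B φ), ctrlAdj S B ψ⟫_ℝ
      + ⟪R (Q (S.incl φ)), Q (S.incl ψ)⟫_ℝ
      + 2 * lam * ⟪Q (S.incl φ), S.incl ψ⟫_ℝ = 0

/-! ### Weak solutions -/

/-- `u' = h` in the sense of distributions in `(0, T)`, with `u, h ∈ L¹(0, T)`. -/
def HasDistribDeriv (T : ℝ) (u h : ℝ → ℝ) : Prop :=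
  IntegrableOn u (Ioo 0 T) ∧ IntegrableOn h (Ioo 0 T) ∧
    ∀ θ : ℝ → ℝ, ContDiff ℝ ∞ θ → HasCompactSupport θ → tsupport θ ⊆ Ioo 0 T →
      ∫ t in Ioo 0 T, u t * deriv θ t = - ∫ t in Ioo 0 T, h t * θ t

/-- `v ∈ L²((0,T); U)` is the observation `B* z` of the trajectory `z ∈ C([0,T]; H)`.

For a weak solution `z` of `z' = -A* z + h` with `h ∈ L¹((0,T); H)`, the integral of `z` over any
`[a, b] ⊆ [0, T]` lies in `D(A*)`, although `z(t)` itself need not. The function `B* z` is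
the one whose integral over every `[a, b]` is `B*` applied to the integral of `z`; this
determines `v` almost everywhere. It agrees with `t ↦ B* (z t)` if `z ∈ C([0,T]; D(A*))`, and it is
preserved when solutions `zₙ` with data `(zₙ(0), hₙ)` convergent in `H × L¹((0,T); H)` have
observations convergent in `L²((0,T); U)`. Thus it is the extension by density of the
observation from smooth data to all data in `H × L¹((0,T); H)`. -/
def IsObservation (S : C0Group H) (B : U →L[ℝ] StrongDual ℝ S.adjDomain) (T : ℝ)
    (z : ℝ → H) (v : ℝ → U) : Prop :=
  MemLp v 2 (volume.restrict (Ioo 0 T)) ∧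
    ∀ a b : ℝ, 0 ≤ a → a ≤ b → b ≤ T → ∃ φ : S.adjDomain,
      S.incl φ = ∫ s in a..b, z s ∧ ctrlAdj S B φ = ∫ s in a..b, v s

/-- `(y, z) ∈ C([0,T]; H)²` is a weak solution of
`y' = A y + g - B W B* z`, `z' = -A* z + h` in `(0, T)`, `y(0) = y₀`, `z(0) = z₀`.
The first equation is tested with `φ ∈ D(A*)`, the second with `ψ ∈ D((-A*)*) = D(A)`. -/
structure IsWeakSolution (S : C0Group H) (B : U →L[ℝ] StrongDual ℝ S.adjDomain) (W : U →L[ℝ] U)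
    (T : ℝ) (g h : ℝ → H) (y₀ z₀ : H) (y z : ℝ → H) : Prop where
  continuousOn_fst : ContinuousOn y (Icc 0 T)
  continuousOn_snd : ContinuousOn z (Icc 0 T)
  init_fst : y 0 = y₀
  init_snd : z 0 = z₀
  eq_fst : ∃ v : ℝ → U, IsObservation S B T z v ∧ ∀ φ : S.adjDomain,
    HasDistribDeriv T (fun t => ⟪y t, S.incl φ⟫_ℝ)
      (fun t => ⟪y t, S.adjGen φ⟫_ℝ + ⟪g t, S.incl φ⟫_ℝ - ⟪W (v t), ctrlAdj S B φ⟫_ℝ)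
  eq_snd : ∀ ψ : S.generator.domain,
    HasDistribDeriv T (fun t => ⟪z t, (ψ : H)⟫_ℝ)
      (fun t => -⟪z t, S.generator ψ⟫_ℝ + ⟪h t, (ψ : H)⟫_ℝ)

/-- `(y, z)` is a weak solution in `[0, T]` of the nonlinear closed-loop system
`y' = A y + f(y) - B W B* z`, `z' = -A* z - 2 λ z - R Q z + Q⁻¹ f(Q z)`,
`y(0) = y₀`, `z(0) = Q⁻¹ y₀`. -/
def IsClosedLoopSolution (S : C0Group H) (B : U →L[ℝ] StrongDual ℝ S.adjDomain)
    (Q : H ≃L[ℝ] H) (R : H →L[ℝ] H) (W : U →L[ℝ] U) (lam : ℝ) (f : H → H)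
    (T : ℝ) (y₀ : H) (y z : ℝ → H) : Prop :=
  IsWeakSolution S B W T (fun t => f (y t))
    (fun t => -((2 * lam) • z t) - R (Q (z t)) + Q.symm (f (Q (z t)))) y₀ (Q.symm y₀) y z

end StaticFeedback

end

open StaticFeedback

namespace StaticFeedback

/-! ### Square roots of non-negative operators -/

/-! The operator identity says that `Q` intertwines the two equations. Formally AQ = -QA* + BWB* -
QRQ - 2λQ, so if z solves z' = -A*z - 2λz - RQz + Q⁻¹g, then y = Qz solves y' = Ay + g - BWB*z: the
unbounded feedback term is produced by the identity and never has to be solved for. The closed loop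
collapses to the equation for z, which contains no control operator and is a bounded Lipschitz
perturbation of the group S(-t)*, solvable by variation of constants (`exists_isMild`). The
intertwining is `IsMild.inner_eq_integral`; it is carried out after integration in time, because ∫z
lies in D(A*) while z(t) need not.

The Lyapunov function is ⟨Qz, z⟩ = ‖Q^{-1/2}y‖². Its balance would follow from the identity at φ = ψ
= z(t), which is again not allowed. The identity is therefore used at `S.smooth n (z t)`, a short
time average of the dual orbit, which commutes with A* (`IsMild.smooth_energy`), and n tends to
infinity (`IsMild.energy`). The limit of the B* terms is where admissibility enters. By duality it
gives the direct inequality ∫‖B*S(-t)*φ‖² ≤ M‖φ‖² (`IsAdmissible.exists_observation_bound`);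
Duhamel's formula and Fubini extend it to trajectories with a source and make the regularised
observations Cauchy in L² (`exists_tendsto_observation`). Their limit is the observation of z
(`IsMild.exists_observation`).

For the nonlinear problem f is cut off to a globally Lipschitz map that is small relative to its
argument everywhere. In the energy balance the W and R terms have a sign, and `IsMild.decay` follows
from a Grönwall inequality with negative rate. With γ = 0 it shows that small data never leave the
ball where the cutoff equals 1, so the truncated solution solves the original system
(`exists_isMild_closedLoop`); with general γ < λ it gives the decay rate.

For uniqueness, the second equation does not involve y. Du Bois-Reymond's lemma
(`HasDistribDeriv.eq_add_integral`) and `hasDerivWithinAt_of_weak` turn weak solutions into mild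
ones, and the difference of two solutions has a source dominated by the difference while the latter
is small, which suffices by continuation (`eq_zero_of_norm_source_le`). Once the second components
agree, so do their observations, and the first equation is treated in the same way. -/

theorem sum_catalan_div_two_pow (N : ℕ) :
    ∑ n ∈ Finset.range N, (catalan n : ℝ) / 2 ^ (2 * n + 1)
      = 1 - (Nat.centralBinom N : ℝ) / 4 ^ N := by
  induction N with
  | zero => simp
  | succ n ih =>
    rw [Finset.sum_range_succ, ih]
    have h1 : ((n : ℝ) + 1) * catalan n = Nat.centralBinom n := by
      exact_mod_cast succ_mul_catalan_eq_centralBinom n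
    have h2 : ((n : ℝ) + 1) * Nat.centralBinom (n + 1) = 2 * (2 * n + 1) * Nat.centralBinom n := by
      exact_mod_cast Nat.succ_mul_centralBinom_succ n
    have h3 : (2 : ℝ) ^ (2 * n + 1) = 2 * 4 ^ n := by
      rw [pow_succ, pow_mul]; norm_num [mul_comm]
    have h4 : (n : ℝ) + 1 ≠ 0 := by positivity
    have h5 : (catalan n : ℝ) = Nat.centralBinom n / (n + 1) := by
      rw [← h1]; field_simp
    have h6 : (Nat.centralBinom (n + 1) : ℝ) = 2 * (2 * n + 1) * Nat.centralBinom n / (n + 1) := by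
      rw [← h2]; field_simp
    rw [h3, h5, h6, pow_succ]
    field_simp
    ring

/-- The closed form of the partial sums bounds them by 1. Hence the series for 1 - √(1 - A) still
converges absolutely at the endpoint ‖A‖ = 1, where a geometric comparison fails. -/
theorem summable_catalan : Summable fun n : ℕ => (catalan n : ℝ) / 2 ^ (2 * n + 1) :=
  summable_of_sum_range_le (c := 1) (fun n => by positivity) fun N => by
    rw [sum_catalan_div_two_pow]
    have : (0 : ℝ) ≤ (Nat.centralBinom N : ℝ) / 4 ^ N := by positivity
    linarith

theorem tsum_catalan_le : ∑' n : ℕ, (catalan n : ℝ) / 2 ^ (2 * n + 1) ≤ 1 :=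
  Real.tsum_le_of_sum_range_le (fun n => by positivity) fun N => by
    rw [sum_catalan_div_two_pow]
    have : (0 : ℝ) ≤ (Nat.centralBinom N : ℝ) / 4 ^ N := by positivity
    linarith

section Sqrt

variable {X : Type*} [NormedAddCommGroup X] [InnerProductSpace ℝ X] [CompleteSpace X]

/-- `1 - √(1 - A) = A ∑ aₙ Aⁿ` for `‖A‖ ≤ 1`, with `aₙ = catalan n / 2 ^ (2 n + 1)`. -/
theorem exists_sqrt_one_sub {A : X →L[ℝ] X} (hA : IsSelfAdjoint A) (hA1 : ‖A‖ ≤ 1) :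
    ∃ D : X →L[ℝ] X, IsSelfAdjoint D ∧ ‖D‖ ≤ 1 ∧ (1 - D) * (1 - D) = 1 - A := by
  set a : ℕ → ℝ := fun n => (catalan n : ℝ) / 2 ^ (2 * n + 1) with ha
  have ha0 : ∀ n, 0 ≤ a n := fun n => by positivity
  have hpow : ∀ n : ℕ, ‖A ^ n‖ ≤ 1 := by
    intro n
    rcases Nat.eq_zero_or_pos n with rfl | hn
    · rw [pow_zero]; exact ContinuousLinearMap.norm_id_le
    · exact (norm_pow_le' A hn).trans (pow_le_one₀ (norm_nonneg _) hA1)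
  have hterm : ∀ n, ‖a n • A ^ n‖ ≤ a n := fun n => by
    rw [norm_smul, Real.norm_of_nonneg (ha0 n)]
    exact mul_le_of_le_one_right (ha0 n) (hpow n)
  have hsn : Summable fun n => ‖a n • A ^ n‖ :=
    Summable.of_nonneg_of_le (fun _ => norm_nonneg _) hterm summable_catalan
  have hs : Summable fun n => a n • A ^ n := hsn.of_norm
  set Y : X →L[ℝ] X := ∑' n, a n • A ^ n with hY
  have hYn : ‖Y‖ ≤ 1 :=
    (tsum_of_norm_bounded summable_catalan.hasSum hterm).trans tsum_catalan_le
  have hYsa : IsSelfAdjoint Y := by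
    rw [IsSelfAdjoint, hY, tsum_star]
    congr 1
    ext1 n
    rw [star_smul, star_trivial, star_pow, hA.star_eq]
  have hcomm : Commute A Y :=
    Commute.tsum_right (f := fun n => a n • A ^ n) A
      fun n => ((Commute.refl A).pow_right n).smul_right (a n)
  -- Segner's recurrence for the Catalan numbers; summed over n it becomes 2Y = 1 + AY².
  have hrec : ∀ n, a (n + 1) • A ^ (n + 1)
      = A * ((1 / 2 : ℝ) • ∑ kl ∈ Finset.HasAntidiagonal.antidiagonal n, (a kl.1 • A ^ kl.1) * (a kl.2 • A ^ kl.2)) := by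
    intro n
    have h1 : ∀ kl ∈ Finset.HasAntidiagonal.antidiagonal n, (a kl.1 • A ^ kl.1) * (a kl.2 • A ^ kl.2)
        = (a kl.1 * a kl.2) • A ^ n := by
      intro kl hkl
      rw [smul_mul_smul_comm, ← pow_add, Finset.HasAntidiagonal.mem_antidiagonal.1 hkl]
    rw [Finset.sum_congr rfl h1, ← Finset.sum_smul, smul_smul, mul_smul_comm, ← pow_succ']
    congr 1
    have h2 : ∀ kl ∈ Finset.HasAntidiagonal.antidiagonal n,
        a kl.1 * a kl.2 = (catalan kl.1 * catalan kl.2 : ℕ) / 2 ^ (2 * n + 2) := by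
      intro kl hkl
      rw [← Finset.HasAntidiagonal.mem_antidiagonal.1 hkl]
      simp only [ha]
      push_cast
      rw [div_mul_div_comm, ← pow_add]
      ring_nf
    rw [Finset.sum_congr rfl h2, ← Finset.sum_div, ← Nat.cast_sum, ← catalan_succ']
    simp only [ha]
    rw [show 2 * (n + 1) + 1 = (2 * n + 2) + 1 by ring, pow_succ]
    field_simp
  have hYeq : Y = (1 / 2 : ℝ) • (1 : X →L[ℝ] X) + A * ((1 / 2 : ℝ) • (Y * Y)) := by
    have h1 : Y * Y = ∑' n, ∑ kl ∈ Finset.HasAntidiagonal.antidiagonal n, (a kl.1 • A ^ kl.1) * (a kl.2 • A ^ kl.2) :=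
      tsum_mul_tsum_eq_tsum_sum_antidiagonal_of_summable_norm hsn hsn
    have h2 : Summable fun n => ∑ kl ∈ Finset.HasAntidiagonal.antidiagonal n,
        (a kl.1 • A ^ kl.1) * (a kl.2 • A ^ kl.2) :=
      (summable_norm_sum_mul_antidiagonal_of_summable_norm hsn hsn).of_norm
    rw [h1, ← h2.tsum_const_smul, ← (h2.const_smul (1 / 2 : ℝ)).tsum_mul_left]
    simp_rw [← hrec]
    rw [hY, hs.tsum_eq_zero_add]
    simp [ha]
  -- Multiplying 2Y = 1 + AY² by A gives 2D = A + D² for D = AY, that is (1 - D)² = 1 - A.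
  refine ⟨A * Y, ?_, ?_, ?_⟩
  · rw [IsSelfAdjoint, star_mul, hA.star_eq, hYsa.star_eq, hcomm.eq]
  · exact (norm_mul_le _ _).trans (mul_le_one₀ hA1 (norm_nonneg _) hYn)
  · have h3 : (2 : ℝ) • Y = 1 + A * (Y * Y) := by
      conv_lhs => rw [hYeq]
      rw [smul_add, smul_smul, mul_smul_comm, smul_smul]
      norm_num
    have h4 : A * Y + A * Y = A + A * Y * (A * Y) := by
      have : A * Y * (A * Y) = A * (A * (Y * Y)) := by
        rw [hcomm.symm.mul_mul_mul_comm, mul_assoc A A]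
      rw [this, ← two_smul ℝ (A * Y), ← mul_smul_comm, h3, mul_add, mul_one]
    have h5 : (1 - A * Y) * (1 - A * Y) = 1 - (A * Y + A * Y) + A * Y * (A * Y) := by
      noncomm_ring
    rw [h5, h4]
    abel

/-- After division by m = ‖T‖ + 1 (positive even for T = 0) the operator lies between 0 and 1, so
`exists_sqrt_one_sub` applies to 1 - T/m. The root √m (1 - D) is non-negative because ‖D‖ ≤ 1. -/
theorem IsNonnegSymm.exists_sqrt {T : X →L[ℝ] X} (hT : IsNonnegSymm T) :
    ∃ P : X →L[ℝ] X, IsNonnegSymm P ∧ P.comp P = T := by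
  set m : ℝ := ‖T‖ + 1 with hm
  have hm0 : 0 < m := by positivity
  set T' : X →L[ℝ] X := m⁻¹ • T with hT'
  have hsymm : ∀ x y : X, ⟪T' x, y⟫_ℝ = ⟪x, T' y⟫_ℝ := fun x y => by
    simp [hT', inner_smul_left, inner_smul_right, hT.1]
  have hnn : ∀ x, 0 ≤ ⟪T' x, x⟫_ℝ := fun x => by
    simp only [hT', smul_apply, inner_smul_left]
    exact mul_nonneg (by simpa using hm0.le) (hT.2 x)
  have hn1 : ∀ x, ‖T' x‖ ≤ ‖x‖ := fun x => by
    rw [hT', smul_apply, norm_smul, Real.norm_of_nonneg (by positivity),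
      inv_mul_le_iff₀ hm0]
    exact (T.le_opNorm x).trans (by gcongr; linarith)
  have hsa : IsSelfAdjoint (1 - T') := by
    rw [ContinuousLinearMap.isSelfAdjoint_iff_isSymmetric]
    intro x y
    simp [inner_sub_left, inner_sub_right, hsymm]
  have hA1 : ‖1 - T'‖ ≤ 1 := by
    refine ContinuousLinearMap.opNorm_le_bound _ zero_le_one fun x => ?_
    rw [one_mul]
    -- Non-negativity at x - T'x yields ‖T'x‖² ≤ ⟨T'x, x⟩, and this makes 1 - T' a contraction
    -- without spectral theory.
    have h1 := hnn (x - T' x)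
    have h2 : ⟪T' (T' x), T' x⟫_ℝ ≤ ‖T' x‖ ^ 2 := by
      refine (real_inner_le_norm _ _).trans ?_
      rw [sq]
      gcongr
      exact hn1 _
    have h3 : ⟪T' (x - T' x), x - T' x⟫_ℝ
        = ⟪T' x, x⟫_ℝ - 2 * ‖T' x‖ ^ 2 + ⟪T' (T' x), T' x⟫_ℝ := by
      rw [map_sub, inner_sub_left, inner_sub_right, inner_sub_right, hsymm (T' x) x,
        real_inner_self_eq_norm_sq]
      ring
    refine (sq_le_sq₀ (norm_nonneg _) (norm_nonneg _)).1 ?_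
    have h4 := norm_sub_sq_real x (T' x)
    rw [real_inner_comm] at h4
    simp only [sub_apply, one_apply_eq_self]
    have := hnn x
    linarith
  obtain ⟨D, hD, hD1, hDD⟩ := exists_sqrt_one_sub hsa hA1
  have hD' := ContinuousLinearMap.isSelfAdjoint_iff_isSymmetric.1 hD
  refine ⟨Real.sqrt m • (1 - D), ⟨fun x y => ?_, fun x => ?_⟩, ?_⟩
  · have := hD' x y
    simp only [ContinuousLinearMap.coe_coe] at this
    simp [inner_smul_left, inner_smul_right, inner_sub_left, inner_sub_right, this]
  · simp only [smul_apply, inner_smul_left, sub_apply,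
      one_apply_eq_self, inner_sub_left]
    refine mul_nonneg (by simp) (sub_nonneg.2 ?_)
    refine (real_inner_le_norm _ _).trans ?_
    rw [real_inner_self_eq_norm_sq, sq]
    gcongr
    simpa using D.le_of_opNorm_le hD1 x
  · change (Real.sqrt m • (1 - D)) * (Real.sqrt m • (1 - D)) = T
    rw [smul_mul_smul_comm, hDD, Real.mul_self_sqrt hm0.le, sub_sub_cancel, hT', smul_smul,
      mul_inv_cancel₀ hm0.ne', one_smul]

/-- This is the only property of square roots used later, so the choice of root in `opSqrt` is
immaterial. -/
theorem norm_opSqrt_sq {T : X →L[ℝ] X} (hT : IsNonnegSymm T) (x : X) :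
    ‖opSqrt T x‖ ^ 2 = ⟪T x, x⟫_ℝ := by
  have h : ∃ P : X →L[ℝ] X, IsNonnegSymm P ∧ P.comp P = T := hT.exists_sqrt
  have h1 : opSqrt T = h.choose := by rw [opSqrt, dif_pos h]
  obtain ⟨h2, h3⟩ := h.choose_spec
  rw [h1, ← real_inner_self_eq_norm_sq, ← h2.1, ← ContinuousLinearMap.comp_apply, h3]

end Sqrt

end StaticFeedback

namespace StaticFeedback

/-! ### Truncation -/

section Truncation

variable {E : Type*} [NormedAddCommGroup E]

/-- The Lipschitz cutoff function equal to `1` for `‖x‖ ≤ r / 2` and to `0` for `‖x‖ ≥ r`. -/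
noncomputable def cutoff (r : ℝ) (x : E) : ℝ := max 0 (min 1 (2 - 2 / r * ‖x‖))

theorem cutoff_nonneg (r : ℝ) (x : E) : 0 ≤ cutoff r x := le_max_left _ _

theorem cutoff_le_one (r : ℝ) (x : E) : cutoff r x ≤ 1 := max_le zero_le_one (min_le_left _ _)

theorem cutoff_eq_one {r : ℝ} (hr : 0 < r) {x : E} (hx : ‖x‖ ≤ r / 2) : cutoff r x = 1 := by
  have : 2 / r * ‖x‖ ≤ 1 := by
    calc 2 / r * ‖x‖ ≤ 2 / r * (r / 2) := by gcongr
      _ = 1 := by field_simp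
  rw [cutoff, min_eq_left (by linarith), max_eq_right zero_le_one]

theorem cutoff_eq_zero {r : ℝ} (hr : 0 < r) {x : E} (hx : r ≤ ‖x‖) : cutoff r x = 0 := by
  have : 2 ≤ 2 / r * ‖x‖ := by
    calc 2 = 2 / r * r := by field_simp
      _ ≤ 2 / r * ‖x‖ := by gcongr
  rw [cutoff, min_eq_right (by linarith), max_eq_left (by linarith)]

theorem abs_cutoff_sub_le {r : ℝ} (hr : 0 < r) (x y : E) :
    |cutoff r x - cutoff r y| ≤ 2 / r * ‖x - y‖ := by
  have h1 : |cutoff r x - cutoff r y| ≤ |(2 - 2 / r * ‖x‖) - (2 - 2 / r * ‖y‖)| := by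
    refine (abs_max_sub_max_le_max _ _ _ _).trans (max_le (by simp) ?_)
    exact (abs_min_sub_min_le_max _ _ _ _).trans (max_le (by simp) le_rfl)
  refine h1.trans ?_
  rw [show (2 - 2 / r * ‖x‖) - (2 - 2 / r * ‖y‖) = 2 / r * (‖y‖ - ‖x‖) by ring, abs_mul,
    abs_of_pos (by positivity : 0 < 2 / r), norm_sub_rev]
  gcongr
  exact abs_norm_sub_norm_le _ _

variable [NormedSpace ℝ E]

theorem norm_cutoff_smul_le {r L : ℝ} (hr : 0 < r) (hL : 0 ≤ L) {f : E → E}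
    (hf : ∀ x, ‖x‖ < r → ‖f x‖ ≤ L * ‖x‖) (x : E) : ‖cutoff r x • f x‖ ≤ L * r := by
  rcases lt_or_ge ‖x‖ r with h | h
  · rw [norm_smul, Real.norm_of_nonneg (cutoff_nonneg _ _)]
    calc cutoff r x * ‖f x‖ ≤ 1 * ‖f x‖ := by gcongr; exact cutoff_le_one _ _
      _ ≤ L * ‖x‖ := by rw [one_mul]; exact hf x h
      _ ≤ L * r := by gcongr
  · rw [cutoff_eq_zero hr h, zero_smul, norm_zero]
    positivity

/-- The constant 3L is L from f plus 2L from the cutoff, whose slope 2/r multiplies values of f of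
size at most Lr. If both points lie outside the ball the difference is zero; if only one does, only
the second contribution is present. -/
theorem norm_cutoff_smul_sub_le {r L : ℝ} (hr : 0 < r) (hL : 0 ≤ L) {f : E → E} (h0 : f 0 = 0)
    (hf : ∀ x y, ‖x‖ < r → ‖y‖ < r → ‖f x - f y‖ ≤ L * ‖x - y‖) (x y : E) :
    ‖cutoff r x • f x - cutoff r y • f y‖ ≤ 3 * L * ‖x - y‖ := by
  have hb : ∀ x, ‖x‖ < r → ‖f x‖ ≤ L * ‖x‖ := fun x hx => by
    simpa [h0] using hf x 0 hx (by simpa using hr)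
  have key : ∀ x y, ‖x‖ < r → ‖(cutoff r x - cutoff r y) • f x‖ ≤ 2 * L * ‖x - y‖ := by
    intro x y hx
    rw [norm_smul, Real.norm_eq_abs]
    calc |cutoff r x - cutoff r y| * ‖f x‖ ≤ (2 / r * ‖x - y‖) * (L * r) := by
          gcongr
          · exact abs_cutoff_sub_le hr x y
          · exact (hb x hx).trans (by gcongr)
      _ = 2 * L * ‖x - y‖ := by field_simp
  have hpos : 0 ≤ L * ‖x - y‖ := by positivity
  rcases lt_or_ge ‖x‖ r with hx | hx <;> rcases lt_or_ge ‖y‖ r with hy | hy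
  · have h1 : cutoff r x • f x - cutoff r y • f y
        = (cutoff r x - cutoff r y) • f x + cutoff r y • (f x - f y) := by
      rw [sub_smul, smul_sub]; abel
    have h2 : ‖cutoff r y • (f x - f y)‖ ≤ L * ‖x - y‖ := by
      rw [norm_smul, Real.norm_of_nonneg (cutoff_nonneg _ _)]
      exact (mul_le_of_le_one_left (norm_nonneg _) (cutoff_le_one _ _)).trans (hf x y hx hy)
    rw [h1]
    refine (norm_add_le _ _).trans ?_
    linarith [key x y hx]
  · have := key x y hx
    rw [cutoff_eq_zero hr hy, sub_zero] at this
    rw [cutoff_eq_zero hr hy, zero_smul, sub_zero]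
    linarith
  · have := key y x hy
    rw [cutoff_eq_zero hr hx, sub_zero, norm_sub_rev y x] at this
    rw [cutoff_eq_zero hr hx, zero_smul, zero_sub, norm_neg]
    linarith
  · rw [cutoff_eq_zero hr hx, cutoff_eq_zero hr hy, zero_smul, zero_smul, sub_zero, norm_zero]
    linarith

end Truncation

/-! ### Global solutions of ordinary differential equations -/

section ODE

variable {E : Type*} [NormedAddCommGroup E] [NormedSpace ℝ E]

theorem norm_le_exp_of_norm_deriv_le {T K : ℝ} {p p' : ℝ → E}
    (hp : ∀ t ∈ Icc (-T) T, HasDerivWithinAt p (p' t) (Icc (-T) T) t)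
    (hb : ∀ t ∈ Icc (-T) T, ‖p' t‖ ≤ K * ‖p t‖) {t : ℝ} (ht : t ∈ Icc (-T) T) :
    ‖p t‖ ≤ ‖p 0‖ * Real.exp (K * |t|) := by
  have forward : ∀ q q' : ℝ → E, (∀ t ∈ Icc (-T) T, HasDerivWithinAt q (q' t) (Icc (-T) T) t) →
      (∀ t ∈ Icc (-T) T, ‖q' t‖ ≤ K * ‖q t‖) → ∀ t ∈ Icc 0 T, ‖q t‖ ≤ ‖q 0‖ * Real.exp (K * t) := by
    intro q q' hq hqb t ht
    have hT : 0 ≤ T := ht.1.trans ht.2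
    have hsub : Icc 0 T ⊆ Icc (-T) T := Icc_subset_Icc_left (by linarith)
    have := norm_le_gronwallBound_of_norm_deriv_right_le (f := q) (f' := q') (δ := ‖q 0‖) (K := K)
      (ε := 0) (a := 0) (b := T) (fun s hs => ((hq s (hsub hs)).continuousWithinAt).mono hsub)
      (fun s hs => (hq s (hsub (Ico_subset_Icc_self hs))).mono_of_mem_nhdsWithin
        (mem_of_superset (Icc_mem_nhdsGE hs.2) (Icc_subset_Icc_left (by linarith [hs.1]))))
      le_rfl (fun s hs => by simpa using hqb s (hsub (Ico_subset_Icc_self hs))) t ht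
    simpa [gronwallBound_ε0] using this
  rcases le_total 0 t with h | h
  · rw [abs_of_nonneg h]
    exact forward p p' hp hb t ⟨h, ht.2⟩
  · rw [abs_of_nonpos h]
    have hneg : ∀ s ∈ Icc (-T) T, -s ∈ Icc (-T) T := fun s hs =>
      ⟨by linarith [hs.2], by linarith [hs.1]⟩
    have := forward (fun s => p (-s)) (fun s => -p' (-s)) (fun s hs => by
        have h1 := (hp (-s) (hneg s hs)).scomp s (hasDerivAt_neg s).hasDerivWithinAt
          (fun x hx => hneg x hx)
        simpa [Function.comp_def] using h1)
      (fun s hs => by simpa using hb (-s) (hneg s hs)) (-t) ⟨by linarith, by linarith [ht.1]⟩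
    simpa using this

variable [CompleteSpace E]

/-- Cutting F off at radius r bounds it by Kr, so Picard-Lindelöf in a ball of radius KrT reaches
all of [-T, T] in one step. Grönwall bounds the solution by ‖x₀‖ exp(KT) < r/2, where the cutoff is
1, so it solves the original equation. -/
theorem exists_ode_solution_Icc {F : ℝ → E → E} (hFc : ∀ x, Continuous fun t => F t x)
    (hF0 : ∀ t, F t 0 = 0) {T K : ℝ} (hT : 0 ≤ T) (hK : 0 ≤ K)
    (hFl : ∀ t ∈ Icc (-T) T, ∀ x y, ‖F t x - F t y‖ ≤ K * ‖x - y‖) (x₀ : E) :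
    ∃ p : ℝ → E, p 0 = x₀ ∧ ContinuousOn p (Icc (-T) T) ∧
      ∀ t ∈ Ioo (-T) T, HasDerivAt p (F t (p t)) t := by
  set r : ℝ := 2 * (‖x₀‖ * Real.exp (K * T) + 1) with hr
  have hr0 : 0 < r := by positivity
  have hFb : ∀ t ∈ Icc (-T) T, ∀ x, ‖F t x‖ ≤ K * ‖x‖ := fun t ht x => by
    simpa [hF0] using hFl t ht x 0
  let G : ℝ → E → E := fun t x => cutoff r x • F t x
  have h0 : (0 : ℝ) ∈ Icc (-T) T := ⟨by linarith, hT⟩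
  have hpl : IsPicardLindelof G (tmin := -T) (tmax := T) ⟨0, h0⟩ x₀
      ⟨K * r * T, by positivity⟩ 0 ⟨K * r, by positivity⟩ ⟨3 * K, by positivity⟩ := by
    refine ⟨fun t ht => ?_, fun x _ => ?_, fun t ht x _ => ?_, ?_⟩
    · refine LipschitzWith.lipschitzOnWith (LipschitzWith.of_dist_le_mul fun x y => ?_)
      rw [dist_eq_norm, dist_eq_norm]
      exact norm_cutoff_smul_sub_le hr0 hK (hF0 t) (fun x y _ _ => hFl t ht x y) x y
    · exact ((hFc x).const_smul _).continuousOn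
    · exact norm_cutoff_smul_le hr0 hK (fun x _ => hFb t ht x) x
    · simp only [sub_zero, zero_sub, neg_neg, max_self, NNReal.coe_zero]
      exact le_rfl
  obtain ⟨p, hp0, hp⟩ := hpl.exists_eq_forall_mem_Icc_hasDerivWithinAt₀
  have hp0' : p 0 = x₀ := hp0
  have hbound : ∀ t ∈ Icc (-T) T, ‖p t‖ ≤ r / 2 := by
    intro t ht
    have h1 := norm_le_exp_of_norm_deriv_le (K := K) hp (fun s hs => by
      rw [norm_smul, Real.norm_of_nonneg (cutoff_nonneg _ _)]
      exact (mul_le_of_le_one_left (norm_nonneg _) (cutoff_le_one _ _)).trans (hFb s hs _)) ht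
    rw [hp0'] at h1
    have h2 : |t| ≤ T := abs_le.2 ht
    have h3 : ‖x₀‖ * Real.exp (K * |t|) ≤ ‖x₀‖ * Real.exp (K * T) := by gcongr
    rw [hr]
    linarith
  refine ⟨p, hp0', fun t ht => (hp t ht).continuousWithinAt, fun t ht => ?_⟩
  have h1 := (hp t (Ioo_subset_Icc_self ht)).hasDerivAt (Icc_mem_nhds ht.1 ht.2)
  simpa only [G, cutoff_eq_one hr0 (hbound t (Ioo_subset_Icc_self ht)), one_smul] using h1

/-- Global existence for a vector field that is Lipschitz, locally uniformly in time. -/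
theorem exists_global_ode_solution {F : ℝ → E → E} (hFc : ∀ x, Continuous fun t => F t x)
    (hF0 : ∀ t, F t 0 = 0)
    (hFl : ∀ T, 0 ≤ T → ∃ K, 0 ≤ K ∧ ∀ t ∈ Icc (-T) T, ∀ x y, ‖F t x - F t y‖ ≤ K * ‖x - y‖)
    (x₀ : E) : ∃ p : ℝ → E, p 0 = x₀ ∧ ∀ t, HasDerivAt p (F t (p t)) t := by
  have hex : ∀ n : ℕ, ∃ p : ℝ → E, p 0 = x₀ ∧
      ∀ t ∈ Ioo (-((n : ℝ) + 1)) (n + 1), HasDerivAt p (F t (p t)) t := by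
    intro n
    obtain ⟨K, hK, hKl⟩ := hFl ((n : ℝ) + 1) (by positivity)
    obtain ⟨p, hp0, _, hp⟩ := exists_ode_solution_Icc hFc hF0 (by positivity) hK hKl x₀
    exact ⟨p, hp0, hp⟩
  choose P hP0 hP using hex
  have huniq : ∀ m n : ℕ, m ≤ n → EqOn (P m) (P n) (Ioo (-((m : ℝ) + 1)) (m + 1)) := by
    intro m n hmn
    obtain ⟨K, hK, hKl⟩ := hFl ((m : ℝ) + 1) (by positivity)
    have hmn' : (m : ℝ) ≤ n := by exact_mod_cast hmn
    refine ODE_solution_unique_of_mem_Ioo (v := F) (s := fun _ => univ) (K := ⟨K, hK⟩) (t₀ := 0)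
      (fun t ht => ?_) ⟨by linarith [(m.cast_nonneg : (0 : ℝ) ≤ m)], by positivity⟩
      (fun t ht => ⟨hP m t ht, trivial⟩)
      (fun t ht => ⟨hP n t ⟨by linarith [ht.1], by linarith [ht.2]⟩, trivial⟩) ?_
    · refine LipschitzWith.lipschitzOnWith (LipschitzWith.of_dist_le_mul fun x y => ?_)
      rw [dist_eq_norm, dist_eq_norm]
      exact hKl t (Ioo_subset_Icc_self ht) x y
    · rw [hP0, hP0]
  have hmem : ∀ t : ℝ, t ∈ Ioo (-((⌈|t|⌉₊ : ℝ) + 1)) (⌈|t|⌉₊ + 1) := fun t => by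
    have := Nat.le_ceil |t|
    have h2 := abs_le.1 this
    constructor <;> linarith
  have hagree : ∀ (n : ℕ), ∀ t ∈ Ioo (-((n : ℝ) + 1)) (n + 1), P ⌈|t|⌉₊ t = P n t := by
    intro n t ht
    rcases le_total ⌈|t|⌉₊ n with h | h
    · exact huniq _ _ h (hmem t)
    · exact (huniq _ _ h ht).symm
  -- The piece with index ⌈|t|⌉ lives on an open interval containing t, and there it coincides with
  -- the glued function.
  refine ⟨fun t => P ⌈|t|⌉₊ t, by simp [hP0], fun t => ?_⟩
  exact (hP _ t (hmem t)).congr_of_eventuallyEq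
    (Filter.eventually_of_mem (Ioo_mem_nhds (hmem t).1 (hmem t).2) (hagree _))

end ODE

/-! ### An integral form of Grönwall's inequality -/

/-- The constant c may be negative, which is the case needed for decay. Then an integral inequality
from time 0 alone would not suffice; the inequality on every [τ, t] bounds the right Dini derivative
of e by c e. -/
theorem le_exp_mul_of_sub_le_integral {e : ℝ → ℝ} (he : Continuous e) {c : ℝ}
    (h : ∀ τ t, 0 ≤ τ → τ ≤ t → e t - e τ ≤ c * ∫ s in τ..t, e s) {t : ℝ} (ht : 0 ≤ t) :
    e t ≤ Real.exp (c * t) * e 0 := by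
  have := le_gronwallBound_of_liminf_deriv_right_le (f := e) (f' := fun x => c * e x)
    (δ := e 0) (K := c) (ε := 0) (a := 0) (b := t) he.continuousOn (fun x hx r hr => ?_) le_rfl
    (fun x _ => by simp) t ⟨ht, le_rfl⟩
  · rw [gronwallBound_ε0, sub_zero, mul_comm] at this
    exact this
  · have hd : HasDerivAt (fun z => c * ∫ s in x..z, e s) (c * e x) x :=
      (intervalIntegral.integral_hasDerivAt_right (he.intervalIntegrable _ _)
        (he.stronglyMeasurableAtFilter _ _) he.continuousAt).const_mul c
    have h1 : Tendsto (slope (fun z => c * ∫ s in x..z, e s) x) (𝓝[>] x) (𝓝 (c * e x)) :=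
      (hasDerivAt_iff_tendsto_slope.1 hd).mono_left
        (nhdsWithin_mono _ fun z hz => ne_of_gt hz)
    refine Eventually.frequently ?_
    filter_upwards [h1.eventually (gt_mem_nhds hr), self_mem_nhdsWithin] with z hz hzx
    refine lt_of_le_of_lt ?_ hz
    rw [slope_def_field, intervalIntegral.integral_same, mul_zero, sub_zero, div_eq_inv_mul]
    have hzx' : 0 < z - x := sub_pos.2 hzx
    gcongr
    exact h x z hx.1 (le_of_lt hzx)

end StaticFeedback

namespace StaticFeedback

/-! ### Distributional derivatives on an interval -/

theorem intervalIntegrable_of_integrableOn_Ioo {E : Type*} [NormedAddCommGroup E] {T : ℝ}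
    {h : ℝ → E} (hh : IntegrableOn h (Ioo 0 T)) {a b : ℝ} (ha : a ∈ Icc 0 T) (hb : b ∈ Icc 0 T) :
    IntervalIntegrable h volume a b := by
  have h1 : IntegrableOn h (Icc 0 T) := by rwa [integrableOn_Icc_iff_integrableOn_Ioo]
  exact (h1.mono_set (uIcc_subset_Icc ha hb)).intervalIntegrable

theorem setIntegral_Ioo_eq {E : Type*} [NormedAddCommGroup E] [NormedSpace ℝ E] {T : ℝ}
    (hT : 0 ≤ T) (h : ℝ → E) : ∫ t in Ioo 0 T, h t = ∫ t in (0 : ℝ)..T, h t := by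
  rw [intervalIntegral.integral_of_le hT, integral_Ioc_eq_integral_Ioo]

/-- Since h is merely integrable, its primitive is only absolutely continuous; integration by parts
holds in that class, and the derivative of the primitive is h almost everywhere. -/
theorem integral_primitive_mul_deriv {T : ℝ} (hT : 0 < T) {h : ℝ → ℝ}
    (hh : IntegrableOn h (Ioo 0 T)) {θ : ℝ → ℝ} (hθ : ContDiff ℝ ∞ θ) (hθ0 : θ 0 = 0)
    (hθT : θ T = 0) :
    ∫ t in Ioo 0 T, (∫ s in (0 : ℝ)..t, h s) * deriv θ t = - ∫ t in Ioo 0 T, h t * θ t := by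
  have h0 : (0 : ℝ) ∈ Icc 0 T := ⟨le_rfl, hT.le⟩
  have hTT : T ∈ Icc 0 T := ⟨hT.le, le_rfl⟩
  have hi : IntervalIntegrable h volume 0 T := intervalIntegrable_of_integrableOn_Ioo hh h0 hTT
  have hac := hi.absolutelyContinuousOnInterval_intervalIntegral (c := 0) (by simp)
  have hθac : AbsolutelyContinuousOnInterval θ 0 T :=
    (hθ.of_le (by simp)).contDiffOn.absolutelyContinuousOnInterval
  rw [setIntegral_Ioo_eq hT.le, setIntegral_Ioo_eq hT.le, hac.integral_mul_deriv_eq_deriv_mul hθac,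
    hθ0, hθT, mul_zero, mul_zero, sub_zero, zero_sub]
  congr 1
  refine intervalIntegral.integral_congr_ae ?_
  filter_upwards [hi.ae_hasDerivAt_integral] with x hx hx'
  rw [(hx (uIoc_subset_uIcc hx') 0 (by simp)).deriv]

theorem eq_zero_of_tsupport_subset_Ioo {T : ℝ} {θ : ℝ → ℝ} (hθ : tsupport θ ⊆ Ioo 0 T) {t : ℝ}
    (ht : t ∉ Ioo 0 T) : θ t = 0 :=
  image_eq_zero_of_notMem_tsupport fun h => ht (hθ h)

theorem setIntegral_mul_congr {T : ℝ} {u v : ℝ → ℝ} (huv : ∀ t ∈ Icc 0 T, u t = v t) (θ : ℝ → ℝ) :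
    ∫ t in Ioo 0 T, u t * θ t = ∫ t in Ioo 0 T, v t * θ t :=
  setIntegral_congr_fun measurableSet_Ioo fun t ht => by
    simp only [huv t (Ioo_subset_Icc_self ht)]

/-- A primitive of an integrable function has that function as distributional derivative. -/
theorem hasDistribDeriv_of_eq_integral {T : ℝ} (hT : 0 < T) {u h : ℝ → ℝ}
    (hh : IntegrableOn h (Ioo 0 T)) (hu : ∀ t ∈ Icc 0 T, u t = u 0 + ∫ s in (0 : ℝ)..t, h s) :
    HasDistribDeriv T u h := by
  have h0 : (0 : ℝ) ∈ Icc 0 T := ⟨le_rfl, hT.le⟩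
  have hTT : T ∈ Icc 0 T := ⟨hT.le, le_rfl⟩
  have hi : IntervalIntegrable h volume 0 T := intervalIntegrable_of_integrableOn_Ioo hh h0 hTT
  have hc : ContinuousOn (fun t => ∫ s in (0 : ℝ)..t, h s) (Icc 0 T) := by
    have := intervalIntegral.continuousOn_primitive_interval (μ := volume) (f := h) (a := 0) (b := T)
      (by rw [uIcc_of_le hT.le, integrableOn_Icc_iff_integrableOn_Ioo]; exact hh)
    rwa [uIcc_of_le hT.le] at this
  have huc : ContinuousOn u (Icc 0 T) := (continuousOn_const.add hc).congr hu
  refine ⟨(huc.integrableOn_Icc).mono_set Ioo_subset_Icc_self, hh, fun θ hθ _ hθs => ?_⟩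
  have hθ0 : θ 0 = 0 := eq_zero_of_tsupport_subset_Ioo hθs (by simp)
  have hθT : θ T = 0 := eq_zero_of_tsupport_subset_Ioo hθs (by simp)
  have hθ1 : ContDiff ℝ 1 θ := hθ.of_le (by simp)
  have hd : Continuous (deriv θ) := hθ1.continuous_deriv le_rfl
  rw [setIntegral_mul_congr hu, ← integral_primitive_mul_deriv hT hh hθ hθ0 hθT]
  simp_rw [add_mul]
  rw [integral_add, add_eq_right, integral_const_mul, setIntegral_Ioo_eq hT.le,
    intervalIntegral.integral_deriv_eq_sub (fun x _ => (hθ1.differentiable one_ne_zero) x)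
      (hd.intervalIntegrable _ _), hθ0, hθT, sub_zero, mul_zero]
  · exact (continuous_const.mul hd).continuousOn.integrableOn_Icc.mono_set Ioo_subset_Icc_self
  · exact (hc.mul hd.continuousOn).integrableOn_Icc.mono_set Ioo_subset_Icc_self

/-- A test function with zero mean is the derivative of a test function. -/
theorem exists_primitive_testFunction {T : ℝ} {g : ℝ → ℝ} (hg : ContDiff ℝ ∞ g)
    (hgc : HasCompactSupport g) (hgs : tsupport g ⊆ Ioo 0 T) (hT : 0 < T)
    (hg0 : ∫ t in Ioo 0 T, g t = 0) :
    ∃ θ : ℝ → ℝ, ContDiff ℝ ∞ θ ∧ HasCompactSupport θ ∧ tsupport θ ⊆ Ioo 0 T ∧ deriv θ = g := by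
  have hgcont := hg.continuous
  have hd : ∀ t, HasDerivAt (fun t => ∫ s in (0 : ℝ)..t, g s) (g t) t := fun t =>
    intervalIntegral.integral_hasDerivAt_right (hgcont.intervalIntegrable _ _)
      (hgcont.stronglyMeasurableAtFilter _ _) hgcont.continuousAt
  have hderiv : deriv (fun t => ∫ s in (0 : ℝ)..t, g s) = g := funext fun t => (hd t).deriv
  obtain ⟨a, b, ha, hb, hab⟩ : ∃ a b : ℝ, 0 < a ∧ b < T ∧ ∀ t, t ∉ Icc a b → g t = 0 := by
    rcases (tsupport g).eq_empty_or_nonempty with he | hne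
    -- For g = 0 the interval with a = T and b = 0 is empty and still meets the requirements 0 < a
    -- and b < T.
    · refine ⟨T, 0, hT, hT, fun t _ => ?_⟩
      rw [tsupport_eq_empty_iff.1 he]; rfl
    · refine ⟨sInf (tsupport g), sSup (tsupport g), (hgs (hgc.isCompact.sInf_mem hne)).1,
        (hgs (hgc.isCompact.sSup_mem hne)).2, fun t ht => ?_⟩
      refine image_eq_zero_of_notMem_tsupport fun h => ht ?_
      exact ⟨csInf_le hgc.isCompact.bddBelow h, le_csSup hgc.isCompact.bddAbove h⟩
  have hzero : ∀ c d : ℝ, (∀ t ∈ uIcc c d, g t = 0) → ∫ s in c..d, g s = 0 := fun c d h => by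
    rw [intervalIntegral.integral_congr (g := fun _ => (0 : ℝ)) h]; simp
  have hsupp : Function.support (fun t => ∫ s in (0 : ℝ)..t, g s) ⊆ Icc a b := by
    intro t ht
    by_contra hn
    refine ht ?_
    rcases lt_or_ge t a with h | h
    · refine hzero _ _ fun s hs => hab s fun hs' => ?_
      have := hs.2
      rcases le_max_iff.1 this with h' | h'
      · linarith [hs'.1]
      · linarith [hs'.1]
    · have hbt : b < t := by
        by_contra hh
        exact hn ⟨h, not_lt.1 hh⟩
      have h1 : ∫ s in (0 : ℝ)..T, g s = 0 := by rw [← setIntegral_Ioo_eq hT.le, hg0]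
      have h2 := intervalIntegral.integral_add_adjacent_intervals
        (hgcont.intervalIntegrable (μ := volume) 0 T) (hgcont.intervalIntegrable T t)
      simp only
      rw [← h2, h1, zero_add]
      refine hzero _ _ fun s hs => hab s fun hs' => ?_
      rcases min_le_iff.1 hs.1 with h' | h' <;> linarith [hs'.2]
  have hts : tsupport (fun t => ∫ s in (0 : ℝ)..t, g s) ⊆ Icc a b :=
    closure_minimal hsupp isClosed_Icc
  refine ⟨_, ?_, ?_, ?_, hderiv⟩
  · rw [contDiff_infty_iff_deriv, hderiv]
    exact ⟨fun t => (hd t).differentiableAt, hg⟩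
  · exact isCompact_Icc.of_isClosed_subset (isClosed_tsupport _) hts
  · exact hts.trans fun t ht => ⟨ha.trans_le ht.1, ht.2.trans_lt hb⟩

theorem setIntegral_Ioo_eq_integral_of_tsupport {T : ℝ} {F : ℝ → ℝ}
    (hF : ∀ t, t ∉ Ioo 0 T → F t = 0) : ∫ t in Ioo 0 T, F t = ∫ t, F t :=
  setIntegral_eq_integral_of_forall_compl_eq_zero hF

/-- The lemma of du Bois-Reymond. -/
theorem HasDistribDeriv.eq_add_integral {T : ℝ} (hT : 0 < T) {u h : ℝ → ℝ}
    (huh : HasDistribDeriv T u h) (huc : ContinuousOn u (Icc 0 T)) {t : ℝ} (ht : t ∈ Icc 0 T) :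
    u t = u 0 + ∫ s in (0 : ℝ)..t, h s := by
  obtain ⟨_, hh, huh⟩ := huh
  have h0 : (0 : ℝ) ∈ Icc 0 T := ⟨le_rfl, hT.le⟩
  have hc : ContinuousOn (fun t => ∫ s in (0 : ℝ)..t, h s) (Icc 0 T) := by
    have := intervalIntegral.continuousOn_primitive_interval (μ := volume) (f := h) (a := 0) (b := T)
      (by rw [uIcc_of_le hT.le, integrableOn_Icc_iff_integrableOn_Ioo]; exact hh)
    rwa [uIcc_of_le hT.le] at this
  set w : ℝ → ℝ := fun t => u t - ∫ s in (0 : ℝ)..t, h s with hw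
  have hwc : ContinuousOn w (Icc 0 T) := huc.sub hc
  have hint : ∀ {φ : ℝ → ℝ}, Continuous φ → ∀ {v : ℝ → ℝ}, ContinuousOn v (Icc 0 T) →
      IntegrableOn (fun t => v t * φ t) (Ioo 0 T) := fun hφ _ hv =>
    (hv.mul hφ.continuousOn).integrableOn_Icc.mono_set Ioo_subset_Icc_self
  have hwθ : ∀ θ : ℝ → ℝ, ContDiff ℝ ∞ θ → HasCompactSupport θ → tsupport θ ⊆ Ioo 0 T →
      ∫ t in Ioo 0 T, w t * deriv θ t = 0 := by
    intro θ hθ hθc hθs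
    have hd : Continuous (deriv θ) := hθ.continuous_deriv (by simp)
    simp only [hw, sub_mul]
    rw [integral_sub (hint hd huc) (hint hd hc), huh θ hθ hθc hθs,
      integral_primitive_mul_deriv hT hh hθ (eq_zero_of_tsupport_subset_Ioo hθs (by simp))
        (eq_zero_of_tsupport_subset_Ioo hθs (by simp)), sub_self]
  -- A bump of total mass 1 inside (0, T), used to correct arbitrary test functions to mean zero.
  let χb : ContDiffBump (T / 2) := ⟨T / 8, T / 4, by positivity, by linarith⟩
  set χ : ℝ → ℝ := χb.normed volume with hχ
  have hχd : ContDiff ℝ ∞ χ := χb.contDiff_normed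
  have hχc : HasCompactSupport χ := χb.hasCompactSupport_normed
  have hχs : tsupport χ ⊆ Ioo 0 T := by
    rw [hχ, χb.tsupport_normed_eq, Real.closedBall_eq_Icc]
    intro s hs
    simp only [χb, mem_Icc] at hs
    constructor <;> linarith [hs.1, hs.2]
  have hχ1 : ∫ t in Ioo 0 T, χ t = 1 := by
    rw [setIntegral_Ioo_eq_integral_of_tsupport fun t ht => eq_zero_of_tsupport_subset_Ioo hχs ht]
    exact χb.integral_normed
  set C : ℝ := ∫ t in Ioo 0 T, w t * χ t with hC
  have hae : ∀ᵐ t : ℝ, t ∈ Ioo 0 T → w t - C = 0 := by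
    refine isOpen_Ioo.ae_eq_zero_of_integral_contDiff_smul_eq_zero
      (((hwc.sub continuousOn_const).mono Ioo_subset_Icc_self).locallyIntegrableOn
        measurableSet_Ioo) fun g hg hgc hgs => ?_
    rw [← setIntegral_Ioo_eq_integral_of_tsupport (T := T) fun t ht => by
      rw [eq_zero_of_tsupport_subset_Ioo hgs ht, zero_smul]]
    set c : ℝ := ∫ t in Ioo 0 T, g t with hc'
    have hone : ∀ {φ : ℝ → ℝ}, Continuous φ → IntegrableOn φ (Ioo 0 T) := fun hφ =>
      hφ.integrableOn_Icc.mono_set Ioo_subset_Icc_self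
    have hcχ : Continuous fun t => c * χ t := continuous_const.mul hχd.continuous
    -- The function g - cχ has mean zero, hence is the derivative of a test function, and w is
    -- orthogonal to it; this says that w - C is orthogonal to g.
    obtain ⟨θ, hθ, hθc, hθs, hθd⟩ := exists_primitive_testFunction (T := T)
      (g := fun t => g t - c * χ t) (hg.sub (contDiff_const.mul hχd)) (hgc.sub hχc.mul_left)
      ((tsupport_sub _ _).trans (union_subset hgs
        ((tsupport_mul_subset_right).trans hχs))) hT (by
        rw [integral_sub (hone hg.continuous) (hone hcχ), integral_const_mul, hχ1, mul_one, sub_self])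
    have h1 := hwθ θ hθ hθc hθs
    rw [hθd] at h1
    simp only [mul_sub] at h1
    have h2 : ∀ t, w t * (c * χ t) = c * (w t * χ t) := fun t => by ring
    rw [integral_sub (hint hg.continuous hwc) (hint hcχ hwc)] at h1
    simp only [h2] at h1
    rw [integral_const_mul, ← hC] at h1
    have h3 : ∀ t, g t • (w t - C) = w t * g t - C * g t := fun t => by
      rw [smul_eq_mul]; ring
    simp only [h3]
    rw [integral_sub (hint hg.continuous hwc) ((hone hg.continuous).const_mul C),
      integral_const_mul, ← hc']
    linarith
  have heq : EqOn w (fun _ => C) (Icc 0 T) := by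
    refine Measure.eqOn_Icc_of_ae_eq (μ := volume) hT.ne ?_ hwc continuousOn_const
    rw [Measure.restrict_congr_set Ioo_ae_eq_Icc.symm, Filter.EventuallyEq,
      ae_restrict_iff' measurableSet_Ioo]
    filter_upwards [hae] with s hs hs'
    linarith [hs hs']
  have h1 := heq ht
  have h2 := heq h0
  simp only [hw, intervalIntegral.integral_same, sub_zero] at h1 h2
  linarith

end StaticFeedback

namespace StaticFeedback

/-! ### Auxiliary facts on interval integrals -/

theorem abs_le_abs_of_mem_uIoc_zero {s e : ℝ} (hs : s ∈ uIoc 0 e) : |s| ≤ |e| := by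
  rcases le_total 0 e with h | h
  · rw [uIoc_of_le h] at hs
    rw [abs_of_pos hs.1, abs_of_nonneg h]
    exact hs.2
  · rw [uIoc_of_ge h] at hs
    rw [abs_of_nonpos hs.2, abs_of_nonpos h]
    linarith [hs.1]

theorem intervalIntegral_inner_left {H : Type*} [NormedAddCommGroup H] [InnerProductSpace ℝ H]
    [CompleteSpace H] {f : ℝ → H} {a b : ℝ} (hf : IntervalIntegrable f volume a b) (x : H) :
    ⟪∫ s in a..b, f s, x⟫_ℝ = ∫ s in a..b, ⟪f s, x⟫_ℝ := by
  have := (innerSL ℝ x).intervalIntegral_comp_comm hf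
  simp only [innerSL_apply_apply] at this
  rw [real_inner_comm, ← this]
  simp only [real_inner_comm]

namespace C0Group

variable {H : Type*} [NormedAddCommGroup H] [InnerProductSpace ℝ H]

/-! ### Elementary properties of strongly continuous groups -/

section Elementary

variable (S : C0Group H)

theorem op_op (s t : ℝ) (x : H) : S.op s (S.op t x) = S.op (s + t) x := by
  rw [S.op_add, ContinuousLinearMap.comp_apply]

theorem op_neg_op (t : ℝ) (x : H) : S.op (-t) (S.op t x) = x := by
  rw [op_op, neg_add_cancel, S.op_zero, ContinuousLinearMap.id_apply]

theorem op_op_neg (t : ℝ) (x : H) : S.op t (S.op (-t) x) = x := by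
  rw [op_op, add_neg_cancel, S.op_zero, ContinuousLinearMap.id_apply]

theorem op_comm (s t : ℝ) (x : H) : S.op s (S.op t x) = S.op t (S.op s x) := by
  rw [op_op, op_op, add_comm]

theorem hasDerivAt_orbit (x : S.generator.domain) (t : ℝ) :
    HasDerivAt (fun t => S.op t x) (S.op t (S.generator x)) t := by
  rw [hasDerivAt_iff_tendsto_slope_zero]
  refine (S.tendsto_op t x).congr fun s => ?_
  rw [op_op, add_comm]

variable [CompleteSpace H]

theorem exists_norm_op_le (T : ℝ) : ∃ C : ℝ, 0 < C ∧ ∀ t ∈ Icc (-T) T, ‖S.op t‖ ≤ C := by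
  obtain ⟨C, hC⟩ := banach_steinhaus (g := fun t : Icc (-T) T => S.op t) fun x => by
    obtain ⟨C, hC⟩ := isCompact_Icc.exists_bound_of_continuousOn
      (S.continuous_orbit x).continuousOn (s := Icc (-T) T)
    exact ⟨C, fun t => hC t t.2⟩
  exact ⟨max C 1, by positivity, fun t ht => (hC ⟨t, ht⟩).trans (le_max_left _ _)⟩

/-- Strong continuity together with the locally uniform bound of Banach-Steinhaus gives joint
continuity in time and vector. -/
theorem continuous_op_apply {α : Type*} [TopologicalSpace α] {u : α → ℝ} {v : α → H}
    (hu : Continuous u) (hv : Continuous v) : Continuous fun a => S.op (u a) (v a) := by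
  have key : Continuous fun p : ℝ × H => S.op p.1 p.2 := by
    rw [continuous_iff_continuousAt]
    rintro ⟨t, x⟩
    obtain ⟨C, _, hC⟩ := S.exists_norm_op_le (|t| + 1)
    have h1 : Tendsto (fun p : ℝ × H => S.op p.1 x) (𝓝 (t, x)) (𝓝 (S.op t x)) :=
      ((S.continuous_orbit x).tendsto t).comp continuous_fst.continuousAt
    have h2 : Tendsto (fun p : ℝ × H => C * ‖p.2 - x‖) (𝓝 (t, x)) (𝓝 0) := by
      have : Continuous fun p : ℝ × H => C * ‖p.2 - x‖ := by fun_prop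
      simpa using this.tendsto (t, x)
    have h3 : Tendsto (fun p : ℝ × H => S.op p.1 (p.2 - x)) (𝓝 (t, x)) (𝓝 0) := by
      refine squeeze_zero_norm' ?_ h2
      have : ∀ᶠ p : ℝ × H in 𝓝 (t, x), p.1 ∈ Ioo (-(|t| + 1)) (|t| + 1) :=
        continuous_fst.continuousAt.eventually_mem (Ioo_mem_nhds
          (by linarith [neg_abs_le t]) (by linarith [le_abs_self t]))
      filter_upwards [this] with p hp
      exact ContinuousLinearMap.le_of_opNorm_le _ (hC _ (Ioo_subset_Icc_self hp)) _
    have := h1.add h3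
    simp only [add_zero] at this
    refine this.congr fun p => ?_
    rw [map_sub, add_sub_cancel]
  exact key.comp (hu.prodMk hv)

theorem continuousOn_op_apply {α : Type*} [TopologicalSpace α] {s : Set α} {u : α → ℝ} {v : α → H}
    (hu : ContinuousOn u s) (hv : ContinuousOn v s) : ContinuousOn (fun a => S.op (u a) (v a)) s :=
  (S.continuous_op_apply continuous_fst continuous_snd).comp_continuousOn (hu.prodMk hv)

/-- The operator `x ↦ ∫₀ᵉ S(s) x ds`. -/
noncomputable def prim (e : ℝ) : H →L[ℝ] H :=
  LinearMap.mkContinuousOfExistsBound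
    { toFun := fun x => ∫ s in (0 : ℝ)..e, S.op s x
      map_add' := fun x y => by
        simp only [map_add]
        exact intervalIntegral.integral_add ((S.continuous_orbit x).intervalIntegrable _ _)
          ((S.continuous_orbit y).intervalIntegrable _ _)
      map_smul' := fun c x => by
        simp only [map_smul, RingHom.id_apply]
        exact intervalIntegral.integral_smul _ _ }
    (by
      obtain ⟨C, _, hC⟩ := S.exists_norm_op_le |e|
      refine ⟨C * |e|, fun x => ?_⟩
      have := intervalIntegral.norm_integral_le_of_norm_le_const (a := 0) (b := e)
        (f := fun s => S.op s x) (C := C * ‖x‖) fun s hs => by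
          refine ContinuousLinearMap.le_of_opNorm_le _ (hC _ ?_) _
          exact abs_le.1 (abs_le_abs_of_mem_uIoc_zero hs)
      simpa [mul_assoc, mul_comm, mul_left_comm] using this)

theorem prim_apply (e : ℝ) (x : H) : S.prim e x = ∫ s in (0 : ℝ)..e, S.op s x := rfl

theorem hasDerivAt_prim (e : ℝ) (x : H) : HasDerivAt (fun e => S.prim e x) (S.op e x) e :=
  intervalIntegral.integral_hasDerivAt_right ((S.continuous_orbit x).intervalIntegrable 0 e)
    ((S.continuous_orbit x).stronglyMeasurableAtFilter _ _) (S.continuous_orbit x).continuousAt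

theorem prim_zero (x : H) : S.prim 0 x = 0 := by
  rw [prim_apply, intervalIntegral.integral_same]

theorem op_prim (t e : ℝ) (x : H) : S.op t (S.prim e x) = S.prim e (S.op t x) := by
  rw [prim_apply, prim_apply, ← ContinuousLinearMap.intervalIntegral_comp_comm _
    ((S.continuous_orbit x).intervalIntegrable _ _)]
  simp only [S.op_comm t]

theorem op_prim_eq_sub (t e : ℝ) (x : H) : S.op t (S.prim e x) = S.prim (e + t) x - S.prim t x := by
  have hint : ∀ a b : ℝ, IntervalIntegrable (fun s => S.op s x) volume a b :=
    fun a b => (S.continuous_orbit x).intervalIntegrable a b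
  rw [op_prim, prim_apply, prim_apply, prim_apply,
    intervalIntegral.integral_interval_sub_left (hint _ _) (hint _ _)]
  simp only [op_op]
  rw [intervalIntegral.integral_comp_add_right (fun s => S.op s x) t, zero_add]

theorem tendsto_prim (e : ℝ) (x : H) :
    Tendsto (fun t : ℝ => t⁻¹ • (S.op t (S.prim e x) - S.prim e x)) (𝓝[≠] 0)
      (𝓝 (S.op e x - x)) := by
  have h1 := (hasDerivAt_iff_tendsto_slope_zero.1 (S.hasDerivAt_prim e x)).sub
    (hasDerivAt_iff_tendsto_slope_zero.1 (S.hasDerivAt_prim 0 x))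
  rw [S.op_zero, ContinuousLinearMap.id_apply] at h1
  refine h1.congr fun t => ?_
  rw [← smul_sub, op_prim_eq_sub, zero_add, prim_zero, sub_zero]
  congr 1
  abel

theorem prim_mem_domain (e : ℝ) (x : H) : S.prim e x ∈ S.generator.domain :=
  ⟨_, S.tendsto_prim e x⟩

theorem generator_prim (e : ℝ) (x : H) :
    S.generator ⟨S.prim e x, S.prim_mem_domain e x⟩ = S.op e x - x :=
  S.generator_eq _ (S.tendsto_prim e x)

theorem prim_generator (e : ℝ) (x : S.generator.domain) :
    S.prim e (S.generator x) = S.op e x - x := by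
  rw [prim_apply, intervalIntegral.integral_eq_sub_of_hasDerivAt
    (fun t _ => S.hasDerivAt_orbit x t) ((S.continuous_orbit _).intervalIntegrable _ _), S.op_zero,
    ContinuousLinearMap.id_apply]

theorem tendsto_inv_smul_prim (x : H) :
    Tendsto (fun e : ℝ => e⁻¹ • S.prim e x) (𝓝[≠] 0) (𝓝 x) := by
  have h1 := hasDerivAt_iff_tendsto_slope_zero.1 (S.hasDerivAt_prim 0 x)
  rw [S.op_zero, ContinuousLinearMap.id_apply] at h1
  refine h1.congr fun t => ?_
  rw [zero_add, prim_zero, sub_zero]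

end Elementary

/-! ### The adjoint group -/

section Adjoint

variable [CompleteSpace H] (S : C0Group H)

theorem inner_adjGen (φ : S.adjDomain) (ψ : S.generator.domain) :
    ⟪S.adjGen φ, (ψ : H)⟫_ℝ = ⟪S.incl φ, S.generator ψ⟫_ℝ := by
  have hg := S.mem_graph φ
  rw [LinearPMap.adjoint_graph_eq_graph_adjoint S.dense_domain, Submodule.mem_adjoint_iff] at hg
  have := hg _ _ (LinearPMap.mem_graph _ ψ)
  rw [real_inner_comm, real_inner_comm (S.generator ψ)]
  linarith

theorem exists_adjDomain {φ χ : H}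
    (h : ∀ ψ : S.generator.domain, ⟪χ, (ψ : H)⟫_ℝ = ⟪φ, S.generator ψ⟫_ℝ) :
    ∃ a : S.adjDomain, S.incl a = φ ∧ S.adjGen a = χ := by
  refine ⟨⟨WithLp.toLp 2 (φ, χ), ⟨(φ, χ), ?_, rfl⟩⟩, rfl, rfl⟩
  rw [SetLike.mem_coe, LinearPMap.adjoint_graph_eq_graph_adjoint S.dense_domain,
    Submodule.mem_adjoint_iff]
  intro a b hab
  obtain ⟨y, rfl, rfl⟩ := (LinearPMap.mem_graph_iff _).1 hab
  rw [real_inner_comm φ, real_inner_comm χ, h y, sub_self]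

/-- A* is single-valued because D(A) is dense. This identifies antiderivatives in D(A*) that are
obtained from different sources. -/
theorem adjDomain_ext {a b : S.adjDomain} (h : S.incl a = S.incl b) : a = b := by
  have h2 : S.adjGen a = S.adjGen b := by
    refine S.dense_domain.eq_of_inner_left ℝ fun ψ hψ => ?_
    have h1 := S.inner_adjGen a ⟨ψ, hψ⟩
    have h3 := S.inner_adjGen b ⟨ψ, hψ⟩
    rw [h1, h3, h]
  refine Subtype.ext (WithLp.ofLp_injective 2 (Prod.ext h h2))

theorem incl_smul (c : ℝ) (a : S.adjDomain) : S.incl (c • a) = c • S.incl a := rfl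
theorem incl_sub (a b : S.adjDomain) : S.incl (a - b) = S.incl a - S.incl b := rfl

/-- Pairing d = S(t)*φ - φ with itself gives ⟨φ, S(t)d - d⟩ = ⟨φ, A∫₀ᵗS(s)d ds⟩ = ⟨A*φ, ∫₀ᵗS(s)d
ds⟩. Only the strong continuity of S is used, so the bound can serve to prove that of S*. -/
theorem norm_adjoint_op_sub_le (φ : S.adjDomain) {T C : ℝ} (hC0 : 0 ≤ C)
    (hC : ∀ t ∈ Icc (-T) T, ‖S.op t‖ ≤ C) {t : ℝ} (ht : |t| ≤ T) :
    ‖(S.op t).adjoint (S.incl φ) - S.incl φ‖ ≤ C * |t| * ‖S.adjGen φ‖ := by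
  obtain ⟨d, hd⟩ : ∃ d, d = (S.op t).adjoint (S.incl φ) - S.incl φ := ⟨_, rfl⟩
  rw [← hd]
  have h1 : ⟪d, d⟫_ℝ = ⟪S.adjGen φ, S.prim t d⟫_ℝ := by
    have h2 : ⟪d, d⟫_ℝ = ⟪(S.op t).adjoint (S.incl φ), d⟫_ℝ - ⟪S.incl φ, d⟫_ℝ := by
      rw [← inner_sub_left, ← hd]
    rw [S.inner_adjGen φ ⟨_, S.prim_mem_domain t d⟩, generator_prim, h2,
      ContinuousLinearMap.adjoint_inner_left, inner_sub_right (S.incl φ)]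
  have h2 : ‖S.prim t d‖ ≤ C * |t| * ‖d‖ := by
    have := intervalIntegral.norm_integral_le_of_norm_le_const (a := 0) (b := t)
      (f := fun s => S.op s d) (C := C * ‖d‖) fun s hs => by
        refine ContinuousLinearMap.le_of_opNorm_le _ (hC _ ?_) _
        exact abs_le.1 ((abs_le_abs_of_mem_uIoc_zero hs).trans ht)
    rw [prim_apply]
    calc _ ≤ _ := this
      _ = _ := by rw [sub_zero]; ring
  have h3 : ‖d‖ * ‖d‖ ≤ (C * |t| * ‖S.adjGen φ‖) * ‖d‖ := by
    rw [← real_inner_self_eq_norm_mul_norm, h1]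
    calc _ ≤ ‖S.adjGen φ‖ * ‖S.prim t d‖ := real_inner_le_norm _ _
      _ ≤ ‖S.adjGen φ‖ * (C * |t| * ‖d‖) := by gcongr
      _ = _ := by ring
  rcases (norm_nonneg d).eq_or_lt with h | h
  · rw [← h]; positivity
  · exact le_of_mul_le_mul_right h3 h

theorem adjoint_prim_mem (e : ℝ) (φ : H) : ∃ a : S.adjDomain, S.incl a = (S.prim e).adjoint φ := by
  obtain ⟨a, ha, _⟩ := S.exists_adjDomain (φ := (S.prim e).adjoint φ)
    (χ := (S.op e).adjoint φ - φ) fun ψ => by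
      rw [ContinuousLinearMap.adjoint_inner_left, prim_generator, inner_sub_left,
        inner_sub_right, ContinuousLinearMap.adjoint_inner_left]
  exact ⟨a, ha⟩

/-- A vector x orthogonal to D(A*) is orthogonal to the range of each `(S.prim e).adjoint`, so
`S.prim e x = 0` for all e; dividing by e and letting e → 0 gives x = 0. -/
theorem dense_range_incl : Dense (Set.range S.incl) := by
  let K : Submodule ℝ H :=
    { carrier := Set.range S.incl
      zero_mem' := ⟨0, rfl⟩
      add_mem' := by rintro _ _ ⟨a, rfl⟩ ⟨b, rfl⟩; exact ⟨a + b, rfl⟩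
      smul_mem' := by rintro c _ ⟨a, rfl⟩; exact ⟨c • a, rfl⟩ }
  have : Dense (K : Set H) := by
    rw [Submodule.dense_iff_topologicalClosure_eq_top, Submodule.topologicalClosure_eq_top_iff,
      Submodule.eq_bot_iff]
    intro x hx
    have h1 : ∀ e : ℝ, S.prim e x = 0 := fun e => by
      refine ext_inner_left ℝ fun v => ?_
      obtain ⟨a, ha⟩ := S.adjoint_prim_mem e v
      rw [← ContinuousLinearMap.adjoint_inner_left, ← ha, inner_zero_right]
      exact (Submodule.mem_orthogonal K x).1 hx _ ⟨a, rfl⟩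
    have h2 := S.tendsto_inv_smul_prim x
    simp only [h1, smul_zero] at h2
    exact tendsto_nhds_unique h2 tendsto_const_nhds
  exact this

/-- On the dense subspace D(A*) the convergence is Lipschitz in t; the uniform bound on S(t) near 0
carries it over to all of H. -/
theorem tendsto_adjoint_op (x : H) : Tendsto (fun t => (S.op t).adjoint x) (𝓝 0) (𝓝 x) := by
  obtain ⟨C, hC0, hC⟩ := S.exists_norm_op_le 1
  have hnear : ∀ᶠ t : ℝ in 𝓝 0, |t| ≤ 1 := by
    filter_upwards [Icc_mem_nhds (show (-1 : ℝ) < 0 by norm_num) zero_lt_one] with t ht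
    exact abs_le.2 ht
  rw [Metric.tendsto_nhds]
  intro ε hε
  obtain ⟨_, hφ, ⟨φ, rfl⟩⟩ := Metric.dense_iff.1 S.dense_range_incl x (ε / (2 * (C + 1)))
    (by positivity)
  rw [Metric.mem_ball, dist_eq_norm] at hφ
  have h1 : Tendsto (fun t : ℝ => C * |t| * ‖S.adjGen φ‖) (𝓝 0) (𝓝 0) := by
    have : Continuous fun t : ℝ => C * |t| * ‖S.adjGen φ‖ := by fun_prop
    simpa using this.tendsto 0
  filter_upwards [hnear, h1.eventually (gt_mem_nhds (half_pos hε))] with t ht ht2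
  have h2 := S.norm_adjoint_op_sub_le φ hC0.le hC ht
  have h3 : ‖(S.op t).adjoint (x - S.incl φ)‖ ≤ C * ‖x - S.incl φ‖ :=
    ContinuousLinearMap.le_of_opNorm_le _
      (by rw [LinearIsometryEquiv.norm_map]; exact hC t (abs_le.1 ht)) _
  have h4 : (S.op t).adjoint x - x = (S.op t).adjoint (x - S.incl φ)
      + ((S.op t).adjoint (S.incl φ) - S.incl φ) + (S.incl φ - x) := by
    rw [map_sub]; abel
  rw [norm_sub_rev] at h3
  have h5 : (C + 1) * ‖S.incl φ - x‖ < ε / 2 := by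
    calc (C + 1) * ‖S.incl φ - x‖ < (C + 1) * (ε / (2 * (C + 1))) := by gcongr
      _ = ε / 2 := by field_simp
  rw [dist_eq_norm, h4]
  refine (norm_add₃_le).trans_lt ?_
  linarith

/-- The group `t ↦ S(-t)*`, whose generator is `-A*`. -/
noncomputable def dual : C0Group H where
  op t := (S.op (-t)).adjoint
  op_zero := by
    rw [neg_zero, S.op_zero]
    exact ContinuousLinearMap.adjoint_id
  op_add s t := by
    rw [← ContinuousLinearMap.adjoint_comp, ← S.op_add, neg_add_rev]
  tendsto_zero x := by
    have h : Tendsto (fun t : ℝ => -t) (𝓝 0) (𝓝 0) := by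
      simpa using (continuous_neg (G := ℝ)).tendsto 0
    exact (S.tendsto_adjoint_op x).comp h

theorem dual_op (t : ℝ) : S.dual.op t = (S.op (-t)).adjoint := rfl

theorem inner_dual_op (t : ℝ) (x y : H) : ⟪S.dual.op t x, y⟫_ℝ = ⟪x, S.op (-t) y⟫_ℝ :=
  ContinuousLinearMap.adjoint_inner_left _ _ _

theorem incl_adjOp (t : ℝ) (φ : S.adjDomain) : S.incl (S.adjOp t φ) = S.dual.op (-t) (S.incl φ) := by
  rw [dual_op, neg_neg]
  rfl

theorem adjGen_adjOp (t : ℝ) (φ : S.adjDomain) :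
    S.adjGen (S.adjOp t φ) = S.dual.op (-t) (S.adjGen φ) := by
  rw [dual_op, neg_neg]
  rfl

/-- This is the inclusion of the generator of S(-t)* in -A*. It makes every test vector of the dual
group an admissible test vector of the first equation. -/
theorem exists_adjDomain_of_dual (ψ : S.dual.generator.domain) :
    ∃ a : S.adjDomain, S.incl a = ψ ∧ S.adjGen a = -S.dual.generator ψ := by
  refine S.exists_adjDomain fun x => ?_
  have hn : Tendsto (fun t : ℝ => -t) (𝓝[≠] 0) (𝓝[≠] 0) := by
    have h1 : Tendsto (fun t : ℝ => -t) (𝓝[≠] 0) (𝓝 0) := by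
      have := (continuous_neg (G := ℝ)).tendsto 0
      rw [neg_zero] at this
      exact this.mono_left nhdsWithin_le_nhds
    exact tendsto_nhdsWithin_iff.2 ⟨h1, eventually_mem_nhdsWithin.mono fun t ht => by simpa using ht⟩
  have h1 := (S.dual.tendsto_generator ψ).inner (𝕜 := ℝ) (tendsto_const_nhds (x := (x : H)))
  have h2 := (tendsto_const_nhds (x := (ψ : H))).inner (𝕜 := ℝ) ((S.tendsto_generator x).comp hn)
  have h3 := tendsto_nhds_unique h1 ((h2.neg).congr fun t => by
    simp only [Function.comp_apply, inner_smul_left, inner_smul_right, inner_sub_left,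
      inner_sub_right, inner_dual_op, inv_neg]
    simp)
  rw [inner_neg_left, h3, neg_neg]

/-- Tested against ψ ∈ D(A), the orbit of A*φ is the derivative of s ↦ -⟨φ, S(-s)ψ⟩. Working weakly
avoids showing that D(A*) lies in the domain of the dual generator. -/
theorem dual_prim_adjGen (e : ℝ) (φ : S.adjDomain) :
    S.dual.prim e (S.adjGen φ) = -(S.dual.op e (S.incl φ) - S.incl φ) := by
  refine S.dense_domain.eq_of_inner_left ℝ fun ψ hψ => ?_
  have h1 : ∀ s : ℝ, HasDerivAt (fun s => -⟪S.incl φ, S.op (-s) ψ⟫_ℝ)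
      (⟪S.dual.op s (S.adjGen φ), ψ⟫_ℝ) s := by
    intro s
    have h2 := (S.hasDerivAt_orbit ⟨ψ, hψ⟩ (-s)).scomp s (hasDerivAt_neg s)
    have h3 := ((hasDerivAt_const s (S.incl φ)).inner ℝ h2).neg
    refine h3.congr_deriv ?_
    rw [inner_dual_op, S.inner_adjGen φ ⟨_, S.op_mem_domain (-s) ⟨ψ, hψ⟩⟩, generator_op]
    simp
  have hc : Continuous fun s => ⟪S.dual.op s (S.adjGen φ), ψ⟫_ℝ :=
    (S.dual.continuous_orbit _).inner continuous_const
  have h4 := intervalIntegral.integral_eq_sub_of_hasDerivAt (fun t _ => h1 t)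
    (hc.intervalIntegrable 0 e)
  rw [prim_apply, intervalIntegral_inner_left
    ((S.dual.continuous_orbit _).intervalIntegrable _ _), h4, inner_neg_left, inner_sub_left,
    inner_dual_op, neg_zero, S.op_zero, ContinuousLinearMap.id_apply]
  ring

end Adjoint

end C0Group

end StaticFeedback

namespace StaticFeedback

namespace C0Group

variable {H : Type*} [NormedAddCommGroup H] [InnerProductSpace ℝ H] [CompleteSpace H]
variable (S : C0Group H)

/-! ### Smoothing operators -/

/-- The inclusion `D(A*) → H` as a bounded operator. -/
noncomputable def inclL : S.adjDomain →L[ℝ] H :=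
  (WithLp.fstL 2 ℝ H H).comp S.adjDomain.subtypeL

/-- `A* : D(A*) → H` as a bounded operator. -/
noncomputable def adjGenL : S.adjDomain →L[ℝ] H :=
  (WithLp.sndL 2 ℝ H H).comp S.adjDomain.subtypeL

theorem smoothing_mem (e : ℝ) (x : H) :
    WithLp.toLp 2 (e⁻¹ • S.dual.prim e x, -(e⁻¹ • (S.dual.op e x - x))) ∈ S.adjDomain := by
  obtain ⟨a, ha, ha'⟩ := S.exists_adjDomain_of_dual ⟨_, S.dual.prim_mem_domain e x⟩
  rw [generator_prim] at ha'
  have h : WithLp.toLp 2 (e⁻¹ • S.dual.prim e x, -(e⁻¹ • (S.dual.op e x - x)))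
      = ((e⁻¹ • a : S.adjDomain) : WithLp 2 (H × H)) := by
    refine WithLp.ofLp_injective 2 (Prod.ext ?_ ?_)
    · change _ = e⁻¹ • S.incl a
      rw [ha]
    · change _ = e⁻¹ • S.adjGen a
      rw [ha', smul_neg]
  rw [h]
  exact Subtype.mem _

/-- The smoothing operator `x ↦ ε⁻¹ ∫₀ᵉ S(-s)* x ds`, with values in `D(A*)`. -/
noncomputable def smoothing (e : ℝ) : H →L[ℝ] S.adjDomain :=
  ((WithLp.prodContinuousLinearEquiv 2 ℝ H H).symm.toContinuousLinearMap.comp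
    ((e⁻¹ • S.dual.prim e).prod
      (-(e⁻¹ • (S.dual.op e - ContinuousLinearMap.id ℝ H))))).codRestrict S.adjDomain
    (S.smoothing_mem e)

theorem incl_smoothing (e : ℝ) (x : H) : S.incl (S.smoothing e x) = e⁻¹ • S.dual.prim e x := rfl

theorem adjGen_smoothing (e : ℝ) (x : H) :
    S.adjGen (S.smoothing e x) = -(e⁻¹ • (S.dual.op e x - x)) := rfl

theorem adjGen_smoothing_incl (e : ℝ) (φ : S.adjDomain) :
    S.adjGen (S.smoothing e (S.incl φ)) = S.incl (S.smoothing e (S.adjGen φ)) := by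
  rw [adjGen_smoothing, incl_smoothing, dual_prim_adjGen, smul_neg]

theorem adjOp_smoothing (e t : ℝ) (x : H) :
    S.adjOp t (S.smoothing e x) = S.smoothing e (S.dual.op (-t) x) := by
  refine S.adjDomain_ext ?_
  rw [incl_adjOp, incl_smoothing, incl_smoothing, map_smul, op_prim]

theorem adjOp_sub (t : ℝ) (φ ψ : S.adjDomain) :
    S.adjOp t (φ - ψ) = S.adjOp t φ - S.adjOp t ψ := by
  refine S.adjDomain_ext ?_
  simp only [incl_adjOp, incl_sub, map_sub]

theorem adjOp_smul (t c : ℝ) (φ : S.adjDomain) : S.adjOp t (c • φ) = c • S.adjOp t φ := by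
  refine S.adjDomain_ext ?_
  simp only [incl_adjOp, incl_smul, map_smul]

theorem adjOp_add (s t : ℝ) (φ : S.adjDomain) :
    S.adjOp (s + t) φ = S.adjOp s (S.adjOp t φ) := by
  refine S.adjDomain_ext ?_
  simp only [incl_adjOp, op_op, neg_add]

theorem continuous_adjDomain_iff {α : Type*} [TopologicalSpace α] {F : α → S.adjDomain} :
    Continuous F ↔ Continuous (fun a => S.incl (F a)) ∧ Continuous fun a => S.adjGen (F a) := by
  refine ⟨fun h => ⟨S.inclL.continuous.comp h, S.adjGenL.continuous.comp h⟩, fun h => ?_⟩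
  rw [continuous_induced_rng]
  exact (WithLp.prodContinuousLinearEquiv 2 ℝ H H).symm.continuous.comp (h.1.prodMk h.2)

theorem tendsto_adjDomain {α : Type*} {l : Filter α} {F : α → S.adjDomain} {φ : S.adjDomain}
    (h1 : Tendsto (fun a => S.incl (F a)) l (𝓝 (S.incl φ)))
    (h2 : Tendsto (fun a => S.adjGen (F a)) l (𝓝 (S.adjGen φ))) : Tendsto F l (𝓝 φ) := by
  rw [tendsto_subtype_rng]
  exact ((WithLp.prodContinuousLinearEquiv 2 ℝ H H).symm.continuous.tendsto _).comp
    (h1.prodMk_nhds h2)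

theorem continuous_adjOp (φ : S.adjDomain) : Continuous fun t => S.adjOp t φ := by
  rw [continuous_adjDomain_iff]
  simp only [incl_adjOp, adjGen_adjOp]
  exact ⟨(S.dual.continuous_orbit _).comp continuous_neg,
    (S.dual.continuous_orbit _).comp continuous_neg⟩

theorem tendsto_incl_smoothing (x : H) :
    Tendsto (fun e => S.incl (S.smoothing e x)) (𝓝[≠] 0) (𝓝 x) :=
  S.dual.tendsto_inv_smul_prim x

/-- Since smoothing commutes with A*, convergence in H of both components is convergence in the
graph norm, which is what B* needs. -/
theorem tendsto_smoothing_incl (φ : S.adjDomain) :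
    Tendsto (fun e => S.smoothing e (S.incl φ)) (𝓝[≠] 0) (𝓝 φ) := by
  refine S.tendsto_adjDomain (S.tendsto_incl_smoothing _) ?_
  simp only [adjGen_smoothing_incl]
  exact S.tendsto_incl_smoothing _

/-- The sequence of smoothing operators with parameter `1 / (n + 1)`. -/
noncomputable def smooth (n : ℕ) : H →L[ℝ] S.adjDomain := S.smoothing (1 / ((n : ℝ) + 1))

theorem tendsto_smooth_parameter :
    Tendsto (fun n : ℕ => 1 / ((n : ℝ) + 1)) atTop (𝓝[≠] 0) :=
  tendsto_nhdsWithin_iff.2 ⟨tendsto_one_div_add_atTop_nhds_zero_nat,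
    Eventually.of_forall fun n => by
      have : (0 : ℝ) < 1 / ((n : ℝ) + 1) := by positivity
      exact this.ne'⟩

theorem tendsto_incl_smooth (x : H) :
    Tendsto (fun n => S.incl (S.smooth n x)) atTop (𝓝 x) :=
  (S.tendsto_incl_smoothing x).comp tendsto_smooth_parameter

theorem tendsto_smooth_incl (φ : S.adjDomain) :
    Tendsto (fun n => S.smooth n (S.incl φ)) atTop (𝓝 φ) :=
  (S.tendsto_smoothing_incl φ).comp tendsto_smooth_parameter

theorem exists_norm_incl_smooth_le :
    ∃ C : ℝ, 0 < C ∧ ∀ n x, ‖S.incl (S.smooth n x)‖ ≤ C * ‖x‖ := by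
  obtain ⟨C, hC⟩ := banach_steinhaus (g := fun n => S.inclL.comp (S.smooth n)) fun x => by
    obtain ⟨C, hC⟩ := (S.tendsto_incl_smooth x).norm.bddAbove_range
    exact ⟨C, fun n => hC ⟨n, rfl⟩⟩
  refine ⟨max C 1, by positivity, fun n x => ?_⟩
  exact ContinuousLinearMap.le_of_opNorm_le _ ((hC n).trans (le_max_left _ _)) x

end C0Group

/-! ### The observation inequality -/

section Observation

variable {H : Type*} [NormedAddCommGroup H] [InnerProductSpace ℝ H] [CompleteSpace H]

/-- The Cauchy-Schwarz inequality on an interval. -/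
theorem sq_integral_le {T : ℝ} (hT : 0 < T) {b : ℝ → ℝ} (hb : Continuous b) :
    (∫ s in (0 : ℝ)..T, b s) ^ 2 ≤ T * ∫ s in (0 : ℝ)..T, b s ^ 2 := by
  set m := ∫ s in (0 : ℝ)..T, b s with hm
  have h1 : 0 ≤ ∫ s in (0 : ℝ)..T, (T * b s - m) ^ 2 :=
    intervalIntegral.integral_nonneg hT.le fun s _ => sq_nonneg _
  have h2 : ∀ s, (T * b s - m) ^ 2 = T ^ 2 * b s ^ 2 - (2 * T * m) * b s + m ^ 2 := fun s => by ring
  have i1 : IntervalIntegrable (fun s => T ^ 2 * b s ^ 2) volume 0 T :=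
    (continuous_const.mul (hb.pow 2)).intervalIntegrable _ _
  have i2 : IntervalIntegrable (fun s => (2 * T * m) * b s) volume 0 T :=
    (continuous_const.mul hb).intervalIntegrable _ _
  simp only [h2] at h1
  rw [intervalIntegral.integral_add (i1.sub i2) (by simp), intervalIntegral.integral_sub i1 i2,
    intervalIntegral.integral_const_mul, intervalIntegral.integral_const_mul, ← hm,
    intervalIntegral.integral_const, sub_zero, smul_eq_mul] at h1
  have h3 : 0 ≤ T * (T * (∫ s in (0 : ℝ)..T, b s ^ 2) - m ^ 2) := by nlinarith
  have := nonneg_of_mul_nonneg_right h3 hT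
  linarith

theorem norm_sq_le_of_eq_add_integral {U : Type*} [NormedAddCommGroup U]
    [InnerProductSpace ℝ U] {T : ℝ} (hT : 0 < T) {y a : U} {b : ℝ → U}
    (hb : Continuous b) {t : ℝ} (ht : t ∈ Icc 0 T) (hy : y = a + ∫ s in (0 : ℝ)..t, b s) :
    ‖y‖ ^ 2 ≤ 2 * ‖a‖ ^ 2 + 2 * T * ∫ s in (0 : ℝ)..T, ‖b s‖ ^ 2 := by
  have h2 : ‖∫ s in (0 : ℝ)..t, b s‖ ≤ ∫ s in (0 : ℝ)..T, ‖b s‖ := by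
    refine (intervalIntegral.norm_integral_le_integral_norm ht.1).trans ?_
    exact intervalIntegral.integral_mono_interval le_rfl ht.1 ht.2
      (Eventually.of_forall fun s => norm_nonneg _) (hb.norm.intervalIntegrable _ _)
  have h3 := sq_integral_le hT hb.norm
  have h4 : ‖y‖ ≤ ‖a‖ + ∫ s in (0 : ℝ)..T, ‖b s‖ := by
    rw [hy]
    exact (norm_add_le _ _).trans (by gcongr)
  have h5 : ‖y‖ ^ 2 ≤ (‖a‖ + ∫ s in (0 : ℝ)..T, ‖b s‖) ^ 2 := by
    gcongr
  have h6 := add_sq_le (a := ‖a‖) (b := ∫ s in (0 : ℝ)..T, ‖b s‖)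
  linarith

theorem memLp_two_of_continuous {U : Type*} [NormedAddCommGroup U] {g : ℝ → U}
    (hg : Continuous g) (T : ℝ) :
    MemLp g 2 (volume.restrict (Ioo 0 T)) := by
  obtain ⟨C, hC⟩ := isCompact_Icc.exists_bound_of_continuousOn hg.continuousOn (s := Icc 0 T)
  refine MemLp.of_bound hg.aestronglyMeasurable.restrict C ?_
  rw [ae_restrict_iff' measurableSet_Ioo]
  exact Eventually.of_forall fun t ht => hC t (Ioo_subset_Icc_self ht)

theorem norm_toLp_sq {U : Type*} [NormedAddCommGroup U] [InnerProductSpace ℝ U]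
    {μ : Measure ℝ} {g : ℝ → U} (hg : MemLp g 2 μ) :
    ‖hg.toLp g‖ ^ 2 = ∫ t, ‖g t‖ ^ 2 ∂μ := by
  rw [← real_inner_self_eq_norm_sq, L2.inner_def]
  refine integral_congr_ae ?_
  filter_upwards [hg.coeFn_toLp] with t ht
  rw [ht, real_inner_self_eq_norm_sq]

variable {U : Type*} [NormedAddCommGroup U] [InnerProductSpace ℝ U] [CompleteSpace U]

/-- `B*` as a bounded operator on `D(A*)`. -/
noncomputable def ctrlAdjL (S : C0Group H) (B : U →L[ℝ] StrongDual ℝ S.adjDomain) :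
    S.adjDomain →L[ℝ] U :=
  LinearMap.mkContinuous
    { toFun := ctrlAdj S B
      map_add' := fun φ ψ => ext_inner_left ℝ fun u => by
        simp only [inner_add_right, inner_ctrlAdj, map_add]
      map_smul' := fun c φ => ext_inner_left ℝ fun u => by
        simp only [inner_smul_right, inner_ctrlAdj, map_smul, RingHom.id_apply, smul_eq_mul] }
    ‖B.flip‖ fun φ => by
      change ‖ctrlAdj S B φ‖ ≤ _
      rw [ctrlAdj, LinearIsometryEquiv.norm_map]
      exact B.flip.le_opNorm φ

theorem ctrlAdjL_apply (S : C0Group H) (B : U →L[ℝ] StrongDual ℝ S.adjDomain) (φ : S.adjDomain) :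
    ctrlAdjL S B φ = ctrlAdj S B φ := rfl

variable {S : C0Group H} {B : U →L[ℝ] StrongDual ℝ S.adjDomain}

/-- The direct inequality, by duality. For each control u, pairing u with t ↦ B*S(T - t)*φ gives
⟨Φ(T), φ⟩, which is bounded over ‖φ‖ ≤ 1; Banach-Steinhaus in L² makes the bound uniform in u. -/
theorem IsAdmissible.exists_observation_bound (hB : IsAdmissible S B) {T : ℝ} (hT : 0 < T) :
    ∃ M : ℝ, 0 ≤ M ∧ ∀ φ : S.adjDomain,
      ∫ t in (0 : ℝ)..T, ‖ctrlAdj S B (S.adjOp (-t) φ)‖ ^ 2 ≤ M * ‖S.incl φ‖ ^ 2 := by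
  have hgc : ∀ φ, Continuous fun s => ctrlAdj S B (S.adjOp (T - s) φ) := fun φ =>
    (ctrlAdjL S B).continuous.comp ((S.continuous_adjOp φ).comp (continuous_const.sub continuous_id))
  have hg := fun φ => memLp_two_of_continuous (hgc φ) T
  obtain ⟨C, hC⟩ := banach_steinhaus
    (g := fun φ : {φ : S.adjDomain // ‖S.incl φ‖ ≤ 1} => innerSL ℝ ((hg φ).toLp _)) fun u => by
      obtain ⟨Φ, _, hΦ⟩ := hB T hT u (Lp.memLp u)
      refine ⟨‖Φ T‖, fun φ => ?_⟩
      have h1 := hΦ T ⟨hT.le, le_rfl⟩ φ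
      have h2 : innerSL ℝ ((hg φ).toLp _) u = ⟪Φ T, S.incl φ⟫_ℝ := by
        rw [innerSL_apply_apply, h1, L2.inner_def, ← setIntegral_Ioo_eq hT.le]
        refine integral_congr_ae ?_
        filter_upwards [(hg φ).coeFn_toLp] with t ht
        rw [ht, real_inner_comm, inner_ctrlAdj]
      rw [h2, Real.norm_eq_abs]
      exact (abs_real_inner_le_norm _ _).trans (mul_le_of_le_one_right (norm_nonneg _) φ.2)
  have hC0 : 0 ≤ max C 0 := le_max_right _ _
  have key : ∀ φ : S.adjDomain, ∫ t in (0 : ℝ)..T, ‖ctrlAdj S B (S.adjOp (T - t) φ)‖ ^ 2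
      ≤ (max C 0) ^ 2 * ‖S.incl φ‖ ^ 2 := by
    have h1 : ∀ φ : S.adjDomain, ‖S.incl φ‖ ≤ 1 →
        ∫ t in (0 : ℝ)..T, ‖ctrlAdj S B (S.adjOp (T - t) φ)‖ ^ 2 ≤ (max C 0) ^ 2 := by
      intro φ hφ
      rw [← setIntegral_Ioo_eq hT.le, ← norm_toLp_sq (hg φ)]
      have := hC ⟨φ, hφ⟩
      rw [innerSL_apply_norm] at this
      gcongr
      exact this.trans (le_max_left _ _)
    intro φ
    rcases (norm_nonneg (S.incl φ)).eq_or_lt with h0 | h0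
    · have hφ : φ = 0 := S.adjDomain_ext (norm_eq_zero.1 h0.symm)
      have hz : ∀ t, ctrlAdj S B (S.adjOp (T - t) φ) = 0 := fun t => by
        have : S.adjOp (T - t) φ = 0 := by
          have h := S.adjOp_smul (T - t) 0 φ
          rw [zero_smul, zero_smul] at h
          rw [hφ]
          exact h
        rw [this]
        exact map_zero (ctrlAdjL S B)
      simp [hz, ← h0]
    · have h2 := h1 (‖S.incl φ‖⁻¹ • φ) (by
        rw [C0Group.incl_smul, norm_smul, norm_inv, norm_norm, inv_mul_cancel₀ h0.ne'])
      have h3 : ∀ t, ‖ctrlAdj S B (S.adjOp (T - t) (‖S.incl φ‖⁻¹ • φ))‖ ^ 2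
          = (‖S.incl φ‖⁻¹) ^ 2 * ‖ctrlAdj S B (S.adjOp (T - t) φ)‖ ^ 2 := fun t => by
        rw [S.adjOp_smul, ← ctrlAdjL_apply, map_smul, norm_smul, norm_inv, norm_norm, mul_pow,
          ctrlAdjL_apply]
      simp only [h3] at h2
      rw [intervalIntegral.integral_const_mul, inv_pow, inv_mul_le_iff₀ (by positivity)] at h2
      linarith
  -- Replacing φ by S(-T)*φ changes the orbit S(T - t)*φ into S(-t)*φ, at the cost of the norm of
  -- S(-T)*; invertibility of the group is used here.
  refine ⟨(max C 0) ^ 2 * ‖S.dual.op T‖ ^ 2, by positivity, fun φ => ?_⟩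
  have h1 := key (S.adjOp (-T) φ)
  have h2 : ∀ t, S.adjOp (T - t) (S.adjOp (-T) φ) = S.adjOp (-t) φ := fun t => by
    rw [← S.adjOp_add]
    congr 1
    ring
  simp only [h2] at h1
  refine h1.trans ?_
  rw [C0Group.incl_adjOp, neg_neg]
  calc (max C 0) ^ 2 * ‖S.dual.op T (S.incl φ)‖ ^ 2
      ≤ (max C 0) ^ 2 * (‖S.dual.op T‖ * ‖S.incl φ‖) ^ 2 := by
        gcongr
        exact ContinuousLinearMap.le_opNorm _ _
    _ = _ := by ring

/-- An estimate for bounded observations of a mild solution. -/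
theorem integral_norm_sq_observation_le (G : C0Group H) {T M : ℝ} (hT : 0 < T) (E : H →L[ℝ] U)
    (j : H →L[ℝ] H)
    (hME : ∀ y, ∫ t in (0 : ℝ)..T, ‖E (G.op t y)‖ ^ 2 ≤ M * ‖j y‖ ^ 2)
    {x z : ℝ → H} (hx : Continuous x) {z₀ : H} (hzc : Continuous z)
    (hz : ∀ t, z t = G.op t (z₀ + ∫ s in (0 : ℝ)..t, x s)) :
    ∫ t in (0 : ℝ)..T, ‖E (z t)‖ ^ 2
      ≤ 2 * M * ‖j z₀‖ ^ 2 + 2 * T * M * ∫ s in (0 : ℝ)..T, ‖j (x s)‖ ^ 2 := by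
  have hbc : Continuous fun q : ℝ × ℝ => ‖E (G.op q.1 (x q.2))‖ :=
    (E.continuous.comp (G.continuous_op_apply continuous_fst (hx.comp continuous_snd))).norm
  have hbt' : ∀ t, Continuous fun s => E (G.op t (x s)) := fun t =>
    E.continuous.comp ((G.op t).continuous.comp hx)
  have hac : Continuous fun t => ‖E (G.op t z₀)‖ :=
    (E.continuous.comp (G.continuous_orbit z₀)).norm
  have hpt : ∀ t ∈ Icc 0 T, ‖E (z t)‖ ^ 2
      ≤ 2 * ‖E (G.op t z₀)‖ ^ 2 + 2 * T * ∫ s in (0 : ℝ)..T, ‖E (G.op t (x s))‖ ^ 2 := by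
    intro t ht
    -- With `G.op t` kept in front, each s contributes a free orbit started at x(s). After the
    -- s-integral is enlarged to [0, T] and the order is exchanged, `hME` applies to every x(s), and
    -- no norm of E enters.
    have h1 : E (z t) = E (G.op t z₀) + ∫ s in (0 : ℝ)..t, E (G.op t (x s)) := by
      rw [hz, map_add, map_add]
      congr 1
      exact ((E.comp (G.op t)).intervalIntegral_comp_comm (hx.intervalIntegrable _ _)).symm
    exact norm_sq_le_of_eq_add_integral hT (hbt' t) ht h1
  have hb2 : Continuous (Function.uncurry fun t s : ℝ => ‖E (G.op t (x s))‖ ^ 2) := hbc.pow 2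
  have hinner : Continuous fun t => ∫ s in (0 : ℝ)..T, ‖E (G.op t (x s))‖ ^ 2 :=
    intervalIntegral.continuous_parametric_intervalIntegral_of_continuous' hb2 0 T
  have hb2' : Continuous (Function.uncurry fun s t : ℝ => ‖E (G.op t (x s))‖ ^ 2) :=
    hb2.comp continuous_swap
  have hinner' : Continuous fun s => ∫ t in (0 : ℝ)..T, ‖E (G.op t (x s))‖ ^ 2 :=
    intervalIntegral.continuous_parametric_intervalIntegral_of_continuous' hb2' 0 T
  have hswap : ∫ t in (0 : ℝ)..T, ∫ s in (0 : ℝ)..T, ‖E (G.op t (x s))‖ ^ 2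
      = ∫ s in (0 : ℝ)..T, ∫ t in (0 : ℝ)..T, ‖E (G.op t (x s))‖ ^ 2 :=
    intervalIntegral_intervalIntegral_swap
      ((hb2.continuousOn.integrableOn_compact (isCompact_uIcc.prod isCompact_uIcc)).mono_set
        (prod_mono uIoc_subset_uIcc uIoc_subset_uIcc))
  have hxs : Continuous fun s => M * ‖j (x s)‖ ^ 2 :=
    continuous_const.mul ((j.continuous.comp hx).norm.pow 2)
  calc ∫ t in (0 : ℝ)..T, ‖E (z t)‖ ^ 2
      ≤ ∫ t in (0 : ℝ)..T, (2 * ‖E (G.op t z₀)‖ ^ 2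
          + 2 * T * ∫ s in (0 : ℝ)..T, ‖E (G.op t (x s))‖ ^ 2) := by
        refine intervalIntegral.integral_mono_on hT.le ?_ ?_ hpt
        · exact ((E.continuous.comp hzc).norm.pow 2).intervalIntegrable _ _
        · exact ((continuous_const.mul (hac.pow 2)).add
            (continuous_const.mul hinner)).intervalIntegrable _ _
    _ = 2 * (∫ t in (0 : ℝ)..T, ‖E (G.op t z₀)‖ ^ 2)
          + 2 * T * ∫ s in (0 : ℝ)..T, ∫ t in (0 : ℝ)..T, ‖E (G.op t (x s))‖ ^ 2 := by
        have i1 : IntervalIntegrable (fun t => 2 * ‖E (G.op t z₀)‖ ^ 2) volume 0 T :=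
          (continuous_const.mul (hac.pow 2)).intervalIntegrable _ _
        have i2 : IntervalIntegrable (fun t => 2 * T * ∫ s in (0 : ℝ)..T,
            ‖E (G.op t (x s))‖ ^ 2) volume 0 T :=
          (continuous_const.mul hinner).intervalIntegrable _ _
        rw [intervalIntegral.integral_add i1 i2,
          intervalIntegral.integral_const_mul, intervalIntegral.integral_const_mul, hswap]
    _ ≤ 2 * (M * ‖j z₀‖ ^ 2)
          + 2 * T * ∫ s in (0 : ℝ)..T, M * ‖j (x s)‖ ^ 2 := by
        gcongr
        · exact hME z₀
        · exact intervalIntegral.integral_mono_on hT.le (hinner'.intervalIntegrable _ _)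
            (hxs.intervalIntegrable _ _) fun s _ => hME (x s)
    _ = _ := by
        rw [intervalIntegral.integral_const_mul]
        ring

end Observation

end StaticFeedback

namespace StaticFeedback

/-! ### Convergence of regularised observations in L² -/

section L2

variable {H : Type*} [NormedAddCommGroup H] [InnerProductSpace ℝ H] [CompleteSpace H]
variable {U : Type*} [NormedAddCommGroup U] [InnerProductSpace ℝ U] [CompleteSpace U]

theorem norm_sub_sq_le {E : Type*} [NormedAddCommGroup E] (a b c : E) :
    ‖a - b‖ ^ 2 ≤ 2 * ‖a - c‖ ^ 2 + 2 * ‖b - c‖ ^ 2 := by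
  have h1 : ‖a - b‖ ≤ ‖a - c‖ + ‖b - c‖ := by
    rw [norm_sub_rev b c]
    exact norm_sub_le_norm_sub_add_norm_sub _ _ _
  have h2 : ‖a - b‖ ^ 2 ≤ (‖a - c‖ + ‖b - c‖) ^ 2 := by gcongr
  have h3 := add_sq_le (a := ‖a - c‖) (b := ‖b - c‖)
  linarith

theorem cauchySeq_of_dist_sq_le {α : Type*} [PseudoMetricSpace α] {V : ℕ → α} {g : ℕ → ℝ}
    (hg : Tendsto g atTop (𝓝 0)) (h : ∀ n m, dist (V n) (V m) ^ 2 ≤ g n + g m) : CauchySeq V := by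
  rw [Metric.cauchySeq_iff]
  intro ε hε
  obtain ⟨N, hN⟩ := eventually_atTop.1 (hg.eventually (gt_mem_nhds (show 0 < ε ^ 2 / 2 by positivity)))
  refine ⟨N, fun m hm n hn => lt_of_pow_lt_pow_left₀ 2 hε.le ?_⟩
  linarith [h m n, hN m hm, hN n hn]

/-- Approximate observations of a mild solution converge in `L²` if they satisfy the direct
inequality uniformly. -/
theorem exists_tendsto_observation (G : C0Group H) {T M : ℝ} (hT : 0 < T) (hM : 0 ≤ M)
    (E : ℕ → H →L[ℝ] U) (j : ℕ → H →L[ℝ] H)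
    (hME : ∀ n m y, ∫ t in (0 : ℝ)..T, ‖(E n - E m) (G.op t y)‖ ^ 2 ≤ M * ‖(j n - j m) y‖ ^ 2)
    (hj : ∀ y, Tendsto (fun n => j n y) atTop (𝓝 y)) {C : ℝ} (hC : ∀ n y, ‖j n y‖ ≤ C * ‖y‖)
    {x z : ℝ → H} (hx : Continuous x) {z₀ : H} (hzc : Continuous z)
    (hz : ∀ t, z t = G.op t (z₀ + ∫ s in (0 : ℝ)..t, x s)) :
    ∃ V : Lp U 2 (volume.restrict (Ioo 0 T)),
      Tendsto (fun n => (memLp_two_of_continuous ((E n).continuous.comp hzc) T).toLp _) atTop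
        (𝓝 V) := by
  refine cauchySeq_tendsto_of_complete ?_
  -- The factor 4 is the 2 of the direct estimate times the 2 from splitting the square of j n - j m
  -- through the identity, so squared distances are at most a n + a m.
  set a : ℕ → ℝ := fun n => 4 * M * ‖j n z₀ - z₀‖ ^ 2
    + 4 * T * M * ∫ s in (0 : ℝ)..T, ‖j n (x s) - x s‖ ^ 2 with ha
  have ha0 : Tendsto a atTop (𝓝 0) := by
    have h1 : ∀ y, Tendsto (fun n => ‖j n y - y‖ ^ 2) atTop (𝓝 0) := fun y => by
      have := (((hj y).sub_const y).norm).pow 2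
      simpa using this
    have h2 : Tendsto (fun n => ∫ s in (0 : ℝ)..T, ‖j n (x s) - x s‖ ^ 2) atTop
        (𝓝 (∫ s in (0 : ℝ)..T, (0 : ℝ))) := by
      refine intervalIntegral.tendsto_integral_filter_of_dominated_convergence
        (fun s => ((C + 1) * ‖x s‖) ^ 2) (Eventually.of_forall fun n => ?_)
        (Eventually.of_forall fun n => Eventually.of_forall fun s _ => ?_) ?_
        (Eventually.of_forall fun s _ => h1 (x s))
      · exact ((((j n).continuous.comp hx).sub hx).norm.pow 2).aestronglyMeasurable
      · rw [Real.norm_of_nonneg (by positivity)]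
        gcongr
        calc ‖j n (x s) - x s‖ ≤ ‖j n (x s)‖ + ‖x s‖ := norm_sub_le _ _
          _ ≤ C * ‖x s‖ + ‖x s‖ := by gcongr; exact hC n _
          _ = (C + 1) * ‖x s‖ := by ring
      · exact ((continuous_const.mul hx.norm).pow 2).intervalIntegrable _ _
    have := ((h1 z₀).const_mul (4 * M)).add (h2.const_mul (4 * T * M))
    simpa [ha] using this
  refine cauchySeq_of_dist_sq_le ha0 fun n m => ?_
  rw [dist_eq_norm, ← MemLp.toLp_sub, norm_toLp_sq]
  have h1 := integral_norm_sq_observation_le G hT (E n - E m) (j n - j m) (hME n m) hx hzc hz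
  rw [← setIntegral_Ioo_eq hT.le] at h1
  refine h1.trans ?_
  have h2 : ‖(j n - j m) z₀‖ ^ 2 ≤ 2 * ‖j n z₀ - z₀‖ ^ 2 + 2 * ‖j m z₀ - z₀‖ ^ 2 :=
    norm_sub_sq_le _ _ _
  have hi : ∀ n, IntervalIntegrable (fun s => 2 * ‖j n (x s) - x s‖ ^ 2) volume 0 T := fun n =>
    (continuous_const.mul ((((j n).continuous.comp hx).sub hx).norm.pow 2)).intervalIntegrable _ _
  have h3 : ∫ s in (0 : ℝ)..T, ‖(j n - j m) (x s)‖ ^ 2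
      ≤ 2 * (∫ s in (0 : ℝ)..T, ‖j n (x s) - x s‖ ^ 2)
        + 2 * ∫ s in (0 : ℝ)..T, ‖j m (x s) - x s‖ ^ 2 := by
    rw [← intervalIntegral.integral_const_mul, ← intervalIntegral.integral_const_mul,
      ← intervalIntegral.integral_add (hi n) (hi m)]
    exact intervalIntegral.integral_mono_on hT.le
      ((((j n - j m).continuous.comp hx).norm.pow 2).intervalIntegrable _ _)
      ((hi n).add (hi m)) fun s _ => norm_sub_sq_le _ _ _
  have h4 := mul_le_mul_of_nonneg_left h2 (by positivity : 0 ≤ 2 * M)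
  have h5 := mul_le_mul_of_nonneg_left h3 (by positivity : 0 ≤ 2 * T * M)
  simp only [ha]
  linarith

theorem setIntegral_restrict_Ioo_eq {E : Type*} [NormedAddCommGroup E] [NormedSpace ℝ E] {T a b : ℝ}
    (ha : 0 ≤ a) (hab : a ≤ b) (hb : b ≤ T) (F : ℝ → E) :
    ∫ s in Ioo a b, F s ∂(volume.restrict (Ioo 0 T)) = ∫ s in a..b, F s := by
  rw [Measure.restrict_restrict measurableSet_Ioo,
    inter_eq_left.2 (Ioo_subset_Ioo ha hb), intervalIntegral.integral_of_le hab,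
    integral_Ioc_eq_integral_Ioo]

theorem tendsto_inner_intervalIntegral {T a b : ℝ} (ha : 0 ≤ a) (hab : a ≤ b) (hb : b ≤ T)
    {g : ℕ → ℝ → U} (hg : ∀ n, MemLp (g n) 2 (volume.restrict (Ioo 0 T)))
    {V : Lp U 2 (volume.restrict (Ioo 0 T))}
    (hV : Tendsto (fun n => (hg n).toLp (g n)) atTop (𝓝 V)) (u : U) :
    Tendsto (fun n => ⟪u, ∫ s in a..b, g n s⟫_ℝ) atTop (𝓝 ⟪u, ∫ s in a..b, V s⟫_ℝ) := by
  have hfin : (volume.restrict (Ioo 0 T)) (Ioo a b) ≠ ⊤ := measure_ne_top _ _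
  have h1 := (tendsto_const_nhds (x := indicatorConstLp 2 measurableSet_Ioo hfin u)).inner
    (𝕜 := ℝ) hV
  simp only [L2.inner_indicatorConstLp_eq_inner_setIntegral] at h1
  rw [setIntegral_restrict_Ioo_eq ha hab hb] at h1
  refine h1.congr fun n => ?_
  rw [← setIntegral_restrict_Ioo_eq ha hab hb (g n)]
  congr 1
  exact setIntegral_congr_ae measurableSet_Ioo ((hg n).coeFn_toLp.mono fun s hs _ => hs)

/-- Restriction to (a, b) and pointwise application of W are bounded operators on L², so the
quadratic form is continuous for the norm of L². -/
theorem tendsto_integral_inner_comp {T a b : ℝ} (ha : 0 ≤ a) (hab : a ≤ b) (hb : b ≤ T)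
    {g : ℕ → ℝ → U} (hg : ∀ n, MemLp (g n) 2 (volume.restrict (Ioo 0 T)))
    {V : Lp U 2 (volume.restrict (Ioo 0 T))}
    (hV : Tendsto (fun n => (hg n).toLp (g n)) atTop (𝓝 V)) (W : U →L[ℝ] U) :
    Tendsto (fun n => ∫ s in a..b, ⟪W (g n s), g n s⟫_ℝ) atTop
      (𝓝 (∫ s in a..b, ⟪W (V s), V s⟫_ℝ)) := by
  let r := LpToLpRestrictCLM ℝ U ℝ (volume.restrict (Ioo 0 T)) 2 (Ioo a b)
  let w := W.compLpL 2 ((volume.restrict (Ioo 0 T)).restrict (Ioo a b))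
  have hrc : Continuous fun f => ⟪w (r f), r f⟫_ℝ :=
    (w.continuous.comp r.continuous).inner r.continuous
  have hval : ∀ f : Lp U 2 (volume.restrict (Ioo 0 T)), ⟪w (r f), r f⟫_ℝ = ∫ s in a..b, ⟪W (f s), f s⟫_ℝ := by
    intro f
    rw [L2.inner_def, ← setIntegral_restrict_Ioo_eq ha hab hb]
    refine integral_congr_ae ?_
    filter_upwards [W.coeFn_compLpL (p := 2) (μ := (volume.restrict (Ioo 0 T)).restrict (Ioo a b)) (r f),
      LpToLpRestrictCLM_coeFn ℝ (Ioo a b) f] with s hs1 hs2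
    rw [hs1, hs2]
  have h1 := (hrc.tendsto V).comp hV
  rw [hval] at h1
  refine h1.congr fun n => ?_
  rw [Function.comp_apply, hval, ← setIntegral_restrict_Ioo_eq ha hab hb,
    ← setIntegral_restrict_Ioo_eq ha hab hb]
  exact setIntegral_congr_ae measurableSet_Ioo ((hg n).coeFn_toLp.mono fun s hs _ => by rw [hs])

end L2

/-! ### Mild solutions of the adjoint equation -/

section Mild

variable {H : Type*} [NormedAddCommGroup H] [InnerProductSpace ℝ H] [CompleteSpace H]
variable {U : Type*} [NormedAddCommGroup U] [InnerProductSpace ℝ U] [CompleteSpace U]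

/-- `z` is a mild solution of `z' = -A* z + k` in `ℝ`. -/
structure IsMild (S : C0Group H) (k z : ℝ → H) : Prop where
  continuous_source : Continuous k
  continuous : Continuous z
  hasDerivAt : ∀ t, HasDerivAt (fun t => S.dual.op (-t) (z t)) (S.dual.op (-t) (k t)) t

namespace IsMild

variable {S : C0Group H} {B : U →L[ℝ] StrongDual ℝ S.adjDomain} {k z : ℝ → H}

theorem eq_op (h : IsMild S k z) (t : ℝ) :
    z t = S.dual.op t (z 0 + ∫ s in (0 : ℝ)..t, S.dual.op (-s) (k s)) := by
  have hc : Continuous fun s => S.dual.op (-s) (k s) :=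
    S.dual.continuous_op_apply continuous_neg h.continuous_source
  rw [intervalIntegral.integral_eq_sub_of_hasDerivAt (fun s _ => h.hasDerivAt s)
    (hc.intervalIntegrable _ _), neg_zero, S.dual.op_zero, ContinuousLinearMap.id_apply,
    add_sub_cancel, S.dual.op_op_neg]

theorem hasDerivAt_inner (h : IsMild S k z) (ψ : S.generator.domain) (t : ℝ) :
    HasDerivAt (fun t => ⟪z t, (ψ : H)⟫_ℝ) (-⟪z t, S.generator ψ⟫_ℝ + ⟪k t, (ψ : H)⟫_ℝ) t := by
  have h1 : HasDerivAt (fun t => S.op (-t) ψ) (-S.op (-t) (S.generator ψ)) t := by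
    have := (S.hasDerivAt_orbit ψ (-t)).scomp t (hasDerivAt_neg t)
    simpa [Function.comp_def] using this
  have h2 := (h.hasDerivAt t).inner ℝ h1
  have h3 : ∀ x y, ⟪S.dual.op (-t) x, S.op (-t) y⟫_ℝ = ⟪x, y⟫_ℝ := fun x y => by
    rw [S.inner_dual_op, neg_neg, S.op_op_neg]
  have h4 : (fun t => ⟪S.dual.op (-t) (z t), S.op (-t) (ψ : H)⟫_ℝ) = fun t => ⟪z t, (ψ : H)⟫_ℝ := by
    ext t
    rw [S.inner_dual_op, neg_neg, S.op_op_neg]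
  rw [h4] at h2
  refine h2.congr_deriv ?_
  rw [inner_neg_right, h3, h3]

theorem inner_sub_eq_integral (h : IsMild S k z) (ψ : S.generator.domain) (a b : ℝ) :
    ⟪z b, (ψ : H)⟫_ℝ - ⟪z a, (ψ : H)⟫_ℝ
      = ∫ s in a..b, (-⟪z s, S.generator ψ⟫_ℝ + ⟪k s, (ψ : H)⟫_ℝ) := by
  have hc : Continuous fun s => -⟪z s, S.generator ψ⟫_ℝ + ⟪k s, (ψ : H)⟫_ℝ :=
    (h.continuous.inner continuous_const).neg.add (h.continuous_source.inner continuous_const)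
  exact (intervalIntegral.integral_eq_sub_of_hasDerivAt (fun s _ => h.hasDerivAt_inner ψ s)
    (hc.intervalIntegrable _ _)).symm

/-- Integrating the equation tested with ψ ∈ D(A) gives ⟨∫z, Aψ⟩ = ⟨z(a) - z(b) + ∫k, ψ⟩, which is
the definition of membership in D(A*). Time averages thus gain the regularity that z(t) lacks. -/
theorem exists_integral_mem (h : IsMild S k z) (a b : ℝ) :
    ∃ φ : S.adjDomain, S.incl φ = ∫ s in a..b, z s ∧
      S.adjGen φ = z a - z b + ∫ s in a..b, k s := by
  refine S.exists_adjDomain fun ψ => ?_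
  have h1 := h.inner_sub_eq_integral ψ a b
  have i1 : IntervalIntegrable (fun s => -⟪z s, S.generator ψ⟫_ℝ) volume a b :=
    (h.continuous.inner continuous_const).neg.intervalIntegrable _ _
  have i2 : IntervalIntegrable (fun s => ⟪k s, (ψ : H)⟫_ℝ) volume a b :=
    (h.continuous_source.inner continuous_const).intervalIntegrable _ _
  rw [intervalIntegral.integral_add i1 i2, intervalIntegral.integral_neg,
    ← intervalIntegral_inner_left (h.continuous.intervalIntegrable _ _),
    ← intervalIntegral_inner_left (h.continuous_source.intervalIntegrable _ _)] at h1
  rw [inner_add_left, inner_sub_left]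
  linarith

/-- The observation is the L² limit of B* applied to the smoothed trajectory. It has the right
integrals because smoothing ∫z converges in the graph norm. The convergence of the W-forms is
recorded for the energy identity. -/
theorem exists_observation (hB : IsAdmissible S B) (h : IsMild S k z) {T : ℝ} (hT : 0 < T) :
    ∃ v : ℝ → U, IsObservation S B T z v ∧ ∀ (W : U →L[ℝ] U) (a b : ℝ), 0 ≤ a → a ≤ b → b ≤ T →
      Tendsto (fun n => ∫ s in a..b,
          ⟪W (ctrlAdj S B (S.smooth n (z s))), ctrlAdj S B (S.smooth n (z s))⟫_ℝ) atTop
        (𝓝 (∫ s in a..b, ⟪W (v s), v s⟫_ℝ)) := by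
  obtain ⟨M, hM0, hM⟩ := hB.exists_observation_bound hT
  obtain ⟨C, _, hC⟩ := S.exists_norm_incl_smooth_le
  have hc : Continuous fun s => S.dual.op (-s) (k s) :=
    S.dual.continuous_op_apply continuous_neg h.continuous_source
  obtain ⟨V, hV⟩ := exists_tendsto_observation S.dual hT hM0
    (fun n => (ctrlAdjL S B).comp (S.smooth n)) (fun n => S.inclL.comp (S.smooth n))
    (fun n m y => by
      have h1 := hM (S.smooth n y - S.smooth m y)
      have h2 : ∀ t, S.adjOp (-t) (S.smooth n y - S.smooth m y)
          = S.smooth n (S.dual.op t y) - S.smooth m (S.dual.op t y) := fun t => by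
        rw [S.adjOp_sub, C0Group.smooth, C0Group.smooth, S.adjOp_smoothing, S.adjOp_smoothing,
          neg_neg]
      simp only [h2] at h1
      simp only [← ctrlAdjL_apply, map_sub] at h1
      exact h1)
    S.tendsto_incl_smooth hC hc h.continuous h.eq_op
  refine ⟨V, ⟨Lp.memLp V, fun a b ha hab hb => ?_⟩, fun W a b ha hab hb =>
    tendsto_integral_inner_comp ha hab hb
      (fun n => memLp_two_of_continuous (((ctrlAdjL S B).comp (S.smooth n)).continuous.comp
        h.continuous) T) hV W⟩
  obtain ⟨φ, hφ, _⟩ := h.exists_integral_mem a b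
  refine ⟨φ, hφ, ext_inner_left ℝ fun u => ?_⟩
  refine tendsto_nhds_unique ?_ (tendsto_inner_intervalIntegral ha hab hb
      (fun n => memLp_two_of_continuous (((ctrlAdjL S B).comp (S.smooth n)).continuous.comp
        h.continuous) T) hV u)
  have h1 : Tendsto (fun n => ctrlAdjL S B (S.smooth n (S.incl φ))) atTop (𝓝 (ctrlAdjL S B φ)) :=
    ((ctrlAdjL S B).continuous.tendsto _).comp (S.tendsto_smooth_incl φ)
  refine ((tendsto_const_nhds (x := u)).inner (𝕜 := ℝ) h1).congr fun n => ?_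
  congr 1
  rw [hφ]
  exact (((ctrlAdjL S B).comp (S.smooth n)).intervalIntegral_comp_comm
    (h.continuous.intervalIntegrable _ _)).symm

end IsMild

/-- The observation of a trajectory is unique up to null sets. -/
theorem IsObservation.ae_eq {S : C0Group H} {B : U →L[ℝ] StrongDual ℝ S.adjDomain} {T : ℝ}
    {z : ℝ → H} {v w : ℝ → U} (hT : 0 ≤ T) (hv : IsObservation S B T z v)
    (hw : IsObservation S B T z w) : ∀ᵐ s, s ∈ Ioo 0 T → v s = w s := by
  have h0 : (0 : ℝ) ∈ Icc 0 T := ⟨le_rfl, hT⟩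
  have hTT : T ∈ Icc 0 T := ⟨hT, le_rfl⟩
  have hvi : IntervalIntegrable v volume 0 T :=
    intervalIntegrable_of_integrableOn_Ioo (hv.1.integrable (by norm_num)) h0 hTT
  have hwi : IntervalIntegrable w volume 0 T :=
    intervalIntegrable_of_integrableOn_Ioo (hw.1.integrable (by norm_num)) h0 hTT
  have heq : ∀ t ∈ Icc 0 T, ∫ s in (0 : ℝ)..t, v s = ∫ s in (0 : ℝ)..t, w s := by
    intro t ht
    obtain ⟨φ, hφ, hφv⟩ := hv.2 0 t le_rfl ht.1 ht.2
    obtain ⟨ψ, hψ, hψw⟩ := hw.2 0 t le_rfl ht.1 ht.2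
    rw [← hφv, ← hψw, S.adjDomain_ext (hφ.trans hψ.symm)]
  filter_upwards [hvi.ae_hasDerivAt_integral, hwi.ae_hasDerivAt_integral] with s hs1 hs2 hs
  have hs' : s ∈ uIcc 0 T := by
    rw [uIcc_of_le hT]
    exact Ioo_subset_Icc_self hs
  refine (hs1 hs' 0 left_mem_uIcc).unique ((hs2 hs' 0 left_mem_uIcc).congr_of_eventuallyEq ?_)
  filter_upwards [Ioo_mem_nhds hs.1 hs.2] with t ht
  exact heq t (Ioo_subset_Icc_self ht)

end Mild

end StaticFeedback

namespace StaticFeedback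

variable {H : Type*} [NormedAddCommGroup H] [InnerProductSpace ℝ H] [CompleteSpace H]

/-! ### Existence and uniqueness of mild solutions -/

/-- In the moving frame p(t) = S(t)* z(t) the generator disappears, leaving an ordinary differential
equation whose field is Lipschitz with a constant that is uniform on bounded time intervals. -/
theorem exists_isMild (S : C0Group H) {h : H → H} (h0 : h 0 = 0) {K : ℝ} (hK : 0 ≤ K)
    (hl : ∀ x y, ‖h x - h y‖ ≤ K * ‖x - y‖) (z₀ : H) :
    ∃ z : ℝ → H, z 0 = z₀ ∧ IsMild S (fun t => h (z t)) z := by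
  have hc : Continuous h := by
    refine (LipschitzWith.of_dist_le_mul (K := ⟨K, hK⟩) fun x y => ?_).continuous
    rw [dist_eq_norm, dist_eq_norm]
    exact hl x y
  obtain ⟨p, hp0, hp⟩ := exists_global_ode_solution
    (F := fun t x => S.dual.op (-t) (h (S.dual.op t x)))
    (fun x => S.dual.continuous_op_apply continuous_neg (hc.comp (S.dual.continuous_orbit x)))
    (fun t => by simp only [map_zero, h0])
    (fun T hT => by
      obtain ⟨C, hC0, hC⟩ := S.dual.exists_norm_op_le T
      refine ⟨C * (K * C), by positivity, fun t ht x y => ?_⟩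
      rw [← map_sub]
      have hnt : -t ∈ Icc (-T) T := ⟨by linarith [ht.2], by linarith [ht.1]⟩
      calc _ ≤ C * ‖h (S.dual.op t x) - h (S.dual.op t y)‖ :=
            ContinuousLinearMap.le_of_opNorm_le _ (hC _ hnt) _
        _ ≤ C * (K * (C * ‖x - y‖)) := by
            gcongr
            refine (hl _ _).trans ?_
            gcongr
            rw [← map_sub]
            exact ContinuousLinearMap.le_of_opNorm_le _ (hC _ ht) _
        _ = _ := by ring) z₀
  have hpc : Continuous p := continuous_iff_continuousAt.2 fun t => (hp t).continuousAt
  have hzc : Continuous fun t => S.dual.op t (p t) := S.dual.continuous_op_apply continuous_id hpc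
  refine ⟨fun t => S.dual.op t (p t), by simp [S.dual.op_zero, hp0], hc.comp hzc, hzc, fun t => ?_⟩
  simpa only [S.dual.op_neg_op] using hp t

theorem hasDerivAt_inner_orbit_of_weak (G : C0Group H) {T : ℝ} {e k : ℝ → H}
    (he : ContinuousOn e (Icc 0 T)) (hk : ContinuousOn k (Icc 0 T))
    (hw : ∀ ψ : G.generator.domain, ∀ t ∈ Icc 0 T, ⟪e t, (ψ : H)⟫_ℝ
      = ⟪e 0, (ψ : H)⟫_ℝ + ∫ s in (0 : ℝ)..t, (-⟪e s, G.generator ψ⟫_ℝ + ⟪k s, (ψ : H)⟫_ℝ))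
    (ψ : G.generator.domain) {t : ℝ} (ht : t ∈ Ioo 0 T) :
    HasDerivAt (fun t => ⟪e t, G.op t ψ⟫_ℝ) ⟪k t, G.op t ψ⟫_ℝ t := by
  -- The weak equation is used with the test vector frozen at time t; the motion of the test vector
  -- contributes ⟨e, Aχ⟩, which cancels the generator term.
  set χ : G.generator.domain := ⟨G.op t ψ, G.op_mem_domain t ψ⟩ with hχ
  have hnhds : Icc 0 T ∈ 𝓝 t := Icc_mem_nhds ht.1 ht.2
  have hgc : ContinuousOn (fun s => -⟪e s, G.generator χ⟫_ℝ + ⟪k s, (χ : H)⟫_ℝ) (Icc 0 T) :=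
    (he.inner continuousOn_const).neg.add (hk.inner continuousOn_const)
  have h1 : HasDerivAt (fun s => ⟪e s, (χ : H)⟫_ℝ)
      (-⟪e t, G.generator χ⟫_ℝ + ⟪k t, (χ : H)⟫_ℝ) t := by
    have h2 : HasDerivAt (fun r => ∫ s in (0 : ℝ)..r, (-⟪e s, G.generator χ⟫_ℝ + ⟪k s, (χ : H)⟫_ℝ))
        (-⟪e t, G.generator χ⟫_ℝ + ⟪k t, (χ : H)⟫_ℝ) t := by
      refine intervalIntegral.integral_hasDerivAt_right ?_ ?_ (hgc.continuousAt hnhds)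
      · refine (hgc.mono ?_).intervalIntegrable
        rw [uIcc_of_le ht.1.le]
        exact Icc_subset_Icc_right ht.2.le
      · exact (hgc.mono Ioo_subset_Icc_self).stronglyMeasurableAtFilter isOpen_Ioo _ ht
    refine (h2.const_add ⟪e 0, (χ : H)⟫_ℝ).congr_of_eventuallyEq ?_
    filter_upwards [hnhds] with s hs
    exact hw χ s hs
  rw [hasDerivAt_iff_tendsto_slope_zero] at h1 ⊢
  have h3 := hasDerivAt_iff_tendsto_slope_zero.1 (G.hasDerivAt_orbit ψ t)
  have h4 : Tendsto (fun s => e (t + s)) (𝓝[≠] 0) (𝓝 (e t)) := by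
    have h5 : Tendsto (fun s => t + s) (𝓝[≠] 0) (𝓝 t) := by
      have : Continuous fun s : ℝ => t + s := by fun_prop
      simpa using (this.tendsto 0).mono_left nhdsWithin_le_nhds
    exact (he.continuousAt hnhds).tendsto.comp h5
  have h6 := h1.add (h4.inner (𝕜 := ℝ) h3)
  have h7 : -⟪e t, G.generator χ⟫_ℝ + ⟪k t, (χ : H)⟫_ℝ + ⟪e t, G.op t (G.generator ψ)⟫_ℝ
      = ⟪k t, G.op t ψ⟫_ℝ := by
    rw [hχ, G.generator_op]
    ring
  rw [h7] at h6
  refine h6.congr fun s => ?_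
  simp only [hχ, inner_smul_right, inner_sub_right, smul_eq_mul]
  ring

/-- Weak solutions are mild solutions. -/
theorem hasDerivWithinAt_of_weak (G : C0Group H) {T : ℝ} {e k : ℝ → H}
    (he : ContinuousOn e (Icc 0 T)) (hk : ContinuousOn k (Icc 0 T))
    (hw : ∀ ψ : G.generator.domain, ∀ t ∈ Icc 0 T, ⟪e t, (ψ : H)⟫_ℝ
      = ⟪e 0, (ψ : H)⟫_ℝ + ∫ s in (0 : ℝ)..t, (-⟪e s, G.generator ψ⟫_ℝ + ⟪k s, (ψ : H)⟫_ℝ))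
    {t : ℝ} (ht : t ∈ Ico 0 T) :
    HasDerivWithinAt (fun t => G.dual.op (-t) (e t)) (G.dual.op (-t) (k t)) (Ici t) t := by
  have hT : 0 ≤ T := ht.1.trans ht.2.le
  -- Clamping time to [0, T] extends the source continuously to the line, so the fundamental theorem
  -- of calculus also applies at the left endpoint.
  set c : ℝ → ℝ := fun s => max 0 (min s T) with hc
  have hcc : Continuous c := by fun_prop
  have hcm : ∀ s, c s ∈ Icc 0 T := fun s => ⟨le_max_left _ _, max_le hT (min_le_right _ _)⟩
  have hceq : ∀ s ∈ Icc 0 T, c s = s := fun s hs => by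
    simp only [hc]
    rw [min_eq_left hs.2, max_eq_right hs.1]
  set q : ℝ → H := fun s => G.dual.op (-(c s)) (k (c s)) with hq
  have hqc : Continuous q :=
    G.dual.continuous_op_apply hcc.neg (hk.comp_continuous hcc hcm)
  have hqi : ∀ a b, IntervalIntegrable q volume a b := fun a b => hqc.intervalIntegrable a b
  have hinner : ∀ (x : H) (s : ℝ) (ψ : H), ⟪G.dual.op (-s) x, ψ⟫_ℝ = ⟪x, G.op s ψ⟫_ℝ := by
    intro x s ψ
    rw [G.inner_dual_op, neg_neg]
  have key : ∀ s ∈ Icc 0 T, G.dual.op (-s) (e s) = e 0 + ∫ r in (0 : ℝ)..s, q r := by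
    intro s hs
    refine G.dense_domain.eq_of_inner_left ℝ fun ψ hψ => ?_
    have hsub : Icc 0 s ⊆ Icc 0 T := Icc_subset_Icc_right hs.2
    have hqi' : IntervalIntegrable (fun r => ⟪q r, ψ⟫_ℝ) volume 0 s :=
      (hqc.inner continuous_const).intervalIntegrable _ _
    have h1 := intervalIntegral.integral_eq_sub_of_hasDeriv_right_of_le hs.1
      (f := fun r => ⟪e r, G.op r ψ⟫_ℝ) (f' := fun r => ⟪q r, ψ⟫_ℝ)
      ((he.mono hsub).inner (G.continuous_orbit ψ).continuousOn)
      (fun r hr => by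
        have hr' : r ∈ Ioo 0 T := ⟨hr.1, hr.2.trans_le hs.2⟩
        have h2 := hasDerivAt_inner_orbit_of_weak G he hk hw ⟨ψ, hψ⟩ hr'
        have h3 : ⟪q r, ψ⟫_ℝ = ⟪k r, G.op r ψ⟫_ℝ := by
          simp only [hq, hceq r (Ioo_subset_Icc_self hr')]
          exact hinner _ _ _
        rw [h3]
        exact h2.hasDerivWithinAt) hqi'
    rw [inner_add_left, intervalIntegral_inner_left (hqi _ _), h1, hinner, G.op_zero,
      ContinuousLinearMap.id_apply]
    ring
  have h1 : HasDerivAt (fun s => e 0 + ∫ r in (0 : ℝ)..s, q r) (q t) t :=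
    (intervalIntegral.integral_hasDerivAt_right (hqi 0 t) (hqc.stronglyMeasurableAtFilter _ _)
      hqc.continuousAt).const_add (e 0)
  have h2 : q t = G.dual.op (-t) (k t) := by
    simp only [hq, hceq t (Ico_subset_Icc_self ht)]
  rw [← h2]
  refine h1.hasDerivWithinAt.congr_of_eventuallyEq ?_ (key t (Ico_subset_Icc_self ht))
  filter_upwards [Icc_mem_nhdsGE ht.2] with s hs
  exact key s ⟨ht.1.trans hs.1, hs.2⟩

/-- The zero set of q is closed in [0, T] and open to the right: after a zero, continuity keeps ‖q‖
< ρ for a while, and Grönwall in the moving frame keeps q at zero. Hence no smallness of q has to be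
assumed in advance. -/
theorem eq_zero_of_norm_source_le (G : C0Group H) {T ρ L : ℝ} (hρ : 0 < ρ) (hL : 0 ≤ L)
    {q k : ℝ → H} (hq : ContinuousOn q (Icc 0 T)) (hq0 : q 0 = 0)
    (hd : ∀ t ∈ Ico 0 T,
      HasDerivWithinAt (fun t => G.op (-t) (q t)) (G.op (-t) (k t)) (Ici t) t)
    (hk : ∀ t ∈ Icc 0 T, ‖q t‖ < ρ → ‖k t‖ ≤ L * ‖q t‖) : ∀ t ∈ Icc 0 T, q t = 0 := by
  obtain ⟨C, hC0, hC⟩ := G.exists_norm_op_le T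
  refine IsClosed.Icc_subset_of_forall_mem_nhdsWithin (s := {t | q t = 0}) ?_ hq0 ?_
  · rw [inter_comm]
    exact hq.preimage_isClosed_of_isClosed isClosed_Icc isClosed_singleton
  · rintro x ⟨hx0, hx⟩
    have hx0' : q x = 0 := hx0
    have h1 : ∀ᶠ t in 𝓝[≥] x, ‖q t‖ < ρ := by
      have h2 : ContinuousWithinAt q (Ici x) x :=
        (hq x (Ico_subset_Icc_self hx)).mono_of_mem_nhdsWithin
          (mem_of_superset (Icc_mem_nhdsGE hx.2) (Icc_subset_Icc_left hx.1))
      refine h2.norm.eventually (gt_mem_nhds ?_)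
      simpa [hx0'] using hρ
    have h2 : ∀ᶠ t in 𝓝[≥] x, t ≤ T := by
      filter_upwards [Icc_mem_nhdsGE hx.2] with t ht using ht.2
    obtain ⟨y, hxy, hy⟩ := mem_nhdsGE_iff_exists_Icc_subset.1 (h1.and h2)
    have hyT : y ≤ T := (hy (right_mem_Icc.2 (le_of_lt hxy))).2
    have hsub : Icc x y ⊆ Icc 0 T := Icc_subset_Icc hx.1 hyT
    have hzero := eq_zero_of_abs_deriv_le_mul_abs_self_of_eq_zero_right
      (f := fun t => G.op (-t) (q t)) (f' := fun t => G.op (-t) (k t)) (K := C * (L * C))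
      (G.continuousOn_op_apply continuous_neg.continuousOn (hq.mono hsub))
      (fun t ht => hd t ⟨hx.1.trans ht.1, ht.2.trans_le hyT⟩)
      (by simp only [hx0', map_zero])
      (fun t ht => by
        have ht' := hsub (Ico_subset_Icc_self ht)
        have hT1 : t ∈ Icc (-T) T := ⟨by linarith [ht'.1, ht'.2], ht'.2⟩
        have hT2 : -t ∈ Icc (-T) T := ⟨by linarith [ht'.2], by linarith [ht'.1, ht'.2]⟩
        calc ‖G.op (-t) (k t)‖ ≤ C * ‖k t‖ := ContinuousLinearMap.le_of_opNorm_le _ (hC _ hT2) _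
          _ ≤ C * (L * ‖q t‖) := by
              gcongr
              exact hk t ht' (hy (Ico_subset_Icc_self ht)).1
          _ ≤ C * (L * (C * ‖G.op (-t) (q t)‖)) := by
              gcongr
              nth_rewrite 1 [← G.op_op_neg t (q t)]
              exact ContinuousLinearMap.le_of_opNorm_le _ (hC _ hT1) _
          _ = _ := by ring)
    have h3 : Icc x y ∈ 𝓝[>] x :=
      mem_of_superset (Ioc_mem_nhdsGT hxy) Ioc_subset_Icc_self
    filter_upwards [h3] with t ht
    have h4 := hzero t ht
    change q t = 0
    rw [← G.op_op_neg t (q t), h4, map_zero]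

/-! ### The energy identity -/

variable {U : Type*} [NormedAddCommGroup U] [InnerProductSpace ℝ U] [CompleteSpace U]
variable {S : C0Group H} {B : U →L[ℝ] StrongDual ℝ S.adjDomain} {k z : ℝ → H}

/-- Both the smoothing and A* after smoothing are bounded on H, so the regularised trajectory is a
classical solution. The formula comes from applying the commutation relation to ∫z ∈ D(A*). -/
theorem IsMild.hasDerivAt_smooth (h : IsMild S k z) (n : ℕ) (t : ℝ) :
    HasDerivAt (fun t => S.incl (S.smooth n (z t)))
      (-S.adjGen (S.smooth n (z t)) + S.incl (S.smooth n (k t))) t := by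
  obtain ⟨j, hj⟩ : ∃ j : H →L[ℝ] H, ∀ x, S.incl (S.smooth n x) = j x :=
    ⟨S.inclL.comp (S.smooth n), fun x => rfl⟩
  obtain ⟨l, hl⟩ : ∃ l : H →L[ℝ] H, ∀ x, S.adjGen (S.smooth n x) = l x :=
    ⟨S.adjGenL.comp (S.smooth n), fun x => rfl⟩
  have hcomm : ∀ φ : S.adjDomain, l (S.incl φ) = j (S.adjGen φ) := fun φ => by
    rw [← hj, ← hl]
    exact S.adjGen_smoothing_incl _ φ
  simp only [hj, hl]
  have hc : Continuous fun s => -l (z s) + j (k s) :=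
    (l.continuous.comp h.continuous).neg.add (j.continuous.comp h.continuous_source)
  have h1 : ∀ t, j (z t) = j (z 0) + ∫ s in (0 : ℝ)..t, (-l (z s) + j (k s)) := by
    intro t
    obtain ⟨φ, hφ, hφ'⟩ := h.exists_integral_mem 0 t
    have h2 := hcomm φ
    have i1 : IntervalIntegrable (fun s => -l (z s)) volume 0 t :=
      (l.continuous.comp h.continuous).neg.intervalIntegrable _ _
    have i2 : IntervalIntegrable (fun s => j (k s)) volume 0 t :=
      (j.continuous.comp h.continuous_source).intervalIntegrable _ _
    rw [hφ, hφ', map_add, map_sub, ← l.intervalIntegral_comp_comm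
      (h.continuous.intervalIntegrable _ _), ← j.intervalIntegral_comp_comm
      (h.continuous_source.intervalIntegrable _ _)] at h2
    rw [intervalIntegral.integral_add i1 i2, intervalIntegral.integral_neg, h2]
    abel
  have h2 : HasDerivAt (fun t => j (z 0) + ∫ s in (0 : ℝ)..t, (-l (z s) + j (k s)))
      (-l (z t) + j (k t)) t :=
    (intervalIntegral.integral_hasDerivAt_right (hc.intervalIntegrable _ _)
      (hc.stronglyMeasurableAtFilter _ _) hc.continuousAt).const_add _
  exact h2.congr_of_eventuallyEq (Eventually.of_forall h1)

/-- For w the smoothed trajectory, the derivative of ⟨Qw, w⟩ contains -2⟨Qw, A*w⟩, and the identity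
at φ = ψ = w rewrites it. The R and λ terms have positive sign here because k is still arbitrary. -/
theorem IsMild.smooth_energy (h : IsMild S k z) {Q R : H →L[ℝ] H} {W : U →L[ℝ] U} {lam : ℝ}
    (hQ : ∀ x y, ⟪Q x, y⟫_ℝ = ⟪x, Q y⟫_ℝ) (hid : OperatorIdentity S B Q R W lam) (n : ℕ)
    (j : H →L[ℝ] H) (hj : ∀ x, S.incl (S.smooth n x) = j x) (a b : ℝ) :
    ⟪Q (j (z b)), j (z b)⟫_ℝ - ⟪Q (j (z a)), j (z a)⟫_ℝ
      = -(∫ s in a..b, ⟪W (ctrlAdj S B (S.smooth n (z s))), ctrlAdj S B (S.smooth n (z s))⟫_ℝ)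
        + ∫ s in a..b, (⟪R (Q (j (z s))), Q (j (z s))⟫_ℝ + 2 * lam * ⟪Q (j (z s)), j (z s)⟫_ℝ
          + 2 * ⟪Q (j (z s)), j (k s)⟫_ℝ) := by
  have hzj : Continuous fun s => j (z s) := j.continuous.comp h.continuous
  have hkj : Continuous fun s => j (k s) := j.continuous.comp h.continuous_source
  have hQj : Continuous fun s => Q (j (z s)) := Q.continuous.comp hzj
  have hv : Continuous fun s => ctrlAdj S B (S.smooth n (z s)) :=
    ((ctrlAdjL S B).comp (S.smooth n)).continuous.comp h.continuous
  have hWv : Continuous fun s =>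
      ⟪W (ctrlAdj S B (S.smooth n (z s))), ctrlAdj S B (S.smooth n (z s))⟫_ℝ :=
    (W.continuous.comp hv).inner hv
  have hrest : Continuous fun s => ⟪R (Q (j (z s))), Q (j (z s))⟫_ℝ
      + 2 * lam * ⟪Q (j (z s)), j (z s)⟫_ℝ + 2 * ⟪Q (j (z s)), j (k s)⟫_ℝ :=
    (((R.continuous.comp hQj).inner hQj).add (continuous_const.mul (hQj.inner hzj))).add
      (continuous_const.mul (hQj.inner hkj))
  have i1 : IntervalIntegrable (fun s => -⟪W (ctrlAdj S B (S.smooth n (z s))),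
      ctrlAdj S B (S.smooth n (z s))⟫_ℝ) volume a b := hWv.neg.intervalIntegrable _ _
  have hd : ∀ t, HasDerivAt (fun t => ⟪Q (j (z t)), j (z t)⟫_ℝ)
      (-⟪W (ctrlAdj S B (S.smooth n (z t))), ctrlAdj S B (S.smooth n (z t))⟫_ℝ
        + (⟪R (Q (j (z t))), Q (j (z t))⟫_ℝ + 2 * lam * ⟪Q (j (z t)), j (z t)⟫_ℝ
          + 2 * ⟪Q (j (z t)), j (k t)⟫_ℝ)) t := by
    intro t
    have h1 := h.hasDerivAt_smooth n t
    simp only [hj] at h1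
    have h2 := (Q.hasFDerivAt.comp_hasDerivAt t h1).inner ℝ h1
    have h3 := hid (S.smooth n (z t)) (S.smooth n (z t))
    simp only [hj] at h3
    refine h2.congr_deriv ?_
    simp only [Function.comp_apply]
    rw [hQ (-S.adjGen (S.smooth n (z t)) + j (k t)), real_inner_comm (Q (j (z t)))
      (-S.adjGen (S.smooth n (z t)) + j (k t)), inner_add_right, inner_neg_right]
    rw [real_inner_comm (Q (j (z t))) (S.adjGen (S.smooth n (z t)))] at h3
    linarith
  rw [← intervalIntegral.integral_neg, ← intervalIntegral.integral_add i1
    (hrest.intervalIntegrable _ _)]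
  exact (intervalIntegral.integral_eq_sub_of_hasDerivAt (fun t _ => hd t)
    ((hWv.neg.add hrest).intervalIntegrable _ _)).symm

/-- Limit of `IsMild.smooth_energy`: the W term converges by `IsMild.exists_observation`, the others
by dominated convergence with the uniform bound on the smoothing. Uniqueness of observations permits
any v. -/
theorem IsMild.energy (h : IsMild S k z) (hB : IsAdmissible S B) {Q R : H →L[ℝ] H} {W : U →L[ℝ] U}
    {lam : ℝ} (hQ : ∀ x y, ⟪Q x, y⟫_ℝ = ⟪x, Q y⟫_ℝ) (hid : OperatorIdentity S B Q R W lam)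
    {T : ℝ} (hT : 0 < T) {v : ℝ → U} (hv : IsObservation S B T z v) {a b : ℝ} (ha : 0 ≤ a)
    (hab : a ≤ b) (hb : b ≤ T) :
    ⟪Q (z b), z b⟫_ℝ - ⟪Q (z a), z a⟫_ℝ = -(∫ s in a..b, ⟪W (v s), v s⟫_ℝ)
      + ∫ s in a..b, (⟪R (Q (z s)), Q (z s)⟫_ℝ + 2 * lam * ⟪Q (z s), z s⟫_ℝ
        + 2 * ⟪Q (z s), k s⟫_ℝ) := by
  obtain ⟨w, hw, hlim⟩ := h.exists_observation hB hT
  have hvw : ∫ s in a..b, ⟪W (v s), v s⟫_ℝ = ∫ s in a..b, ⟪W (w s), w s⟫_ℝ := by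
    rw [intervalIntegral.integral_of_le hab, intervalIntegral.integral_of_le hab,
      integral_Ioc_eq_integral_Ioo, integral_Ioc_eq_integral_Ioo]
    refine setIntegral_congr_ae measurableSet_Ioo ?_
    filter_upwards [hv.ae_eq hT.le hw] with s hs hs'
    rw [hs (Ioo_subset_Ioo ha hb hs')]
  obtain ⟨C, hC0, hC⟩ := S.exists_norm_incl_smooth_le
  have hex : ∀ n, ∃ j : H →L[ℝ] H, ∀ x, S.incl (S.smooth n x) = j x := fun n =>
    ⟨S.inclL.comp (S.smooth n), fun x => rfl⟩
  choose j hj using hex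
  have hjl : ∀ x, Tendsto (fun n => j n x) atTop (𝓝 x) := fun x => by
    simpa only [hj] using S.tendsto_incl_smooth x
  have hjC : ∀ n x, ‖j n x‖ ≤ C * ‖x‖ := fun n x => by
    rw [← hj]
    exact hC n x
  have hEl : ∀ t, Tendsto (fun n => ⟪Q (j n (z t)), j n (z t)⟫_ℝ) atTop (𝓝 ⟪Q (z t), z t⟫_ℝ) :=
    fun t => ((Q.continuous.tendsto _).comp (hjl (z t))).inner (hjl (z t))
  rw [hvw]
  refine tendsto_nhds_unique ((hEl b).sub (hEl a)) ?_
  refine Tendsto.congr (fun n => (h.smooth_energy hQ hid n (j n) (hj n) a b).symm) ?_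
  refine ((hlim W a b ha hab hb).neg).add ?_
  refine intervalIntegral.tendsto_integral_filter_of_dominated_convergence
    (fun s => ‖R‖ * (‖Q‖ * (C * ‖z s‖)) * (‖Q‖ * (C * ‖z s‖))
      + |2 * lam| * ((‖Q‖ * (C * ‖z s‖)) * (C * ‖z s‖))
      + 2 * ((‖Q‖ * (C * ‖z s‖)) * (C * ‖k s‖))) (Eventually.of_forall fun n => ?_)
    (Eventually.of_forall fun n => Eventually.of_forall fun s _ => ?_) ?_
    (Eventually.of_forall fun s _ => ?_)
  · have hzj : Continuous fun s => j n (z s) := (j n).continuous.comp h.continuous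
    have hkj : Continuous fun s => j n (k s) := (j n).continuous.comp h.continuous_source
    have hQj : Continuous fun s => Q (j n (z s)) := Q.continuous.comp hzj
    exact ((((R.continuous.comp hQj).inner hQj).add (continuous_const.mul (hQj.inner hzj))).add
      (continuous_const.mul (hQj.inner hkj))).aestronglyMeasurable
  · have hq : ‖Q (j n (z s))‖ ≤ ‖Q‖ * (C * ‖z s‖) :=
      (Q.le_opNorm _).trans (by gcongr; exact hjC n _)
    have hr : ‖R (Q (j n (z s)))‖ ≤ ‖R‖ * (‖Q‖ * (C * ‖z s‖)) :=
      (R.le_opNorm _).trans (by gcongr)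
    refine (norm_add₃_le).trans ?_
    gcongr
    · exact (norm_inner_le_norm _ _).trans (by gcongr)
    · rw [norm_mul, Real.norm_eq_abs]
      gcongr
      exact (norm_inner_le_norm _ _).trans (by gcongr; exact hjC n _)
    · rw [norm_mul, Real.norm_of_nonneg zero_le_two]
      gcongr
      exact (norm_inner_le_norm _ _).trans (by gcongr; exact hjC n _)
  · have hz := h.continuous
    have hk := h.continuous_source
    refine Continuous.intervalIntegrable ?_ _ _
    fun_prop
  · have hq : Tendsto (fun n => Q (j n (z s))) atTop (𝓝 (Q (z s))) :=
      (Q.continuous.tendsto _).comp (hjl (z s))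
    have hr : Tendsto (fun n => R (Q (j n (z s)))) atTop (𝓝 (R (Q (z s)))) :=
      (R.continuous.tendsto _).comp hq
    exact ((hr.inner hq).add ((hq.inner (hjl (z s))).const_mul _)).add
      ((hq.inner (hjl (k s))).const_mul _)

end StaticFeedback

namespace StaticFeedback

variable {H : Type*} [NormedAddCommGroup H] [InnerProductSpace ℝ H] [CompleteSpace H]
variable {U : Type*} [NormedAddCommGroup U] [InnerProductSpace ℝ U] [CompleteSpace U]
variable {S : C0Group H} {B : U →L[ℝ] StrongDual ℝ S.adjDomain}
variable {Q : H ≃L[ℝ] H} {R : H →L[ℝ] H} {W : U →L[ℝ] U} {lam : ℝ}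

/-! ### The closed-loop system -/

/-- The source term `-2 λ z - R Q z + Q⁻¹ g` of the adjoint equation. -/
noncomputable def loopSource (Q : H ≃L[ℝ] H) (R : H →L[ℝ] H) (lam : ℝ) (g z : H) : H :=
  -((2 * lam) • z) - R (Q z) + Q.symm g

theorem inner_symm_right (hQ : IsPosSymm (Q : H →L[ℝ] H)) (x y : H) :
    ⟪Q x, Q.symm y⟫_ℝ = ⟪x, y⟫_ℝ := by
  have := hQ.1 x (Q.symm y)
  simpa using this

theorem IsPosSymm.isNonnegSymm_symm (hQ : IsPosSymm (Q : H →L[ℝ] H)) :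
    IsNonnegSymm (Q.symm : H →L[ℝ] H) := by
  obtain ⟨h1, c, hc, h2⟩ := hQ
  refine ⟨fun x y => ?_, fun x => ?_⟩
  · have := h1 (Q.symm x) (Q.symm y)
    simpa using this.symm
  · have := h2 (Q.symm x)
    simp only [ContinuousLinearEquiv.coe_coe, ContinuousLinearEquiv.apply_symm_apply] at this ⊢
    rw [real_inner_comm]
    exact le_trans (by positivity) this

theorem norm_opSqrt_symm_sq (hQ : IsPosSymm (Q : H →L[ℝ] H)) (z : H) :
    ‖opSqrt (Q.symm : H →L[ℝ] H) (Q z)‖ ^ 2 = ⟪Q z, z⟫_ℝ := by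
  rw [norm_opSqrt_sq hQ.isNonnegSymm_symm, real_inner_comm]
  simp

theorem norm_loopSource_sub_le (Q : H ≃L[ℝ] H) (R : H →L[ℝ] H) (lam : ℝ) {g g' z z' : H} {L : ℝ}
    (hg : ‖g - g'‖ ≤ L * ‖Q z - Q z'‖) (hL : 0 ≤ L) :
    ‖loopSource Q R lam g z - loopSource Q R lam g' z'‖
      ≤ (|2 * lam| + ‖R‖ * ‖(Q : H →L[ℝ] H)‖
          + ‖(Q.symm : H →L[ℝ] H)‖ * (L * ‖(Q : H →L[ℝ] H)‖)) * ‖z - z'‖ := by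
  have hQz : ‖Q z - Q z'‖ ≤ ‖(Q : H →L[ℝ] H)‖ * ‖z - z'‖ := by
    rw [← map_sub]
    exact (Q : H →L[ℝ] H).le_opNorm _
  have h1 : loopSource Q R lam g z - loopSource Q R lam g' z'
      = -((2 * lam) • (z - z')) + -(R (Q z - Q z')) + Q.symm (g - g') := by
    simp only [loopSource, map_sub, smul_sub]
    abel
  rw [h1]
  refine (norm_add₃_le).trans ?_
  rw [norm_neg, norm_neg, norm_smul, Real.norm_eq_abs, add_mul, add_mul]
  have h2 : ‖R (Q z - Q z')‖ ≤ ‖R‖ * ‖(Q : H →L[ℝ] H)‖ * ‖z - z'‖ := by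
    rw [mul_assoc]
    exact (R.le_opNorm _).trans (by gcongr)
  have h3 : ‖Q.symm (g - g')‖
      ≤ ‖(Q.symm : H →L[ℝ] H)‖ * (L * ‖(Q : H →L[ℝ] H)‖) * ‖z - z'‖ := by
    rw [mul_assoc, mul_assoc]
    refine ((Q.symm : H →L[ℝ] H).le_opNorm _).trans ?_
    gcongr
    exact hg.trans (by gcongr)
  linarith

section ClosedLoop

variable {g z : ℝ → H}

theorem IsObservation.intervalIntegrable {T : ℝ} {v : ℝ → U}
    (hv : IsObservation S B T z v) {a b : ℝ} (ha : a ∈ Icc 0 T) (hb : b ∈ Icc 0 T) :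
    IntervalIntegrable v volume a b :=
  intervalIntegrable_of_integrableOn_Ioo (hv.1.integrable (by norm_num)) ha hb

theorem IsObservation.integrableOn_inner {T : ℝ} {v : ℝ → U}
    (hv : IsObservation S B T z v) (W : U →L[ℝ] U) (u : U) :
    IntegrableOn (fun s => ⟪W (v s), u⟫_ℝ) (Ioo 0 T) := by
  have h1 : Integrable v (volume.restrict (Ioo 0 T)) := hv.1.integrable (by norm_num)
  exact (W.integrable_comp h1).inner_const u

/-- `y = Q z` solves the controlled equation. -/
theorem IsMild.inner_eq_integral (hm : IsMild S (fun s => loopSource Q R lam (g s) (z s)) z)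
    (hg : Continuous g) (hQ : IsPosSymm (Q : H →L[ℝ] H))
    (hid : OperatorIdentity S B (Q : H →L[ℝ] H) R W lam) {T : ℝ} {v : ℝ → U}
    (hv : IsObservation S B T z v) (φ : S.adjDomain) {t : ℝ} (ht : t ∈ Icc 0 T) :
    ⟪Q (z t), S.incl φ⟫_ℝ = ⟪Q (z 0), S.incl φ⟫_ℝ + ∫ s in (0 : ℝ)..t,
      (⟪Q (z s), S.adjGen φ⟫_ℝ + ⟪g s, S.incl φ⟫_ℝ - ⟪W (v s), ctrlAdj S B φ⟫_ℝ) := by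
  obtain ⟨Z, hZ, hZv⟩ := hv.2 0 t le_rfl ht.1 ht.2
  obtain ⟨Z', hZ', hZA⟩ := hm.exists_integral_mem 0 t
  -- The same antiderivative occurs twice: its B* value comes from the observation, its A* value
  -- from the equation.
  obtain rfl : Z' = Z := S.adjDomain_ext (hZ'.trans hZ.symm)
  have hz := hm.continuous
  have hT0 : 0 ≤ T := ht.1.trans ht.2
  have hvi := hv.intervalIntegrable ⟨le_rfl, hT0⟩ ht
  have hzi : IntervalIntegrable z volume 0 t := hz.intervalIntegrable _ _
  have hgi : IntervalIntegrable g volume 0 t := hg.intervalIntegrable _ _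
  have h1 : IntervalIntegrable (fun s => ⟪Q (z s), S.adjGen φ⟫_ℝ) volume 0 t :=
    ((Q.continuous.comp hz).inner continuous_const).intervalIntegrable _ _
  have h2 : IntervalIntegrable (fun s => ⟪g s, S.incl φ⟫_ℝ) volume 0 t :=
    (hg.inner continuous_const).intervalIntegrable _ _
  have h3 : IntervalIntegrable (fun s => ⟪W (v s), ctrlAdj S B φ⟫_ℝ) volume 0 t :=
    intervalIntegrable_of_integrableOn_Ioo (hv.integrableOn_inner W _) ⟨le_rfl, hT0⟩ ht
  have hQzi : IntervalIntegrable (fun s => Q (z s)) volume 0 t :=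
    (Q.continuous.comp hz).intervalIntegrable _ _
  have hWvi : IntervalIntegrable (fun s => W (v s)) volume 0 t :=
    intervalIntegrable_of_integrableOn_Ioo (W.integrable_comp (hv.1.integrable (by norm_num)))
      ⟨le_rfl, hT0⟩ ht
  have hQZ : ∫ s in (0 : ℝ)..t, Q (z s) = Q (S.incl Z') := by
    rw [hZ]
    exact (Q : H →L[ℝ] H).intervalIntegral_comp_comm hzi
  have hWv : ∫ s in (0 : ℝ)..t, W (v s) = W (ctrlAdj S B Z') := by
    rw [hZv]
    exact W.intervalIntegral_comp_comm hvi
  have hk : ∫ s in (0 : ℝ)..t, loopSource Q R lam (g s) (z s)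
      = -((2 * lam) • S.incl Z') - R (Q (S.incl Z')) + Q.symm (∫ s in (0 : ℝ)..t, g s) := by
    have e1 : IntervalIntegrable (fun s => (2 * lam) • z s) volume 0 t := hzi.smul _
    have e2 : IntervalIntegrable (fun s => R (Q (z s))) volume 0 t :=
      (R.continuous.comp (Q.continuous.comp hz)).intervalIntegrable _ _
    have e3 : IntervalIntegrable (fun s => Q.symm (g s)) volume 0 t :=
      (Q.symm.continuous.comp hg).intervalIntegrable _ _
    simp only [loopSource]
    have e1n : IntervalIntegrable (fun s => -((2 * lam) • z s)) volume 0 t := e1.neg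
    have e12 : IntervalIntegrable (fun s => -((2 * lam) • z s) - R (Q (z s))) volume 0 t :=
      e1n.sub e2
    rw [intervalIntegral.integral_add e12 e3, intervalIntegral.integral_sub e1n e2,
      intervalIntegral.integral_neg, intervalIntegral.integral_smul, ← hZ,
      ← hQZ]
    congr 2
    · exact R.intervalIntegral_comp_comm hQzi
    · exact (Q.symm : H →L[ℝ] H).intervalIntegral_comp_comm hgi
  rw [intervalIntegral.integral_sub (h1.add h2) h3, intervalIntegral.integral_add h1 h2,
    ← intervalIntegral_inner_left hQzi, ← intervalIntegral_inner_left hgi,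
    ← intervalIntegral_inner_left hWvi, hQZ, hWv]
  -- The identity is tested with the antiderivative of z. Its R and λ terms cancel those of the
  -- integrated source, leaving the integrated equation for Qz.
  have h4 := hid Z' φ
  simp only [ContinuousLinearEquiv.coe_coe] at h4
  rw [hZA, hk] at h4
  have hs : ∀ x y, ⟪Q x, y⟫_ℝ = ⟪x, Q y⟫_ℝ := hQ.1
  have h5 : ⟪Q.symm (∫ s in (0 : ℝ)..t, g s), Q (S.incl φ)⟫_ℝ
      = ⟪∫ s in (0 : ℝ)..t, g s, S.incl φ⟫_ℝ := by
    rw [← hs]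
    simp
  simp only [inner_add_left, inner_sub_left, inner_neg_left, inner_smul_left, h5] at h4
  rw [hs (S.incl Z') (S.incl φ)] at h4
  simp only [← hs (z 0), ← hs (z t)] at h4
  simp only [conj_trivial] at h4
  linarith

theorem IsMild.integrableOn_fst (hm : IsMild S (fun s => loopSource Q R lam (g s) (z s)) z)
    (hg : Continuous g) {T : ℝ} {v : ℝ → U} (hv : IsObservation S B T z v) (φ : S.adjDomain) :
    IntegrableOn (fun s => ⟪Q (z s), S.adjGen φ⟫_ℝ + ⟪g s, S.incl φ⟫_ℝ
      - ⟪W (v s), ctrlAdj S B φ⟫_ℝ) (Ioo 0 T) := by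
  refine Integrable.sub ?_ (hv.integrableOn_inner W _)
  have : Continuous fun s => ⟪Q (z s), S.adjGen φ⟫_ℝ + ⟪g s, S.incl φ⟫_ℝ :=
    ((Q.continuous.comp hm.continuous).inner continuous_const).add (hg.inner continuous_const)
  exact this.integrableOn_Icc.mono_set Ioo_subset_Icc_self

theorem IsMild.isWeakSolution (hm : IsMild S (fun s => loopSource Q R lam (g s) (z s)) z)
    (hB : IsAdmissible S B) (hg : Continuous g) (hQ : IsPosSymm (Q : H →L[ℝ] H))
    (hid : OperatorIdentity S B (Q : H →L[ℝ] H) R W lam) {T : ℝ} (hT : 0 < T) :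
    IsWeakSolution S B W T g (fun s => loopSource Q R lam (g s) (z s)) (Q (z 0)) (z 0)
      (fun s => Q (z s)) z where
  continuousOn_fst := (Q.continuous.comp hm.continuous).continuousOn
  continuousOn_snd := hm.continuous.continuousOn
  init_fst := rfl
  init_snd := rfl
  eq_fst := by
    obtain ⟨v, hv, _⟩ := hm.exists_observation hB hT
    exact ⟨v, hv, fun φ => hasDistribDeriv_of_eq_integral hT (hm.integrableOn_fst hg hv φ)
      fun t ht => hm.inner_eq_integral hg hQ hid hv φ ht⟩
  eq_snd ψ := by
    have hc : Continuous fun s => -⟪z s, S.generator ψ⟫_ℝ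
        + ⟪loopSource Q R lam (g s) (z s), (ψ : H)⟫_ℝ :=
      (hm.continuous.inner continuous_const).neg.add
        (hm.continuous_source.inner continuous_const)
    refine hasDistribDeriv_of_eq_integral hT
      (hc.integrableOn_Icc.mono_set Ioo_subset_Icc_self) fun t _ => ?_
    rw [← hm.inner_sub_eq_integral ψ 0 t]
    ring

/-- The source contributes -4λ⟨Qz, z⟩ - 2⟨RQz, Qz⟩ + 2⟨g, z⟩, which reverses the signs of the λ and
R terms of `IsMild.energy` and makes the linear part dissipative. -/
theorem IsMild.closedLoop_energy (hm : IsMild S (fun s => loopSource Q R lam (g s) (z s)) z)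
    (hB : IsAdmissible S B) (hQ : IsPosSymm (Q : H →L[ℝ] H))
    (hid : OperatorIdentity S B (Q : H →L[ℝ] H) R W lam) {T : ℝ} (hT : 0 < T) {v : ℝ → U}
    (hv : IsObservation S B T z v) {a b : ℝ} (ha : 0 ≤ a) (hab : a ≤ b) (hb : b ≤ T) :
    ⟪Q (z b), z b⟫_ℝ - ⟪Q (z a), z a⟫_ℝ = -(∫ s in a..b, ⟪W (v s), v s⟫_ℝ)
      + ∫ s in a..b, (-⟪R (Q (z s)), Q (z s)⟫_ℝ - 2 * lam * ⟪Q (z s), z s⟫_ℝ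
        + 2 * ⟪g s, z s⟫_ℝ) := by
  have h := hm.energy hB hQ.1 hid hT hv ha hab hb
  simp only [ContinuousLinearEquiv.coe_coe] at h
  rw [h]
  congr 1
  refine intervalIntegral.integral_congr fun s _ => ?_
  simp only [loopSource]
  rw [inner_add_right, inner_sub_right, inner_neg_right, inner_smul_right, inner_symm_right hQ,
    real_inner_comm (R (Q (z s))), real_inner_comm (z s) (g s)]
  ring

/-- Exponential decay of a mild solution whose nonlinear source is small. -/
theorem IsMild.decay (hm : IsMild S (fun s => loopSource Q R lam (g s) (z s)) z)
    (hB : IsAdmissible S B) (hg : Continuous g) (hQ : IsPosSymm (Q : H →L[ℝ] H))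
    (hR : IsNonnegSymm R) (hW : IsNonnegSymm W)
    (hid : OperatorIdentity S B (Q : H →L[ℝ] H) R W lam) {c : ℝ}
    (hc : ∀ x, c * ‖x‖ ^ 2 ≤ ⟪Q x, x⟫_ℝ) {γ η : ℝ} (hγ : γ ≤ lam) (hη : 0 ≤ η)
    (hηγ : η * ‖(Q : H →L[ℝ] H)‖ ≤ (lam - γ) * c)
    (hsmall : ∀ s, 0 ≤ s → ‖g s‖ ≤ η * ‖Q (z s)‖) {t : ℝ} (ht : 0 ≤ t) :
    ⟪Q (z t), z t⟫_ℝ ≤ Real.exp (-(2 * γ) * t) * ⟪Q (z 0), z 0⟫_ℝ := by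
  have hz := hm.continuous
  have hEc : Continuous fun s => ⟪Q (z s), z s⟫_ℝ := (Q.continuous.comp hz).inner hz
  refine le_exp_mul_of_sub_le_integral hEc (fun a b ha hab => ?_) ht
  -- Observations live on intervals of positive length, and b may be 0.
  have hb1 : 0 < b + 1 := by linarith
  obtain ⟨v, hv, _⟩ := hm.exists_observation hB hb1
  rw [hm.closedLoop_energy hB hQ hid hb1 hv ha hab (by linarith),
    ← intervalIntegral.integral_const_mul]
  have h1 : 0 ≤ ∫ s in a..b, ⟪W (v s), v s⟫_ℝ :=
    intervalIntegral.integral_nonneg hab fun s _ => hW.2 _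
  have h2 : ∫ s in a..b, (-⟪R (Q (z s)), Q (z s)⟫_ℝ - 2 * lam * ⟪Q (z s), z s⟫_ℝ
      + 2 * ⟪g s, z s⟫_ℝ) ≤ ∫ s in a..b, -(2 * γ) * ⟪Q (z s), z s⟫_ℝ := by
    refine intervalIntegral.integral_mono_on hab ?_ ?_ fun s hs => ?_
    · have hQz : Continuous fun s => Q (z s) := Q.continuous.comp hz
      exact ((((R.continuous.comp hQz).inner hQz).neg.sub (continuous_const.mul hEc)).add
        (continuous_const.mul (hg.inner hz))).intervalIntegrable _ _
    · exact (continuous_const.mul hEc).intervalIntegrable _ _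
    · have h3 := hR.2 (Q (z s))
      -- Coercivity absorbs the nonlinearity: it uses up λ - γ of the damping rate, and γ remains.
      have h4 : ⟪g s, z s⟫_ℝ ≤ (lam - γ) * ⟪Q (z s), z s⟫_ℝ := by
        calc ⟪g s, z s⟫_ℝ ≤ ‖g s‖ * ‖z s‖ := real_inner_le_norm _ _
          _ ≤ (η * (‖(Q : H →L[ℝ] H)‖ * ‖z s‖)) * ‖z s‖ := by
              gcongr
              refine (hsmall s (ha.trans hs.1)).trans ?_
              gcongr
              exact (Q : H →L[ℝ] H).le_opNorm _
          _ = (η * ‖(Q : H →L[ℝ] H)‖) * ‖z s‖ ^ 2 := by ring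
          _ ≤ ((lam - γ) * c) * ‖z s‖ ^ 2 := by gcongr
          _ = (lam - γ) * (c * ‖z s‖ ^ 2) := by ring
          _ ≤ (lam - γ) * ⟪Q (z s), z s⟫_ℝ :=
              mul_le_mul_of_nonneg_left (hc _) (by linarith)
      linarith
  linarith

end ClosedLoop

end StaticFeedback

namespace StaticFeedback

variable {H : Type*} [NormedAddCommGroup H] [InnerProductSpace ℝ H] [CompleteSpace H]
variable {U : Type*} [NormedAddCommGroup U] [InnerProductSpace ℝ U] [CompleteSpace U]
variable {S : C0Group H} {B : U →L[ℝ] StrongDual ℝ S.adjDomain}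
variable {Q : H ≃L[ℝ] H} {R : H →L[ℝ] H} {W : U →L[ℝ] U} {lam : ℝ}

/-! ### Existence, uniqueness and decay for the nonlinear closed loop -/

theorem HasDistribDeriv.congr {T : ℝ} {u h h' : ℝ → ℝ} (huh : HasDistribDeriv T u h)
    (hh : ∀ t ∈ Ioo 0 T, h t = h' t) : HasDistribDeriv T u h' := by
  obtain ⟨h1, h2, h3⟩ := huh
  refine ⟨h1, h2.congr_fun hh measurableSet_Ioo, fun θ hθ hθc hθT => ?_⟩
  rw [h3 θ hθ hθc hθT]
  congr 1
  refine setIntegral_congr_fun measurableSet_Ioo fun t ht => ?_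
  simp only [hh t ht]

theorem IsWeakSolution.congr {T : ℝ} {g h g' h' y z : ℝ → H} {y₀ z₀ : H}
    (hs : IsWeakSolution S B W T g h y₀ z₀ y z) (hg : ∀ t ∈ Ioo 0 T, g t = g' t)
    (hh : ∀ t ∈ Ioo 0 T, h t = h' t) : IsWeakSolution S B W T g' h' y₀ z₀ y z where
  continuousOn_fst := hs.continuousOn_fst
  continuousOn_snd := hs.continuousOn_snd
  init_fst := hs.init_fst
  init_snd := hs.init_snd
  eq_fst := by
    obtain ⟨v, hv, hd⟩ := hs.eq_fst
    exact ⟨v, hv, fun φ => (hd φ).congr fun t ht => by rw [hg t ht]⟩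
  eq_snd ψ := (hs.eq_snd ψ).congr fun t ht => by rw [hh t ht]

/-- A weak solution with zero initial value whose source is locally dominated by it vanishes. -/
theorem eq_zero_of_weak (G : C0Group H) {T ρ L : ℝ} (hρ : 0 < ρ) (hL : 0 ≤ L) {q k : ℝ → H}
    (hq : ContinuousOn q (Icc 0 T)) (hk : ContinuousOn k (Icc 0 T)) (hq0 : q 0 = 0)
    (hw : ∀ ψ : G.generator.domain, ∀ t ∈ Icc 0 T, ⟪q t, (ψ : H)⟫_ℝ
      = ∫ s in (0 : ℝ)..t, (-⟪q s, G.generator ψ⟫_ℝ + ⟪k s, (ψ : H)⟫_ℝ))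
    (hkq : ∀ t ∈ Icc 0 T, ‖q t‖ < ρ → ‖k t‖ ≤ L * ‖q t‖) : ∀ t ∈ Icc 0 T, q t = 0 :=
  eq_zero_of_norm_source_le G.dual hρ hL hq hq0
    (fun _ ht => hasDerivWithinAt_of_weak G hq hk
      (fun ψ t ht => by rw [hw ψ t ht, hq0, inner_zero_left, zero_add]) ht) hkq

/-! ### Uniqueness of weak solutions -/

section Uniqueness

variable {g z : ℝ → H} {f : H → H} {r L T : ℝ} {y₀ : H} {y' z' : ℝ → H}

/-- The second equation is closed in z, so the difference z' - z satisfies a weak equation with zero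
initial value and a locally Lipschitz source. The competitor z' is not assumed small. -/
theorem IsClosedLoopSolution.snd_eqOn
    (hs : IsClosedLoopSolution S B Q R W lam f T y₀ y' z') (hT : 0 < T)
    (hm : IsMild S (fun s => loopSource Q R lam (g s) (z s)) z) (hf : Continuous f) (hr : 0 < r)
    (hL : 0 ≤ L) (hlip : ∀ x x' : H, ‖x‖ < r → ‖x'‖ < r → ‖f x - f x'‖ ≤ L * ‖x - x'‖)
    (hz0 : z 0 = Q.symm y₀) (hgf : ∀ t, 0 ≤ t → g t = f (Q (z t)))
    (hzr : ∀ t, 0 ≤ t → ‖Q (z t)‖ ≤ r / 2) : EqOn z' z (Icc 0 T) := by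
  have hz' := hs.continuousOn_snd
  have hz := hm.continuous
  have hk' : ContinuousOn (fun s => loopSource Q R lam (f (Q (z' s))) (z' s)) (Icc 0 T) := by
    unfold loopSource
    fun_prop
  -- At this distance from z the point Qz' differs from Qz by less than r/2; as ‖Qz‖ ≤ r/2, both lie
  -- in the ball where f is Lipschitz.
  have hρ : 0 < r / (2 * (‖(Q : H →L[ℝ] H)‖ + 1)) := by positivity
  have hzero : ∀ t ∈ Icc 0 T, z' t - z t = 0 := by
    refine eq_zero_of_weak S hρ (L := |2 * lam| + ‖R‖ * ‖(Q : H →L[ℝ] H)‖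
          + ‖(Q.symm : H →L[ℝ] H)‖ * (L * ‖(Q : H →L[ℝ] H)‖)) (by positivity)
      (k := fun s => loopSource Q R lam (f (Q (z' s))) (z' s) - loopSource Q R lam (g s) (z s))
      (hz'.sub hz.continuousOn) (hk'.sub hm.continuous_source.continuousOn) ?_ ?_ ?_
    · rw [hs.init_snd, hz0, sub_self]
    · intro ψ t ht
      have huc : ContinuousOn (fun t => ⟪z' t, (ψ : H)⟫_ℝ) (Icc 0 T) :=
        hz'.inner continuousOn_const
      have e1 := (hs.eq_snd ψ).eq_add_integral hT huc ht
      have e2 := hm.inner_sub_eq_integral ψ 0 t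
      have i1 := intervalIntegrable_of_integrableOn_Ioo (hs.eq_snd ψ).2.1 ⟨le_rfl, hT.le⟩ ht
      have i2 : IntervalIntegrable (fun s => -⟪z s, S.generator ψ⟫_ℝ
          + ⟪loopSource Q R lam (g s) (z s), (ψ : H)⟫_ℝ) volume 0 t :=
        ((hz.inner continuous_const).neg.add
          (hm.continuous_source.inner continuous_const)).intervalIntegrable _ _
      rw [inner_sub_left, e1, hs.init_snd, ← hz0, sub_eq_iff_eq_add'.1 e2,
        add_sub_add_left_eq_sub, ← intervalIntegral.integral_sub i1 i2]
      refine intervalIntegral.integral_congr fun s _ => ?_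
      simp only [inner_sub_left, loopSource]
      ring
    · intro t ht hlt
      refine norm_loopSource_sub_le Q R lam ?_ hL
      rw [hgf t ht.1]
      have h1 := hzr t ht.1
      refine hlip _ _ ?_ (by linarith)
      have h2 : ‖Q (z' t) - Q (z t)‖ < r / 2 := by
        rw [← map_sub]
        calc ‖Q (z' t - z t)‖ ≤ ‖(Q : H →L[ℝ] H)‖ * ‖z' t - z t‖ := (Q : H →L[ℝ] H).le_opNorm _
          _ ≤ (‖(Q : H →L[ℝ] H)‖ + 1) * ‖z' t - z t‖ := by gcongr; linarith
          _ < (‖(Q : H →L[ℝ] H)‖ + 1) * (r / (2 * (‖(Q : H →L[ℝ] H)‖ + 1))) := by gcongr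
          _ = r / 2 := by field_simp
      have h3 := norm_sub_norm_le (Q (z' t)) (Q (z t))
      linarith
  exact fun t ht => sub_eq_zero.1 (hzero t ht)

/-- With equal second components the observation of z' is also one of z, so the feedback terms of y'
and Qz coincide and cancel in the difference. -/
theorem IsClosedLoopSolution.fst_eqOn
    (hs : IsClosedLoopSolution S B Q R W lam f T y₀ y' z') (hT : 0 < T)
    (hm : IsMild S (fun s => loopSource Q R lam (g s) (z s)) z) (hg : Continuous g)
    (hQ : IsPosSymm (Q : H →L[ℝ] H)) (hid : OperatorIdentity S B (Q : H →L[ℝ] H) R W lam)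
    (hf : Continuous f) (hr : 0 < r) (hL : 0 ≤ L)
    (hlip : ∀ x x' : H, ‖x‖ < r → ‖x'‖ < r → ‖f x - f x'‖ ≤ L * ‖x - x'‖)
    (hz0 : z 0 = Q.symm y₀) (hgf : ∀ t, 0 ≤ t → g t = f (Q (z t)))
    (hzr : ∀ t, 0 ≤ t → ‖Q (z t)‖ ≤ r / 2) (hzz : EqOn z' z (Icc 0 T)) :
    EqOn y' (fun t => Q (z t)) (Icc 0 T) := by
  have hy' := hs.continuousOn_fst
  have hQz : Continuous fun t => Q (z t) := Q.continuous.comp hm.continuous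
  have hy0 : Q (z 0) = y₀ := by rw [hz0, Q.apply_symm_apply]
  obtain ⟨v, hv', hd⟩ := hs.eq_fst
  have hv : IsObservation S B T z v := by
    refine ⟨hv'.1, fun a b ha hab hb => ?_⟩
    obtain ⟨φ, h1, h2⟩ := hv'.2 a b ha hab hb
    refine ⟨φ, h1.trans (intervalIntegral.integral_congr fun s hs => hzz ?_), h2⟩
    rw [uIcc_of_le hab] at hs
    exact ⟨ha.trans hs.1, hs.2.trans hb⟩
  have hzero : ∀ t ∈ Icc 0 T, y' t - Q (z t) = 0 := by
    refine eq_zero_of_weak S.dual (half_pos hr) hL (k := fun s => f (y' s) - g s)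
      (hy'.sub hQz.continuousOn) ((hf.comp_continuousOn hy').sub hg.continuousOn) ?_ ?_ ?_
    · rw [hs.init_fst, hy0, sub_self]
    · intro ψ t ht
      -- The sign in A* = -(dual generator) puts the equation for y' - Qz in the form required by
      -- `eq_zero_of_weak` for the dual group.
      obtain ⟨φ, hφ, hφA⟩ := S.exists_adjDomain_of_dual ψ
      have huc : ContinuousOn (fun t => ⟪y' t, S.incl φ⟫_ℝ) (Icc 0 T) :=
        hy'.inner continuousOn_const
      have e1 := (hd φ).eq_add_integral hT huc ht
      have e2 := hm.inner_eq_integral hg hQ hid hv φ ht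
      have i1 := intervalIntegrable_of_integrableOn_Ioo (hd φ).2.1 ⟨le_rfl, hT.le⟩ ht
      have i2 := intervalIntegrable_of_integrableOn_Ioo (hm.integrableOn_fst (R := R) (lam := lam)
        (W := W) hg hv φ) ⟨le_rfl, hT.le⟩ ht
      rw [← hφ, inner_sub_left, e1, e2, hs.init_fst, hy0, add_sub_add_left_eq_sub,
        ← intervalIntegral.integral_sub i1 i2]
      refine intervalIntegral.integral_congr fun s _ => ?_
      simp only [inner_sub_left, hφA, inner_neg_right]
      ring
    · intro t ht hlt
      rw [hgf t ht.1]
      have h1 := hzr t ht.1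
      have h3 := norm_sub_norm_le (y' t) (Q (z t))
      exact hlip _ _ (by linarith) (by linarith)
  exact fun t ht => sub_eq_zero.1 (hzero t ht)

end Uniqueness

/-- Small initial data give rise to a global mild solution of the nonlinear adjoint equation that
stays small. -/
theorem exists_isMild_closedLoop (hB : IsAdmissible S B) (hQ : IsPosSymm (Q : H →L[ℝ] H))
    (hR : IsNonnegSymm R) (hW : IsNonnegSymm W) (hlam : 0 < lam)
    (hid : OperatorIdentity S B (Q : H →L[ℝ] H) R W lam) {f : H → H} (hf : Continuous f)
    (hf_small : ∀ η : ℝ, 0 < η → ∃ δ : ℝ, 0 < δ ∧ ∀ x : H, ‖x‖ < δ → ‖f x‖ ≤ η * ‖x‖)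
    {r L : ℝ} (hr : 0 < r) (hL : 0 ≤ L)
    (hlip : ∀ x x' : H, ‖x‖ < r → ‖x'‖ < r → ‖f x - f x'‖ ≤ L * ‖x - x'‖) :
    ∃ ε K : ℝ, 0 < ε ∧ 0 ≤ K ∧ ∀ y₀ : H, ‖y₀‖ ≤ ε → ∃ g z : ℝ → H, z 0 = Q.symm y₀ ∧
      Continuous g ∧ IsMild S (fun s => loopSource Q R lam (g s) (z s)) z ∧
      ∀ t, 0 ≤ t → g t = f (Q (z t)) ∧ ‖Q (z t)‖ ≤ r / 2 ∧ ‖Q (z t)‖ ≤ K * ‖y₀‖ := by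
  obtain ⟨c, hc0, hc⟩ := hQ.2
  have hf0 : f 0 = 0 := by
    obtain ⟨δ, hδ, h⟩ := hf_small 1 one_pos
    simpa using h 0 (by simpa using hδ)
  set q := ‖(Q : H →L[ℝ] H)‖ with hq
  have hq0 : 0 ≤ q := norm_nonneg _
  -- This smallness lets `IsMild.decay` run with γ = 0; the +1 avoids division by zero when ‖Q‖ = 0.
  have hη : 0 < lam * c / (q + 1) := by positivity
  obtain ⟨δ, hδ, hfδ⟩ := hf_small _ hη
  set ρ := min r δ with hρd
  have hρ : 0 < ρ := lt_min hr hδ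
  have hρr : ρ ≤ r := min_le_left _ _
  set F : H → H := fun x => cutoff ρ x • f x with hF
  have hFl : ∀ x y, ‖F x - F y‖ ≤ 3 * L * ‖x - y‖ := norm_cutoff_smul_sub_le hρ hL hf0
    fun x y hx hy => hlip x y (hx.trans_le hρr) (hy.trans_le hρr)
  have hFs : ∀ x, ‖F x‖ ≤ lam * c / (q + 1) * ‖x‖ := fun x => by
    rcases lt_or_ge ‖x‖ ρ with h | h
    · simp only [hF]
      rw [norm_smul, Real.norm_of_nonneg (cutoff_nonneg _ _)]
      exact (mul_le_of_le_one_left (norm_nonneg _) (cutoff_le_one _ _)).trans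
        (hfδ x (h.trans_le (min_le_right _ _)))
    · simp only [hF]
      rw [cutoff_eq_zero hρ h, zero_smul, norm_zero]
      positivity
  have hFc : Continuous F := by
    simp only [hF, cutoff]
    fun_prop
  -- From c‖z(t)‖² ≤ ⟨Qz(t), z(t)⟩ ≤ ⟨Qz(0), z(0)⟩ ≤ q‖Q⁻¹y₀‖², followed by ‖Qz‖ ≤ q‖z‖.
  set K := q * (√(q / c) * ‖(Q.symm : H →L[ℝ] H)‖) with hK
  have hK0 : 0 ≤ K := by positivity
  refine ⟨ρ / (2 * (K + 1)), K, by positivity, hK0, fun y₀ hy₀ => ?_⟩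
  obtain ⟨z, hz0, hm⟩ := exists_isMild S (h := fun x => loopSource Q R lam (F (Q x)) x)
    (by simp [loopSource, hF, hf0])
    (K := |2 * lam| + ‖R‖ * q + ‖(Q.symm : H →L[ℝ] H)‖ * (3 * L * q)) (by positivity)
    (fun x y => norm_loopSource_sub_le Q R lam (hFl _ _) (by positivity)) (Q.symm y₀)
  have hgc : Continuous fun t => F (Q (z t)) := hFc.comp (Q.continuous.comp hm.continuous)
  have hbound : ∀ t, 0 ≤ t → ‖Q (z t)‖ ≤ K * ‖y₀‖ := by
    intro t ht
    have h1 := hm.decay (γ := 0) (η := lam * c / (q + 1)) hB hgc hQ hR hW hid hc hlam.le hη.le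
      (by
        rw [sub_zero, div_mul_eq_mul_div, div_le_iff₀ (by positivity)]
        gcongr
        linarith)
      (fun s _ => hFs _) ht
    rw [mul_zero, neg_zero, zero_mul, Real.exp_zero, one_mul, hz0] at h1
    have h2 : ‖Q.symm y₀‖ ≤ ‖(Q.symm : H →L[ℝ] H)‖ * ‖y₀‖ := (Q.symm : H →L[ℝ] H).le_opNorm _
    have h3 : ⟪Q (Q.symm y₀), Q.symm y₀⟫_ℝ ≤ q * (‖(Q.symm : H →L[ℝ] H)‖ * ‖y₀‖) ^ 2 := by
      calc ⟪Q (Q.symm y₀), Q.symm y₀⟫_ℝ ≤ ‖Q (Q.symm y₀)‖ * ‖Q.symm y₀‖ := real_inner_le_norm _ _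
        _ ≤ (q * ‖Q.symm y₀‖) * ‖Q.symm y₀‖ := by
            gcongr
            exact (Q : H →L[ℝ] H).le_opNorm _
        _ = q * ‖Q.symm y₀‖ ^ 2 := by ring
        _ ≤ _ := by gcongr
    have h4 : ‖z t‖ ≤ √(q / c) * (‖(Q.symm : H →L[ℝ] H)‖ * ‖y₀‖) := by
      refine (abs_le_of_sq_le_sq' ?_ (by positivity)).2
      rw [mul_pow, Real.sq_sqrt (by positivity), div_mul_eq_mul_div, le_div_iff₀ hc0]
      have := hc (z t)
      simp only [ContinuousLinearEquiv.coe_coe] at this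
      linarith
    calc ‖Q (z t)‖ ≤ q * ‖z t‖ := (Q : H →L[ℝ] H).le_opNorm _
      _ ≤ q * (√(q / c) * (‖(Q.symm : H →L[ℝ] H)‖ * ‖y₀‖)) := by gcongr
      _ = K * ‖y₀‖ := by rw [hK]; ring
  -- The source g is the truncated nonlinearity along the trajectory. It is continuous on the line,
  -- but equality with f is claimed only for t ≥ 0, where the energy does not increase.
  refine ⟨fun t => F (Q (z t)), z, hz0, hgc, hm, fun t ht => ?_⟩
  have h1 : ‖Q (z t)‖ ≤ ρ / 2 := by
    calc ‖Q (z t)‖ ≤ K * ‖y₀‖ := hbound t ht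
      _ ≤ (K + 1) * (ρ / (2 * (K + 1))) := by gcongr; linarith
      _ = ρ / 2 := by field_simp
  refine ⟨?_, by linarith, hbound t ht⟩
  simp only [hF]
  rw [cutoff_eq_one hρ h1, one_smul]

/-- The Lyapunov identity along the closed loop. -/
theorem IsMild.lyapunov_identity {g z : ℝ → H} {f : H → H}
    (hm : IsMild S (fun s => loopSource Q R lam (g s) (z s)) z) (hg : Continuous g)
    (hB : IsAdmissible S B) (hQ : IsPosSymm (Q : H →L[ℝ] H)) (hR : IsNonnegSymm R)
    (hW : IsNonnegSymm W) (hid : OperatorIdentity S B (Q : H →L[ℝ] H) R W lam)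
    (hgf : ∀ t, 0 ≤ t → g t = f (Q (z t))) {τ t : ℝ} (hτ : 0 ≤ τ) (hτt : τ ≤ t) {v : ℝ → U}
    (hv : IsObservation S B t z v) :
    ‖opSqrt (Q.symm : H →L[ℝ] H) (Q (z t))‖ ^ 2 - ‖opSqrt (Q.symm : H →L[ℝ] H) (Q (z τ))‖ ^ 2
      = -(2 * lam) * (∫ s in τ..t, ‖opSqrt (Q.symm : H →L[ℝ] H) (Q (z s))‖ ^ 2)
        - (∫ s in τ..t, (‖opSqrt W (v s)‖ ^ 2 + ‖opSqrt R (Q (z s))‖ ^ 2))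
        + 2 * ∫ s in τ..t, ⟪f (Q (z s)), Q.symm (Q (z s))⟫_ℝ := by
  -- For t = 0 the observation interval degenerates and both sides vanish.
  rcases (hτ.trans hτt).eq_or_lt with h0 | ht
  · obtain rfl : τ = t := le_antisymm hτt (h0 ▸ hτ)
    simp
  simp only [norm_opSqrt_symm_sq hQ, Q.symm_apply_apply, norm_opSqrt_sq hR]
  rw [hm.closedLoop_energy hB hQ hid ht hv hτ hτt le_rfl]
  have hz := hm.continuous
  have hQz : Continuous fun s => Q (z s) := Q.continuous.comp hz
  have hτm : τ ∈ Icc 0 t := ⟨hτ, hτt⟩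
  have htm : t ∈ Icc 0 t := ⟨ht.le, le_rfl⟩
  have hWi : IntervalIntegrable (fun s => ‖opSqrt W (v s)‖ ^ 2) volume τ t :=
    intervalIntegrable_of_integrableOn_Ioo
      ((opSqrt W).comp_memLp' hv.1).integrable_norm_pow' hτm htm
  have hRi : IntervalIntegrable (fun s => ⟪R (Q (z s)), Q (z s)⟫_ℝ) volume τ t :=
    ((R.continuous.comp hQz).inner hQz).intervalIntegrable _ _
  have hEi : IntervalIntegrable (fun s => ⟪Q (z s), z s⟫_ℝ) volume τ t :=
    (hQz.inner hz).intervalIntegrable _ _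
  have hfi : IntervalIntegrable (fun s => ⟪g s, z s⟫_ℝ) volume τ t :=
    (hg.inner hz).intervalIntegrable _ _
  have e1 : IntervalIntegrable (fun s => -⟪R (Q (z s)), Q (z s)⟫_ℝ) volume τ t := hRi.neg
  have e2 : IntervalIntegrable (fun s => 2 * lam * ⟪Q (z s), z s⟫_ℝ) volume τ t :=
    hEi.const_mul _
  have e3 : IntervalIntegrable (fun s => 2 * ⟪g s, z s⟫_ℝ) volume τ t := hfi.const_mul _
  have e12 : IntervalIntegrable
      (fun s => -⟪R (Q (z s)), Q (z s)⟫_ℝ - 2 * lam * ⟪Q (z s), z s⟫_ℝ) volume τ t := e1.sub e2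
  have hfg : ∫ s in τ..t, ⟪f (Q (z s)), z s⟫_ℝ = ∫ s in τ..t, ⟪g s, z s⟫_ℝ := by
    refine intervalIntegral.integral_congr fun s hs => ?_
    rw [uIcc_of_le hτt] at hs
    simp only [hgf s (hτ.trans hs.1)]
  rw [hfg, intervalIntegral.integral_add hWi hRi, intervalIntegral.integral_add e12 e3,
    intervalIntegral.integral_sub e1 e2, intervalIntegral.integral_neg,
    intervalIntegral.integral_const_mul, intervalIntegral.integral_const_mul]
  simp only [norm_opSqrt_sq hW]
  ring

end StaticFeedback


/-! ### The main theorem -/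

theorem mainTheorem3 {H U : Type*}
    [NormedAddCommGroup H] [InnerProductSpace ℝ H] [CompleteSpace H]
    [NormedAddCommGroup U] [InnerProductSpace ℝ U] [CompleteSpace U]
    (S : C0Group H) (B : U →L[ℝ] StrongDual ℝ S.adjDomain) (hB : IsAdmissible S B)
    (Q : H ≃L[ℝ] H) (R : H →L[ℝ] H) (W : U →L[ℝ] U)
    (hQ : IsPosSymm (Q : H →L[ℝ] H)) (hR : IsNonnegSymm R) (hW : IsNonnegSymm W)
    (lam : ℝ) (hlam : 0 < lam) (hid : OperatorIdentity S B (Q : H →L[ℝ] H) R W lam)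
    (f : H → H) (hf : Continuous f)
    (hf_small : ∀ η : ℝ, 0 < η → ∃ δ : ℝ, 0 < δ ∧ ∀ x : H, ‖x‖ < δ → ‖f x‖ ≤ η * ‖x‖)
    (hf_lip : ∃ r L : ℝ, 0 < r ∧ 0 < L ∧
      ∀ x x' : H, ‖x‖ < r → ‖x'‖ < r → ‖f x - f x'‖ ≤ L * ‖x - x'‖) :
    ∃ ε : ℝ, 0 < ε ∧
      (∀ y₀ : H, ‖y₀‖ ≤ ε → ∃ y z : ℝ → H,
        -- `(y, z)` is a global weak solution
        (∀ T : ℝ, 0 < T → IsClosedLoopSolution S B Q R W lam f T y₀ y z) ∧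
        -- it is the only one, on every time interval
        (∀ T : ℝ, 0 < T → ∀ y' z' : ℝ → H, IsClosedLoopSolution S B Q R W lam f T y₀ y' z' →
          EqOn y' y (Icc 0 T) ∧ EqOn z' z (Icc 0 T)) ∧
        (∀ t : ℝ, 0 ≤ t → z t = Q.symm (y t)) ∧
        -- the Lyapunov identity, with `v = B* z`
        (∀ τ t : ℝ, 0 ≤ τ → τ ≤ t → ∀ v : ℝ → U, IsObservation S B t z v →
          ‖opSqrt (Q.symm : H →L[ℝ] H) (y t)‖ ^ 2 - ‖opSqrt (Q.symm : H →L[ℝ] H) (y τ)‖ ^ 2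
            = -(2 * lam) * (∫ s in τ..t, ‖opSqrt (Q.symm : H →L[ℝ] H) (y s)‖ ^ 2)
              - (∫ s in τ..t, (‖opSqrt W (v s)‖ ^ 2 + ‖opSqrt R (y s)‖ ^ 2))
              + 2 * ∫ s in τ..t, ⟪f (y s), Q.symm (y s)⟫_ℝ)) ∧
      (∀ γ : ℝ, γ < lam → ∃ εγ : ℝ, 0 < εγ ∧ εγ ≤ ε ∧
        ∀ y₀ : H, ‖y₀‖ ≤ εγ → ∀ y z : ℝ → H,
          (∀ T : ℝ, 0 < T → IsClosedLoopSolution S B Q R W lam f T y₀ y z) →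
          ∀ t : ℝ, 0 ≤ t →
            ‖opSqrt (Q.symm : H →L[ℝ] H) (y t)‖
              ≤ Real.exp (-γ * t) * ‖opSqrt (Q.symm : H →L[ℝ] H) y₀‖) := by
  obtain ⟨r, L, hr, hL, hlip⟩ := hf_lip
  obtain ⟨c, hc0, hc⟩ := hQ.2
  obtain ⟨ε, K, hε, hK, hex⟩ :=
    exists_isMild_closedLoop hB hQ hR hW hlam hid hf hf_small hr hL.le hlip
  refine ⟨ε, hε, fun y₀ hy₀ => ?_, fun γ hγ => ?_⟩
  · obtain ⟨g, z, hz0, hg, hm, hz⟩ := hex y₀ hy₀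
    refine ⟨fun t => Q (z t), z, fun T hT => ?_, fun T hT y' z' hs => ?_,
      fun t _ => (Q.symm_apply_apply _).symm, fun τ t hτ hτt v hv =>
        hm.lyapunov_identity hg hB hQ hR hW hid (fun t ht => (hz t ht).1) hτ hτt hv⟩
    · have h := (hm.isWeakSolution hB hg hQ hid hT).congr (fun t ht => (hz t ht.1.le).1)
        (h' := fun t => -((2 * lam) • z t) - R (Q (z t)) + Q.symm (f (Q (z t))))
        (fun t ht => by rw [(hz t ht.1.le).1, loopSource])
      rwa [hz0, Q.apply_symm_apply] at h
    · have h := hs.snd_eqOn hT hm hf hr hL.le hlip hz0 (fun t ht => (hz t ht).1)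
        (fun t ht => (hz t ht).2.1)
      exact ⟨hs.fst_eqOn hT hm hg hQ hid hf hr hL.le hlip hz0 (fun t ht => (hz t ht).1)
        (fun t ht => (hz t ht).2.1) h, h⟩
  · have hq0 : 0 ≤ ‖(Q : H →L[ℝ] H)‖ := norm_nonneg _
    have hγ' : 0 < lam - γ := sub_pos.2 hγ
    obtain ⟨δ, hδ, hfδ⟩ := hf_small ((lam - γ) * c / (‖(Q : H →L[ℝ] H)‖ + 1)) (by positivity)
    -- The a priori bound ‖Qz(t)‖ ≤ K‖y₀‖ then keeps the trajectory in the ball of radius δ, where f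
    -- is small enough for the rate γ.
    refine ⟨min ε (δ / (2 * (K + 1))), lt_min hε (by positivity), min_le_left _ _,
      fun y₀ hy₀ y z' hs t ht => ?_⟩
    obtain ⟨g, z, hz0, hg, hm, hz⟩ := hex y₀ (hy₀.trans (min_le_left _ _))
    -- Uniqueness on [0, t + 1], which has positive length even for t = 0, identifies the given
    -- solution with the constructed one at time t.
    have ht1 : 0 < t + 1 := by linarith
    have hzz := (hs _ ht1).snd_eqOn ht1 hm hf hr hL.le hlip hz0 (fun t ht => (hz t ht).1)
      (fun t ht => (hz t ht).2.1)
    have hyt := (hs _ ht1).fst_eqOn ht1 hm hg hQ hid hf hr hL.le hlip hz0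
      (fun t ht => (hz t ht).1) (fun t ht => (hz t ht).2.1) hzz ⟨ht, by linarith⟩
    have hsmall : ∀ s, 0 ≤ s →
        ‖g s‖ ≤ (lam - γ) * c / (‖(Q : H →L[ℝ] H)‖ + 1) * ‖Q (z s)‖ := fun s hs0 => by
      rw [(hz s hs0).1]
      refine hfδ _ ?_
      calc ‖Q (z s)‖ ≤ K * ‖y₀‖ := (hz s hs0).2.2
        _ ≤ (K + 1) * (δ / (2 * (K + 1))) := by
            gcongr
            · linarith
            · exact hy₀.trans (min_le_right _ _)
        _ = δ / 2 := by field_simp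
        _ < δ := half_lt_self hδ
    have hdec := hm.decay hB hg hQ hR hW hid hc hγ.le (by positivity)
      (by
        rw [div_mul_eq_mul_div, div_le_iff₀ (by positivity)]
        gcongr
        linarith)
      hsmall ht
    rw [← norm_opSqrt_symm_sq hQ, ← norm_opSqrt_symm_sq hQ, hz0, Q.apply_symm_apply] at hdec
    rw [hyt]
    refine (abs_le_of_sq_le_sq' ?_ (by positivity)).2
    rw [mul_pow, ← Real.exp_nat_mul]
    refine hdec.trans_eq ?_
    congr 2
    push_cast
    ring
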